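/- Let $p\ge 0$, $\boldsymbol\beta=(\beta_1,\dots,\beta_p)^T\in\mathbb R^p$ be such that all complex roots of $w^p=\beta_1w^{p-1}+\dots+\beta_p$ have modulus less than one, let $\nu\in\mathbb R$, and let $\mu$ be defined by $\nu=(1-\beta_1-\dots-\beta_p)\mu$. Let $G_0$ and $H$ be distribution functions of laws on $\mathbb R$ with zero means and finite variances, both twice differentiable with bounded second derivatives, let $G_0$ be symmetric about zero, and let $\Pi$ be an arbitrary probability law on $\mathbb R$. For $n\ge1$ and $\gamma,\rho\ge 0$ put $\gamma_n=\min(1,\gamma/\sqrt n)$, $\rho_n=\min(1,\rho/\sqrt n)$. For given $n,\gamma,\rho$ let $\{\varepsilon_t\}_{t\in\mathbb Z}$ be i.i.d. with distribution function $(1-\rho_n)G_0+\rho_nH$, let $\{z_t\}$ be i.i.d. with values in $\{0,1\}$ and $P(z_t=1)=\gamma_n$, let $\{\xi_t\}$ be i.i.d. with law $\Pi$, the three sequences being independent of each other, and let $\{v_t\}_{t\in\mathbb Z}$ be a stationary solution of $$v_t=\beta_1v_{t-1}+\dots+\beta_pv_{t-p}+\nu+\varepsilon_t,\qquad t\in\mathbb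 Z .$$ The observations are $y_t=v_t+z_t\xi_t$, $t=1-p,\dots,n$. Fix finite $\Gamma,R\ge0$, and let $\hat\mu_n$ (real) and $\hat{\boldsymbol\beta}_n=(\hat\beta_{1n},\dots,\hat\beta_{pn})^T$ be any random variables with $$n^{1/2}(\hat\mu_n-\mu)=O_P(1),\qquad n^{1/2}(\hat{\boldsymbol\beta}_n-\boldsymbol\beta)=O_P(1),\qquad n\to\infty,$$ uniformly in $0\le\gamma\le\Gamma$, $0\le\rho\le R$. Put $\hat u_t=y_t-\hat\mu_n$ for $t=1-p,\dots,n$, and for $t=1,\dots,n$ put $\hat\varepsilon_t=\hat u_t-\hat\beta_{1n}\hat u_{t-1}-\dots-\hat\beta_{pn}\hat u_{t-p}$. Let $$\hat G_n(x)=\frac1n\sum_{t=1}^nI(\hat\varepsilon_t\le x),\qquad G_n(x)=\frac1n\sum_{t=1}^nI(\varepsilon_t\le x),$$ $$\hat S_n(x)=\frac{\hat G_n(x)+1-\hat G_n(-x)}2,\qquad S_n(x)=\frac{G_n(x)+1-G_n(-x)}2,$$ $$\Delta(x,\Pi)=\sum_{j=0}^p\bigl[\mathsf E\,G_0(x+\beta_j\xi_1)-G_0(x)\bigr],\quad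 \beta_0=-1,\qquad \Delta_S(x,\Pi)=\frac{\Delta(x,\Pi)-\Delta(-x,\Pi)}2 .$$ Then for every $x\in\mathbb R$ and every $\delta>0$ $$\sup_{0\le\gamma\le\Gamma,\;0\le\rho\le R}P\Bigl(\bigl|n^{1/2}[\hat S_n(x)-S_n(x)]-\gamma\Delta_S(x,\Pi)\bigr|>\delta\Bigr)\to0,\qquad n\to\infty .$$ -/

import Mathlib

open MeasureTheory ProbabilityTheory Filter Topology Set

noncomputable section

/-- The characteristic roots of the autoregression with coefficients `β`, i.e. the complex roots of
`w ^ p = β₁ w ^ (p - 1) + ⋯ + β_p`, are all of modulus less than one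
(`β j` for `j : Fin p` is the coefficient with number `j + 1`). -/
def IsStableAR {p : ℕ} (β : EuclideanSpace ℝ (Fin p)) : Prop :=
  ∀ w : ℂ, w ^ p = ∑ j : Fin p, (β j : ℂ) * w ^ (p - 1 - (j : ℕ)) → ‖w‖ < 1

/-- The local level `min (1, c / √n)`, used for both the contamination and the alternative. -/
def localLevel (c : ℝ) (n : ℕ) : ℝ := min 1 (c / √(n : ℝ))

/-- The distribution function `(1 - r) G₀ + r H` of the innovations, with mixing weight `r`. -/
def mixtureCDF (G₀ H : Measure ℝ) (r x : ℝ) : ℝ := (1 - r) * cdf G₀ x + r * cdf H x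

/-- Moment condition on a law: zero mean and finite variance. -/
def IsCenteredL2 (G : Measure ℝ) : Prop := MemLp id 2 G ∧ ∫ x, x ∂G = 0

/-- Smoothness condition on a law: the distribution function is twice differentiable with bounded
second derivative. -/
def HasSmoothCDF (G : Measure ℝ) : Prop :=
  Differentiable ℝ (fun x => cdf G x) ∧ Differentiable ℝ (deriv fun x => cdf G x) ∧
    ∃ C : ℝ, ∀ x, |deriv (deriv fun x => cdf G x) x| ≤ C

/-- The autoregressive scheme behind the contaminated observations: `v` is a (strictly) stationary
solution of `v t = β₁ v (t-1) + ⋯ + β_p v (t-p) + ν + ε t`, the innovations `ε t` are i.i.d. with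
distribution function `A`, the outlier indicators `z t` are i.i.d. with values in `{0, 1}` and
`P(z t = 1) = q`, the outliers `ξ t` are i.i.d. with law `Q`, and the three sequences are
independent of each other. -/
structure IsARScheme {Ω : Type*} [MeasurableSpace Ω] (P : Measure Ω) {p : ℕ}
    (β : EuclideanSpace ℝ (Fin p)) (ν : ℝ) (A : ℝ → ℝ) (q : ℝ) (Q : Measure ℝ)
    (v ε z ξ : ℤ → Ω → ℝ) : Prop where
  measurable_v : ∀ t, Measurable (v t)
  measurable_ε : ∀ t, Measurable (ε t)
  measurable_z : ∀ t, Measurable (z t)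
  measurable_ξ : ∀ t, Measurable (ξ t)
  indep : iIndepFun (Sum.elim ε (Sum.elim z ξ)) P
  cdf_ε : ∀ t x, P.real {ω | ε t ω ≤ x} = A x
  z_values : ∀ t, ∀ᵐ ω ∂P, z t ω = 0 ∨ z t ω = 1
  z_prob : ∀ t, P.real {ω | z t ω = 1} = q
  law_ξ : ∀ t, P.map (ξ t) = Q
  recursion : ∀ t, ∀ᵐ ω ∂P,
    v t ω = ∑ j : Fin p, β j * v (t - ((j : ℤ) + 1)) ω + ν + ε t ω
  stationary : ∀ h : ℤ, IdentDistrib (fun ω t => v (t + h) ω) (fun ω t => v t ω) P P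

/-- The contaminated observations `y t = v t + z t ξ t`. -/
def observation {Ω : Type*} (v z ξ : ℤ → Ω → ℝ) (t : ℤ) (ω : Ω) : ℝ := v t ω + z t ω * ξ t ω

/-- The residual `û t - b₁ û (t-1) - ⋯ - b_p û (t-p)` with `û t = y t - m`, computed from the
path `y` with the value `m` of the mean and `b` of the coefficients. -/
def arResidual {p : ℕ} (y : ℤ → ℝ) (m : ℝ) (b : EuclideanSpace ℝ (Fin p)) (t : ℤ) : ℝ :=
  (y t - m) - ∑ j : Fin p, b j * (y (t - ((j : ℤ) + 1)) - m)

/-- The empirical distribution function of `e 1, …, e n`. -/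
def empCDF (n : ℕ) (e : ℤ → ℝ) (x : ℝ) : ℝ :=
  (n : ℝ)⁻¹ * ∑ t ∈ Finset.Icc (1 : ℤ) n, (Iic x).indicator 1 (e t)

/-- The symmetrization `(F(x) + 1 - F(-x)) / 2` of a function `F`. -/
def symCDF (F : ℝ → ℝ) (x : ℝ) : ℝ := (F x + 1 - F (-x)) / 2

/-- The shift `∑_{j=0}^p (E G₀(x + β_j ξ) - G₀(x))`, where `β₀ = -1` and `ξ` has law `Q`. -/
def outlierShift {p : ℕ} (G₀ Q : Measure ℝ) (β : EuclideanSpace ℝ (Fin p)) (x : ℝ) : ℝ :=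
  (∫ y, cdf G₀ (x + (-1) * y) ∂Q - cdf G₀ x) +
    ∑ j : Fin p, (∫ y, cdf G₀ (x + β j * y) ∂Q - cdf G₀ x)

/-- The symmetrized shift `(Δ(x) - Δ(-x)) / 2`. -/
def symShift {p : ℕ} (G₀ Q : Measure ℝ) (β : EuclideanSpace ℝ (Fin p)) (x : ℝ) : ℝ :=
  (outlierShift G₀ Q β x - outlierShift G₀ Q β (-x)) / 2

/-- `X n γ ρ = O_P(1)` as `n → ∞`, uniformly in `0 ≤ γ ≤ Γ`, `0 ≤ ρ ≤ R`. -/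
def IsUniformlyOPOne {Ω : ℕ → ℝ → ℝ → Type*} [∀ n γ ρ, MeasurableSpace (Ω n γ ρ)]
    (P : ∀ n γ ρ, Measure (Ω n γ ρ)) (Γ R : ℝ) {E : Type*} [Norm E]
    (X : ∀ n γ ρ, Ω n γ ρ → E) : Prop :=
  ∀ η : ℝ, 0 < η → ∃ M : ℝ, ∀ᶠ n in atTop, ∀ γ ∈ Icc 0 Γ, ∀ ρ ∈ Icc 0 R,
    (P n γ ρ).real {ω | M < ‖X n γ ρ ω‖} ≤ η

end

/-! Write `v = u + μ`. Substituting the recursion for `u` into a residual gives the exact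
equivalence `arResidual_le_iff`: the residual is at most `x` iff `ε t` is at most `x` plus a shift.
The shift is the sum of the outliers in the window `t, …, t - p`, weighted by `-1, β₁, …, β_p`, plus
`n^{-1/2}` times a linear form in the contaminated lagged values. The coefficients `τ₀, τ` of this
form are the scaled estimation errors. So `√n (Ĝ_n - G_n)(x)` is the sum `shiftedIncrement`
evaluated at the random parameter `(τ₀, τ)`.

For a fixed parameter the sum splits into negligible pieces and a main term
(`vanishes_shiftedIncrement`). Indicators minus their conditional expectations form a martingale
difference sequence; each conditional variance is at most an increment of the distribution function,
so the normalized sum vanishes (`vanishes_noise`). Replacing the mixture by `G₀` costs a factor of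
order `n^{-1/2}` times small increments (`vanishes_alternative`). The remaining increment of `G₀` is
expanded according to the number of outliers in the window (`abs_increment_sub_le`): none gives a
first order Taylor term, one gives `G₀(x + β_j ξ) - G₀(x)`, and two or more have probability of
order `1/n`. The one-outlier terms add up to `γ Δ(x)` by a variance bound (`vanishes_outliers`). The
Taylor terms leave `G₀'(x) τ₀`, because sample means of `u` vanish (`vanishes_mean`).

For the random parameter, tightness restricts attention to a compact ball, which is covered by
finitely many small balls. Monotonicity of indicators in the threshold brackets the random sum
between sums with a fixed centre and a band `± l (1 + ∑ |U_j|)`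
(`vanishes_shiftedIncrement_random`). The parameter may therefore depend on the whole sample.

Finally `G₀'` is even, since `G₀` is symmetric, and `τ₀` is the same at `x` and `-x`. Symmetrization
thus cancels the contribution of the estimation error. Uniformity in `γ, ρ` is obtained by proving
convergence along arbitrary parameter sequences. -/

/-! ### Companion operator and moving-average expansion -/

/-- The companion operator of the autoregression with coefficients `β`. -/
noncomputable def companion {p : ℕ} (β : EuclideanSpace ℝ (Fin p)) :
    (Fin p → ℂ) →L[ℂ] (Fin p → ℂ) :=
  LinearMap.toContinuousLinearMap
    { toFun := fun x i =>
        if (i : ℕ) = 0 then ∑ j : Fin p, (β j : ℂ) * x j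
        else x ⟨(i : ℕ) - 1, lt_of_le_of_lt (Nat.sub_le _ _) i.2⟩
      map_add' := by
        intro x y
        funext i
        by_cases h : (i : ℕ) = 0 <;> simp [h, mul_add, Finset.sum_add_distrib]
      map_smul' := by
        intro c x
        funext i
        by_cases h : (i : ℕ) = 0
        · simp only [h, if_true, Pi.smul_apply, smul_eq_mul, RingHom.id_apply, Finset.mul_sum]
          exact Finset.sum_congr rfl fun j _ => by ring
        · simp [h] }

theorem companion_apply {p : ℕ} (β : EuclideanSpace ℝ (Fin p)) (x : Fin p → ℂ) (i : Fin p) :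
    companion β x i = if (i : ℕ) = 0 then ∑ j : Fin p, (β j : ℂ) * x j
      else x ⟨(i : ℕ) - 1, lt_of_le_of_lt (Nat.sub_le _ _) i.2⟩ := rfl

/-- Eigenvalues of the companion operator are characteristic roots. -/
theorem companion_eigenvalue {p : ℕ} (β : EuclideanSpace ℝ (Fin p)) {x : Fin p → ℂ} (hx : x ≠ 0)
    {w : ℂ} (hw : companion β x = w • x) :
    w ^ p = ∑ j : Fin p, (β j : ℂ) * w ^ (p - 1 - (j : ℕ)) := by
  rcases Nat.eq_zero_or_pos p with rfl | hp
  · exact absurd (Subsingleton.elim x 0) hx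
  set a : ℂ := x ⟨p - 1, by omega⟩ with ha
  -- The lower rows of the operator only shift, so an eigenvector is determined by its last
  -- coordinate `a`; the top row then becomes the characteristic equation multiplied by `a`.
  have hstep : ∀ k : ℕ, ∀ hk : k < p, x ⟨p - 1 - k, by omega⟩ = w ^ k * a := by
    intro k
    induction k with
    | zero => intro _; simp [ha]
    | succ k ih =>
      intro hk
      have h := congrFun hw ⟨p - 1 - k, by omega⟩
      rw [companion_apply] at h
      have h0 : ¬ (p - 1 - k = 0) := by omega
      simp only [h0, if_false, Pi.smul_apply, smul_eq_mul] at h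
      rw [ih (by omega)] at h
      have : x ⟨p - 1 - (k + 1), by omega⟩ = x ⟨p - 1 - k - 1, by omega⟩ := by
        congr 1
      rw [this, h]
      ring
  have hval : ∀ j : Fin p, x j = w ^ (p - 1 - (j : ℕ)) * a := by
    intro j
    rw [← hstep (p - 1 - (j : ℕ)) (by omega)]
    congr 1
    ext
    simp only
    omega
  have ha0 : a ≠ 0 := by
    intro h
    apply hx
    funext j
    rw [hval j, h]
    simp
  have h := congrFun hw ⟨0, hp⟩
  rw [companion_apply] at h
  simp only [if_true, Pi.smul_apply, smul_eq_mul] at h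
  rw [hval ⟨0, hp⟩] at h
  have h2 : ∑ j : Fin p, (β j : ℂ) * x j = (∑ j : Fin p, (β j : ℂ) * w ^ (p - 1 - (j : ℕ))) * a := by
    rw [Finset.sum_mul]
    exact Finset.sum_congr rfl fun j _ => by rw [hval j]; ring
  rw [h2] at h
  apply mul_right_cancel₀ ha0
  rw [h, ← mul_assoc, ← pow_succ']
  congr 2
  simp only
  omega

/-- Stability puts every eigenvalue in the open unit disc, so in finite dimension the spectral
radius is below one, and Gelfand's formula makes the powers decay geometrically. The case `p = 0` is
separated because the underlying space is then trivial. -/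
theorem summable_norm_companion_pow {p : ℕ} {β : EuclideanSpace ℝ (Fin p)} (hβ : IsStableAR β) :
    Summable fun k : ℕ => ‖companion β ^ k‖ := by
  rcases Nat.eq_zero_or_pos p with rfl | hp
  · have : ∀ k : ℕ, ‖companion β ^ k‖ = 0 := fun k => by
      rw [norm_eq_zero]; exact ContinuousLinearMap.ext fun x => Subsingleton.elim _ _
    simp [this, summable_zero]
  have : Nonempty (Fin p) := ⟨⟨0, hp⟩⟩
  have : Nontrivial (Fin p → ℂ) := Function.nontrivial
  have hsp : ∀ w ∈ spectrum ℂ (companion β), ‖w‖₊ < 1 := by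
    intro w hw
    have h1 : Module.End.HasEigenvalue (companion β : (Fin p → ℂ) →ₗ[ℂ] (Fin p → ℂ)) w := by
      rw [Module.End.hasEigenvalue_iff_mem_spectrum]
      intro hu
      apply hw
      have : IsUnit (algebraMap ℂ ((Fin p → ℂ) →L[ℂ] (Fin p → ℂ)) w - companion β) := by
        rw [ContinuousLinearMap.isUnit_iff_bijective]
        rw [spectrum.mem_resolventSet_iff, Module.End.isUnit_iff] at hu
        exact hu
      exact this
    obtain ⟨x, hx⟩ := h1.exists_hasEigenvector
    have := hβ w (companion_eigenvalue β hx.2 hx.apply_eq_smul)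
    exact_mod_cast this
  have hr := spectrum.spectralRadius_lt_of_forall_lt (companion β) hsp
  obtain ⟨r, hr1, hr2⟩ := ENNReal.lt_iff_exists_nnreal_btwn.1 hr
  have hG := spectrum.pow_nnnorm_pow_one_div_tendsto_nhds_spectralRadius (companion β)
  have hev := hG.eventually (gt_mem_nhds hr1)
  have hr2' : (r : ℝ) < 1 := by exact_mod_cast hr2
  refine summable_of_isBigO_nat (g := fun k => (r : ℝ) ^ k)
    (summable_geometric_of_lt_one r.2 hr2') ?_
  refine Asymptotics.IsBigO.of_bound 1 ?_
  filter_upwards [hev, eventually_gt_atTop 0] with k hk hk0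
  have hk' : (‖companion β ^ k‖₊ : ENNReal) ≤ (r : ENNReal) ^ k := by
    have h3 : ((‖companion β ^ k‖₊ : ENNReal) ^ (1 / k : ℝ)) ^ (k : ℝ) ≤ (r : ENNReal) ^ (k : ℝ) :=
      ENNReal.rpow_le_rpow hk.le (by positivity)
    rw [← ENNReal.rpow_mul, one_div, inv_mul_cancel₀ (by positivity), ENNReal.rpow_one,
      ENNReal.rpow_natCast] at h3
    exact h3
  have hk2 : ‖companion β ^ k‖₊ ≤ r ^ k := by exact_mod_cast hk'
  have hk3 : ‖companion β ^ k‖ ≤ (r : ℝ) ^ k := by exact_mod_cast hk2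
  simpa using hk3

/-- Moving-average expansion of an autoregression over the last `k + 1` innovations, with a
remainder that involves the earlier values only through vanishing coefficients. -/
theorem IsStableAR.exists_expansion {p : ℕ} {β : EuclideanSpace ℝ (Fin p)} (hβ : IsStableAR β) :
    ∃ (ψ : ℕ → ℝ) (κ : ℕ → Fin p → ℝ), Summable (fun i => |ψ i|) ∧
      (∀ l, Tendsto (fun k => κ k l) atTop (𝓝 0)) ∧
      ∀ u e : ℤ → ℝ, (∀ t, u t = ∑ j : Fin p, β j * u (t - ((j : ℤ) + 1)) + e t) →
        ∀ (t : ℤ) (k : ℕ), u t = ∑ i ∈ Finset.range (k + 1), ψ i * e (t - i) +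
          ∑ l : Fin p, κ k l * u (t - 1 - k - l) := by
  set T := companion β with hT
  have hsum := summable_norm_companion_pow hβ
  -- The impulse by which a new innovation enters the state vector. The state space is complex for
  -- the sake of the spectral argument; all coefficients of interest are recovered as real parts.
  let b : Fin p → ℂ := fun i => if (i : ℕ) = 0 then 1 else 0
  let ψ₀ : ℕ → Fin p → ℝ := fun i j => ((T ^ i) b j).re
  let κ₀ : ℕ → Fin p → Fin p → ℝ := fun k j l => ((T ^ k) (Pi.single l 1) j).re
  have hbd : ∀ (x : Fin p → ℂ) (k : ℕ) (j : Fin p), |((T ^ k) x j).re| ≤ ‖T ^ k‖ * ‖x‖ := by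
    intro x k j
    exact (Complex.abs_re_le_norm _).trans ((norm_le_pi_norm _ j).trans ((T ^ k).le_opNorm x))
  -- The recursion is applied once to `u t`, and only the lagged state is iterated `k` times: `V
  -- (t-1) = T^k V (t-1-k) + ∑_{i<k} e (t-1-i) T^i b`. Reading `u t` off the recursion rather than
  -- off the state also covers `p = 0`.
  refine ⟨fun i => if i = 0 then 1 else ∑ j, β j * ψ₀ (i - 1) j, fun k l => ∑ j, β j * κ₀ k j l,
    ?_, ?_, ?_⟩
  · rw [← summable_nat_add_iff 1]
    refine Summable.of_nonneg_of_le (fun _ => abs_nonneg _) (fun i => ?_)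
      (hsum.mul_right (∑ j, |β j| * ‖b‖))
    simp only [Nat.add_eq_zero_iff, one_ne_zero, and_false, if_false, Nat.add_sub_cancel]
    refine (Finset.abs_sum_le_sum_abs _ _).trans ?_
    rw [Finset.mul_sum]
    refine Finset.sum_le_sum fun j _ => ?_
    rw [abs_mul]
    have := mul_le_mul_of_nonneg_left (hbd b i j) (abs_nonneg (β j))
    calc _ ≤ _ := this
      _ = _ := by ring
  · intro l
    have : Tendsto (fun k => ∑ j, β j * κ₀ k j l) atTop (𝓝 (∑ j : Fin p, β j * 0)) := by
      refine tendsto_finsetSum _ fun j _ => Tendsto.const_mul _ ?_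
      refine squeeze_zero_norm (fun k => hbd (Pi.single l 1) k j) ?_
      simpa using hsum.tendsto_atTop_zero.mul_const ‖(Pi.single l 1 : Fin p → ℂ)‖
    simpa using this
  · intro u e hu t k
    let V : ℤ → Fin p → ℂ := fun t i => (u (t - i) : ℂ)
    have hV : ∀ t, V t = T (V (t - 1)) + (e t : ℂ) • b := by
      intro t
      funext i
      rw [Pi.add_apply, hT, companion_apply]
      by_cases h : (i : ℕ) = 0
      · simp only [V, h, if_true, Pi.smul_apply, smul_eq_mul, b, mul_one]
        simp only [Nat.cast_zero, sub_zero]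
        rw [hu t]
        push_cast
        congr 1
        refine Finset.sum_congr rfl fun j _ => ?_
        congr 3
        ring
      · simp only [V, h, if_false, Pi.smul_apply, smul_eq_mul, b, mul_zero, add_zero]
        congr 2
        have : 1 ≤ (i : ℕ) := by omega
        push_cast [Nat.cast_sub this]
        ring
    have hVk : ∀ (k : ℕ) (t : ℤ), V t = (T ^ k) (V (t - k)) +
        ∑ i ∈ Finset.range k, (e (t - i) : ℂ) • (T ^ i) b := by
      intro k
      induction k with
      | zero => intro t; simp
      | succ k ih =>
        intro t
        rw [ih t, hV (t - k), map_add, Finset.sum_range_succ, pow_succ, map_smul]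
        have : t - (k : ℤ) - 1 = t - ((k + 1 : ℕ) : ℤ) := by push_cast; ring
        rw [this]
        simp only [mul_apply_eq_comp]
        abel
    have hlin : ∀ (k : ℕ) (s : ℤ) (j : Fin p),
        ((T ^ k) (V s) j).re = ∑ l : Fin p, κ₀ k j l * u (s - l) := by
      intro k s j
      have h1 : V s = ∑ l : Fin p, (u (s - l) : ℂ) • (Pi.single l 1 : Fin p → ℂ) := by
        funext i
        simp [V, Finset.sum_apply, Pi.single_apply]
      rw [h1, map_sum, Finset.sum_apply, Complex.re_sum]
      refine Finset.sum_congr rfl fun l _ => ?_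
      rw [map_smul, Pi.smul_apply, smul_eq_mul, Complex.re_ofReal_mul, mul_comm]
    have hmain : ∀ j : Fin p, u (t - 1 - j) = ∑ i ∈ Finset.range k, ψ₀ i j * e (t - 1 - i) +
        ∑ l : Fin p, κ₀ k j l * u (t - 1 - k - l) := by
      intro j
      have h1 : u (t - 1 - j) = (V (t - 1) j).re := by simp [V]
      rw [h1, hVk k (t - 1), Pi.add_apply, Complex.add_re, hlin, add_comm, Finset.sum_apply,
        Complex.re_sum]
      congr 1
      refine Finset.sum_congr rfl fun i _ => ?_
      rw [Pi.smul_apply, smul_eq_mul, Complex.re_ofReal_mul, mul_comm]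
    have h2 : ∀ j : Fin p, u (t - ((j : ℤ) + 1)) = u (t - 1 - j) := fun j => by
      congr 1; ring
    rw [hu t, Finset.sum_range_succ']
    simp only [h2, hmain, mul_add, Finset.sum_add_distrib]
    simp only [Finset.mul_sum, Finset.sum_mul]
    rw [Finset.sum_comm, Finset.sum_comm (s := Finset.univ (α := Fin p)) (t := Finset.univ)]
    have h3 : ∀ i : ℕ, t - 1 - (i : ℤ) = t - ((i + 1 : ℕ) : ℤ) := fun i => by push_cast; ring
    simp only [h3, mul_assoc]
    simp only [Nat.add_eq_zero_iff, one_ne_zero, and_false, if_false, if_true, Nat.add_sub_cancel,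
      Nat.cast_zero, sub_zero, one_mul, Finset.sum_mul, mul_assoc]
    ring

/-- Otherwise `w = 1` would be a characteristic root. Division by this number recovers the sample
mean of the autoregression from that of the innovations. -/
theorem IsStableAR.one_sub_sum_ne_zero {p : ℕ} {β : EuclideanSpace ℝ (Fin p)}
    (hβ : IsStableAR β) : 1 - ∑ j : Fin p, β j ≠ 0 := by
  intro h
  have h1 : (1 : ℂ) ^ p = ∑ j : Fin p, (β j : ℂ) * 1 ^ (p - 1 - (j : ℕ)) := by
    simp only [one_pow, mul_one]
    have : (1 : ℝ) = ∑ j : Fin p, β j := by linarith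
    exact_mod_cast this
  have := hβ 1 h1
  simp at this

/-! ### Convergence in probability on varying spaces -/

/-- Convergence to zero in probability of random variables defined on varying spaces. -/
def VanishesInProb {Ω : ℕ → Type*} [∀ n, MeasurableSpace (Ω n)] (P : ∀ n, Measure (Ω n))
    (X : ∀ n, Ω n → ℝ) : Prop :=
  ∀ δ : ℝ, 0 < δ → Tendsto (fun n => P n {ω | δ < |X n ω|}) atTop (𝓝 0)

namespace VanishesInProb

variable {Ω : ℕ → Type*} [∀ n, MeasurableSpace (Ω n)] {P : ∀ n, Measure (Ω n)}
  {X Y : ∀ n, Ω n → ℝ}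

theorem mono (hY : VanishesInProb P Y) (h : ∀ᶠ n in atTop, ∀ᵐ ω ∂P n, |X n ω| ≤ |Y n ω|) :
    VanishesInProb P X := by
  intro δ hδ
  refine tendsto_of_tendsto_of_tendsto_of_le_of_le' tendsto_const_nhds (hY δ hδ)
    (Eventually.of_forall fun _ => zero_le) ?_
  filter_upwards [h] with n hn
  refine measure_mono_ae ?_
  filter_upwards [hn] with ω hω h
  exact lt_of_lt_of_le h hω

theorem congr (hY : VanishesInProb P Y) (h : ∀ᶠ n in atTop, ∀ᵐ ω ∂P n, X n ω = Y n ω) :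
    VanishesInProb P X :=
  hY.mono (h.mono fun _ hn => hn.mono fun _ hω => by rw [hω])

theorem add (hX : VanishesInProb P X) (hY : VanishesInProb P Y) :
    VanishesInProb P (fun n ω => X n ω + Y n ω) := by
  intro δ hδ
  have h := (hX (δ / 2) (by positivity)).add (hY (δ / 2) (by positivity))
  rw [add_zero] at h
  refine tendsto_of_tendsto_of_tendsto_of_le_of_le tendsto_const_nhds h
    (fun _ => zero_le) fun n => ?_
  refine (measure_mono ?_).trans (measure_union_le _ _)
  intro ω hω
  simp only [mem_ofPred_eq, mem_union] at hω ⊢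
  by_contra hc
  push Not at hc
  have := abs_add_le (X n ω) (Y n ω)
  linarith [hc.1, hc.2]

theorem const_mul (c : ℝ) (hX : VanishesInProb P X) :
    VanishesInProb P (fun n ω => c * X n ω) := by
  intro δ hδ
  have h := hX (δ / (|c| + 1)) (by positivity)
  refine tendsto_of_tendsto_of_tendsto_of_le_of_le tendsto_const_nhds h
    (fun _ => zero_le) fun n => ?_
  refine measure_mono ?_
  intro ω hω
  simp only [mem_ofPred_eq] at hω ⊢
  rw [abs_mul] at hω
  rw [div_lt_iff₀ (by positivity)]
  nlinarith [abs_nonneg (X n ω)]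

theorem sub (hX : VanishesInProb P X) (hY : VanishesInProb P Y) :
    VanishesInProb P (fun n ω => X n ω - Y n ω) :=
  (hX.add (hY.const_mul (-1))).congr
    (Eventually.of_forall fun _ => Eventually.of_forall fun _ => by ring)

theorem zero : VanishesInProb P (fun _ _ => 0) := by
  intro δ hδ
  simp [not_lt.2 hδ.le]

theorem sum {ι : Type*} (s : Finset ι) {Z : ι → ∀ n, Ω n → ℝ}
    (h : ∀ i ∈ s, VanishesInProb P (Z i)) : VanishesInProb P (fun n ω => ∑ i ∈ s, Z i n ω) := by
  classical
  induction s using Finset.induction_on with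
  | empty => simpa using zero
  | insert a s ha ih =>
    simp only [Finset.sum_insert ha]
    exact (h a (Finset.mem_insert_self _ _)).add
      (ih fun i hi => h i (Finset.mem_insert_of_mem hi))

theorem of_integral_abs {b : ℕ → ℝ} (hb : Tendsto b atTop (𝓝 0))
    (h : ∀ᶠ n in atTop, Integrable (X n) (P n) ∧ ∫ ω, |X n ω| ∂P n ≤ b n) :
    VanishesInProb P X := by
  intro δ hδ
  have hb' : Tendsto (fun n => ENNReal.ofReal (b n / δ)) atTop (𝓝 0) := by
    have := ENNReal.tendsto_ofReal (hb.div_const δ)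
    simpa using this
  refine tendsto_of_tendsto_of_tendsto_of_le_of_le' tendsto_const_nhds hb'
    (Eventually.of_forall fun _ => zero_le) ?_
  filter_upwards [h] with n hn
  have h1 := meas_ge_le_lintegral_div (μ := P n) (f := fun ω => ENNReal.ofReal |X n ω|)
    hn.1.abs.aemeasurable.ennreal_ofReal (ε := ENNReal.ofReal δ) (by simpa using hδ) (by simp)
  rw [← ofReal_integral_eq_lintegral_ofReal hn.1.abs (Eventually.of_forall fun _ => abs_nonneg _),
    ← ENNReal.ofReal_div_of_pos hδ] at h1
  refine (measure_mono ?_).trans (h1.trans (ENNReal.ofReal_le_ofReal (by gcongr; exact hn.2)))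
  intro ω hω
  exact ENNReal.ofReal_le_ofReal (le_of_lt hω)

theorem of_integral_sq {b : ℕ → ℝ} (hb : Tendsto b atTop (𝓝 0))
    (h : ∀ᶠ n in atTop, Integrable (fun ω => X n ω ^ 2) (P n) ∧ ∫ ω, X n ω ^ 2 ∂P n ≤ b n) :
    VanishesInProb P X := by
  have h2 : VanishesInProb P (fun n ω => X n ω ^ 2) := by
    refine of_integral_abs hb (h.mono fun n hn => ⟨hn.1, ?_⟩)
    simpa only [abs_pow, sq_abs] using hn.2
  intro δ hδ
  refine (h2 (δ ^ 2) (by positivity)).congr fun n => ?_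
  congr 1
  ext ω
  simp only [mem_ofPred_eq, abs_pow, sq_abs]
  rw [← sq_abs (X n ω)]
  exact ⟨fun h => lt_of_pow_lt_pow_left₀ 2 (abs_nonneg _) h,
    fun h => pow_lt_pow_left₀ h hδ.le two_ne_zero⟩

end VanishesInProb

/-! ### Causality of the stationary solution -/

/-- The sigma-algebra generated by the innovations up to time `t`. -/
@[reducible]
def pastSigma {Ω : Type*} (ε : ℤ → Ω → ℝ) (t : ℤ) : MeasurableSpace Ω :=
  ⨆ s ∈ Iic t, MeasurableSpace.comap (ε s) inferInstance

theorem measurable_pastSigma {Ω : Type*} {ε : ℤ → Ω → ℝ} {s t : ℤ} (h : s ≤ t) :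
    Measurable[pastSigma ε t] (ε s) := by
  have h1 : MeasurableSpace.comap (ε s) inferInstance ≤ pastSigma ε t :=
    le_iSup₂_of_le s h le_rfl
  exact (comap_measurable (ε s)).mono h1 le_rfl

/-- A stationary process satisfying a stable autoregression is causal: it has a modification
adapted to the innovations, with second moments controlled by those of the innovations. -/
theorem IsStableAR.exists_causal_modification {p : ℕ} {β : EuclideanSpace ℝ (Fin p)}
    (hβ : IsStableAR β) : ∃ B : ℝ, 0 ≤ B ∧ ∀ {Ω : Type*} [MeasurableSpace Ω] (P : Measure Ω)
      [IsProbabilityMeasure P] (u ε : ℤ → Ω → ℝ) (σ : ℝ), 0 ≤ σ → (∀ t, Measurable (u t)) →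
      (∀ t, Measurable (ε t)) → (∀ t, eLpNorm (ε t) 2 P ≤ ENNReal.ofReal σ) →
      (∀ t, IdentDistrib (u t) (u 0) P P) →
      (∀ t, ∀ᵐ ω ∂P, u t ω = ∑ j : Fin p, β j * u (t - ((j : ℤ) + 1)) ω + ε t ω) →
      ∃ u' : ℤ → Ω → ℝ, (∀ t, Measurable[pastSigma ε t] (u' t)) ∧
        (∀ t, u' t =ᵐ[P] u t) ∧ ∀ t, eLpNorm (u t) 2 P ≤ ENNReal.ofReal (B * σ) := by
  obtain ⟨ψ, κ, hψ, hκ, hexp⟩ := hβ.exists_expansion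
  refine ⟨∑' i, |ψ i|, tsum_nonneg fun _ => abs_nonneg _, ?_⟩
  intro Ω _ P _ u ε σ hσ hu hε hεσ hid hrec
  have hrec' := ae_all_iff.2 hrec
  have key : ∀ t, ∃ ut : Ω → ℝ, Measurable[pastSigma ε t] ut ∧ ut =ᵐ[P] u t ∧
      eLpNorm (u t) 2 P ≤ ENNReal.ofReal ((∑' i, |ψ i|) * σ) := by
    intro t
    let S : ℕ → Ω → ℝ := fun k ω => ∑ i ∈ Finset.range (k + 1), ψ i * ε (t - i) ω
    have hSm : ∀ k, Measurable[pastSigma ε t] (S k) := fun k => by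
      refine @Finset.measurable_fun_sum ℝ ℕ Ω _ _ _ (pastSigma ε t) _ _ fun i _ => ?_
      have h0 : t - (i : ℤ) ≤ t := by omega
      exact (measurable_const_mul (ψ i)).comp (measurable_pastSigma h0)
    have hSm' : ∀ k, Measurable (S k) := fun k =>
      Finset.measurable_fun_sum _ fun i _ => (hε _).const_mul (ψ i)
    have hR : VanishesInProb (fun _ : ℕ => P)
        (fun k ω => ∑ l : Fin p, κ k l * u (t - 1 - k - l) ω) := by
      refine VanishesInProb.sum _ fun l _ => ?_
      -- Each lagged value has the law of `u 0`, so the remainder may be compared in law with `κ k l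
      -- * u 0`, which tends to zero pointwise. No moment of `u` is needed.
      have h0 : TendstoInMeasure P (fun k ω => κ k l * u 0 ω) atTop (fun _ => 0) := by
        refine tendstoInMeasure_of_tendsto_ae
          (fun k => ((hu 0).const_mul _).aestronglyMeasurable) ?_
        refine Eventually.of_forall fun ω => ?_
        simpa using (hκ l).mul_const (u 0 ω)
      intro δ hδ
      rw [tendstoInMeasure_iff_norm] at h0
      refine tendsto_of_tendsto_of_tendsto_of_le_of_le tendsto_const_nhds (h0 δ hδ)
        (fun _ => zero_le) fun k => ?_
      have h1 := ((hid (t - 1 - k - l)).comp (u := fun y : ℝ => κ k l * y)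
        (measurable_const_mul _)).measure_mem_eq (s := {y | δ < |y|})
        (measurableSet_lt measurable_const measurable_id.abs)
      refine (le_of_eq h1).trans (measure_mono ?_)
      intro ω hω
      simp only [mem_preimage, mem_ofPred_eq, Function.comp] at hω
      simpa using hω.le
    have hS : TendstoInMeasure P S atTop (u t) := by
      rw [tendstoInMeasure_iff_norm]
      intro δ hδ
      refine tendsto_of_tendsto_of_tendsto_of_le_of_le tendsto_const_nhds
        (hR (δ / 2) (by positivity)) (fun _ => zero_le) fun k => ?_
      refine measure_mono_ae ?_
      filter_upwards [hrec'] with ω hω h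
      have h1 := hexp (fun s => u s ω) (fun s => ε s ω) hω t k
      have h2 : S k ω = ∑ i ∈ Finset.range (k + 1), ψ i * ε (t - i) ω := rfl
      have h : δ ≤ ‖S k ω - u t ω‖ := h
      change δ / 2 < |_|
      rw [h1, h2, sub_add_cancel_left, norm_neg, Real.norm_eq_abs] at h
      linarith
    obtain ⟨ns, -, hns⟩ := hS.exists_seq_tendsto_ae
    -- The partial sums converge almost surely only along a subsequence and off a null set. Their
    -- limsup is nevertheless measurable for the past itself, with no completion. The second moment
    -- of `u t` follows by lower semicontinuity of the norm, with constant `∑ |ψ i|`.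
    refine ⟨fun ω => limsup (fun i => S (ns i) ω) atTop, ?_, ?_, ?_⟩
    · exact Measurable.limsup fun i => hSm (ns i)
    · filter_upwards [hns] with ω hω
      exact hω.limsup_eq
    · refine Lp.eLpNorm_le_of_ae_tendsto (Eventually.of_forall fun i => ?_)
        (fun i => (hSm' (ns i)).aestronglyMeasurable) hns
      have h4 : S (ns i) = ∑ i ∈ Finset.range (ns i + 1), ψ i • ε (t - i) := by
        funext ω
        simp [S, Finset.sum_apply]
      rw [h4]
      refine (eLpNorm_sum_le (fun i _ => ((hε _).const_smul (ψ i)).aestronglyMeasurable)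
        (by norm_num)).trans ?_
      have h3 : ∀ i : ℕ, eLpNorm (ψ i • ε (t - i)) 2 P ≤ ENNReal.ofReal (|ψ i| * σ) := by
        intro i
        rw [eLpNorm_const_smul, ENNReal.ofReal_mul (abs_nonneg _), Real.enorm_eq_ofReal_abs]
        gcongr
        exact hεσ _
      refine (Finset.sum_le_sum fun i _ => h3 i).trans ?_
      rw [← ENNReal.ofReal_sum_of_nonneg fun i _ => by positivity, ← Finset.sum_mul]
      exact ENNReal.ofReal_le_ofReal
        (mul_le_mul_of_nonneg_right (hψ.sum_le_tsum _ fun i _ => abs_nonneg _) hσ)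
  choose u' h1 h2 h3 using key
  exact ⟨u', h1, h2, h3⟩

/-! ### Smooth distribution functions -/

theorem abs_cdf_sub_le_one (G : Measure ℝ) (x y : ℝ) : |cdf G x - cdf G y| ≤ 1 := by
  rw [abs_le]
  constructor <;> linarith [cdf_nonneg G x, cdf_nonneg G y, cdf_le_one G x, cdf_le_one G y]

/-- A distribution function with bounded second derivative is Lipschitz and has a first order
Taylor expansion with a uniform quadratic remainder. -/
theorem HasSmoothCDF.exists_bounds {G : Measure ℝ} (hG : HasSmoothCDF G) :
    ∃ K : ℝ, 0 ≤ K ∧ (∀ x, |deriv (fun y => cdf G y) x| ≤ K) ∧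
      (∀ x y, |cdf G y - cdf G x| ≤ K * |y - x|) ∧
      ∀ x h, |cdf G (x + h) - cdf G x - h * deriv (fun y => cdf G y) x| ≤ K * h ^ 2 := by
  obtain ⟨h1, h2, C, hC⟩ := hG
  have hC0 : 0 ≤ C := (abs_nonneg _).trans (hC 0)
  set g := deriv (fun y => cdf G y) with hg
  have hlip : ∀ x y, |g y - g x| ≤ C * |y - x| := fun x y =>
    Convex.norm_image_sub_le_of_norm_deriv_le (s := univ) (f := g) (fun z _ => h2 z)
      (fun z _ => hC z) convex_univ (mem_univ x) (mem_univ y)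
  have hmvt : ∀ x y, x < y → ∃ c ∈ Ioo x y, g c = (cdf G y - cdf G x) / (y - x) := fun x y hxy =>
    exists_deriv_eq_slope _ hxy h1.continuous.continuousOn h1.differentiableOn
  -- On `[x, x + 1]` the distribution function rises by at most one, so the density is at most one
  -- at some point there; the Lipschitz bound carries this to `x` at cost `C`.
  have hgb : ∀ x, |g x| ≤ 1 + C := by
    intro x
    obtain ⟨c, hc, hgc⟩ := hmvt x (x + 1) (by linarith)
    have h3 : |g c| ≤ 1 := by
      rw [hgc]
      simpa using abs_cdf_sub_le_one G (x + 1) x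
    have h4 := hlip c x
    have h5 : |x - c| ≤ 1 := by
      rw [abs_le]
      constructor <;> linarith [hc.1, hc.2]
    have h6 : |g x| ≤ |g c| + |g x - g c| := by
      have := abs_add_le (g c) (g x - g c)
      simpa using this
    nlinarith
  refine ⟨1 + C, by positivity, hgb, fun x y => ?_, fun x h => ?_⟩
  · exact Convex.norm_image_sub_le_of_norm_deriv_le (s := univ) (f := fun y => cdf G y)
      (fun z _ => h1 z) (fun z _ => hgb z) convex_univ (mem_univ x) (mem_univ y)
  -- The Taylor remainder is controlled by the mean value inequality applied to `z ↦ G(x + z) - z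
  -- g(x)`, whose derivative is at most `C |h|` between `0` and `h`.
  · have hd : ∀ z, HasDerivAt (fun z => cdf G (x + z) - z * g x) (g (x + z) - g x) z := by
      intro z
      have h3 : HasDerivAt (fun z => cdf G (x + z)) (g (x + z)) z :=
        HasDerivAt.comp_const_add x z (h1 (x + z)).hasDerivAt
      have h4 : HasDerivAt (fun z => z * g x) (g x) z := by
        simpa using (hasDerivAt_id z).mul_const (g x)
      exact h3.sub h4
    have h5 := Convex.norm_image_sub_le_of_norm_hasDerivWithin_le (s := uIcc 0 h)
      (f := fun z => cdf G (x + z) - z * g x) (f' := fun z => g (x + z) - g x) (C := C * |h|)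
      (fun z _ => (hd z).hasDerivWithinAt) (fun z hz => ?_) (convex_uIcc 0 h)
      left_mem_uIcc right_mem_uIcc
    · simp only [add_zero, zero_mul, sub_zero, Real.norm_eq_abs] at h5
      have h6 : cdf G (x + h) - cdf G x - h * g x = cdf G (x + h) - h * g x - cdf G x := by ring
      rw [h6]
      refine h5.trans ?_
      rw [mul_assoc, ← sq, sq_abs]
      nlinarith [sq_nonneg h]
    · have h7 := hlip x (x + z)
      rw [add_sub_cancel_left] at h7
      refine h7.trans (mul_le_mul_of_nonneg_left ?_ hC0)
      have := abs_sub_left_of_mem_uIcc hz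
      simpa using this

/-- The derivative of the distribution function of a symmetric law is even. -/
theorem HasSmoothCDF.deriv_neg {G : Measure ℝ} [IsProbabilityMeasure G] (hG : HasSmoothCDF G)
    (hsymm : G.map (fun x => -x) = G) (x : ℝ) :
    deriv (fun y => cdf G y) (-x) = deriv (fun y => cdf G y) x := by
  have hcont : Continuous fun y => cdf G y := hG.1.continuous
  -- Continuity excludes atoms, so symmetry gives `G(-y) = 1 - G(y)` for every `y`, and
  -- differentiating this identity shows that the density is even.
  have hatom : ∀ y, G {y} = 0 := by
    intro y
    have h := (cdf G).measure_singleton y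
    rw [measure_cdf] at h
    rw [h, (hcont.continuousAt (x := y)).continuousWithinAt.leftLim_eq]
    simp
  have hrefl : ∀ y, cdf G (-y) = 1 - cdf G y := by
    intro y
    have h1 : G (Iic (-y)) = G (Ici y) := by
      conv_lhs => rw [← hsymm]
      rw [Measure.map_apply measurable_neg measurableSet_Iic]
      congr 1
      ext z
      simp
    have h2 : G (Ici y) = G (Ioi y) := by
      rw [← Ioi_union_left]
      refine le_antisymm ((measure_union_le _ _).trans ?_) (measure_mono subset_union_left)
      rw [hatom, add_zero]
    rw [cdf_eq_real, cdf_eq_real, measureReal_def, h1, h2, ← measureReal_def, ← compl_Iic,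
      probReal_compl_eq_one_sub measurableSet_Iic]
  have h3 : (fun y => cdf G y) = fun y => 1 - cdf G (-y) := by
    funext y
    rw [hrefl y]
    ring
  conv_rhs => rw [h3]
  rw [deriv_const_sub, deriv_comp_neg (fun y => cdf G y) x, neg_neg]

/-! ### Indicator noise as a martingale difference -/

/-- The centred increment of the empirical indicator at a random threshold. -/
noncomputable def indicatorNoise (L : Measure ℝ) (x d e : ℝ) : ℝ :=
  (Iic (x + d)).indicator 1 e - (Iic x).indicator 1 e - (cdf L (x + d) - cdf L x)

theorem measurable_indicator_Iic_uncurry :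
    Measurable fun a : ℝ × ℝ => (Iic a.1).indicator (1 : ℝ → ℝ) a.2 := by
  have : (fun a : ℝ × ℝ => (Iic a.1).indicator (1 : ℝ → ℝ) a.2) =
      {a : ℝ × ℝ | a.2 ≤ a.1}.indicator 1 := by
    funext a
    simp [indicator]
  rw [this]
  exact measurable_one.indicator (measurableSet_le measurable_snd measurable_fst)

theorem measurable_cdf (L : Measure ℝ) : Measurable fun x => cdf L x := (monotone_cdf L).measurable

theorem measurable_indicatorNoise (L : Measure ℝ) (x : ℝ) :
    Measurable fun a : ℝ × ℝ => indicatorNoise L x a.1 a.2 := by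
  refine Measurable.sub (Measurable.sub ?_ ?_) (Measurable.sub ?_ measurable_const)
  · exact measurable_indicator_Iic_uncurry.comp
      ((measurable_const.add measurable_fst).prodMk measurable_snd)
  · exact measurable_indicator_Iic_uncurry.comp (measurable_const.prodMk measurable_snd)
  · exact (measurable_cdf L).comp (measurable_const.add measurable_fst)

theorem abs_indicator_one_sub_le (x y e : ℝ) :
    |(Iic y).indicator (1 : ℝ → ℝ) e - (Iic x).indicator 1 e| ≤ 1 := by
  by_cases h1 : e ∈ Iic x <;> by_cases h2 : e ∈ Iic y <;> simp [h1, h2]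

theorem abs_indicatorNoise_le (L : Measure ℝ) (x d e : ℝ) : |indicatorNoise L x d e| ≤ 2 := by
  have h1 := abs_indicator_one_sub_le x (x + d) e
  have h2 := abs_cdf_sub_le_one L (x + d) x
  have := abs_sub ((Iic (x + d)).indicator 1 e - (Iic x).indicator 1 e) (cdf L (x + d) - cdf L x)
  exact this.trans (by linarith)

theorem integrable_indicator_Iic (L : Measure ℝ) [IsProbabilityMeasure L] (x : ℝ) :
    Integrable (fun e => (Iic x).indicator (1 : ℝ → ℝ) e) L :=
  (integrable_const 1).indicator measurableSet_Iic

theorem integral_indicator_Iic (L : Measure ℝ) [IsProbabilityMeasure L] (x : ℝ) :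
    ∫ e, (Iic x).indicator (1 : ℝ → ℝ) e ∂L = cdf L x := by
  rw [integral_indicator_one measurableSet_Iic, cdf_eq_real]

theorem integral_indicatorNoise (L : Measure ℝ) [IsProbabilityMeasure L] (x d : ℝ) :
    ∫ e, indicatorNoise L x d e ∂L = 0 := by
  unfold indicatorNoise
  rw [integral_sub, integral_sub, integral_indicator_Iic, integral_indicator_Iic]
  · simp
  all_goals first
    | exact integrable_indicator_Iic L _
    | exact (integrable_indicator_Iic L _).sub (integrable_indicator_Iic L _)
    | exact integrable_const _

/-- The difference of two indicators of half-lines has a constant sign and values in `{0, ±1}`, so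
its square is plus or minus itself. The variance is therefore `|a| - a ^ 2`, where `a` is the
increment. -/
theorem integral_indicatorNoise_sq_le (L : Measure ℝ) [IsProbabilityMeasure L] (x d : ℝ) :
    ∫ e, indicatorNoise L x d e ^ 2 ∂L ≤ |cdf L (x + d) - cdf L x| := by
  set a := cdf L (x + d) - cdf L x with ha
  let f : ℝ → ℝ := fun e => (Iic (x + d)).indicator 1 e - (Iic x).indicator 1 e
  have hf : Integrable f L :=
    (integrable_indicator_Iic L (x + d)).sub (integrable_indicator_Iic L x)
  have hfi : ∫ e, f e ∂L = a := by
    rw [integral_sub (integrable_indicator_Iic L _) (integrable_indicator_Iic L _),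
      integral_indicator_Iic, integral_indicator_Iic]
  have hsq : ∀ e, f e ^ 2 = (if 0 ≤ d then 1 else -1) * f e := by
    intro e
    by_cases hd : 0 ≤ d
    · by_cases h1 : e ≤ x
      · have h2 : e ≤ x + d := by linarith
        simp [f, h1, h2]
      · by_cases h2 : e ≤ x + d <;> simp [f, h1, h2, hd]
    · by_cases h2 : e ≤ x + d
      · have h1 : e ≤ x := by linarith
        simp [f, h1, h2]
      · by_cases h1 : e ≤ x <;> simp [f, h1, h2, hd]
  have hexp : ∀ e, indicatorNoise L x d e ^ 2 =
      (if 0 ≤ d then 1 else -1) * f e - 2 * a * f e + a ^ 2 := by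
    intro e
    rw [← hsq]
    change (f e - a) ^ 2 = _
    ring
  simp only [hexp]
  rw [integral_add, integral_sub, integral_const_mul, integral_const_mul, hfi]
  · have h3 : (if 0 ≤ d then (1 : ℝ) else -1) * a ≤ |a| := by
      split_ifs
      · simpa using le_abs_self a
      · simpa using neg_le_abs a
    simp only [integral_const, probReal_univ, smul_eq_mul, one_mul]
    nlinarith [sq_nonneg a]
  all_goals first
    | exact hf.const_mul _
    | exact (hf.const_mul _).sub (hf.const_mul _)
    | exact integrable_const _

theorem integrable_of_abs_le {Ω : Type*} [MeasurableSpace Ω] {P : Measure Ω} [IsFiniteMeasure P]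
    {f : Ω → ℝ} (hf : Measurable f) {C : ℝ} (h : ∀ ω, |f ω| ≤ C) : Integrable f P :=
  Integrable.of_bound hf.aestronglyMeasurable C (Eventually.of_forall h)

/-- The indicator noise is orthogonal to bounded functions of the past, and its conditional second
moment is at most the increment of the distribution function. -/
theorem indicatorNoise_orthogonal {Ω : Type*} {m m0 : MeasurableSpace Ω} {P : Measure Ω}
    [IsProbabilityMeasure P] (hm : m ≤ m0) {X δ ε : Ω → ℝ} (hX : Measurable[m] X)
    (hδ : Measurable[m] δ) (hε : Measurable ε)
    (hind : Indep (MeasurableSpace.comap ε inferInstance) m P) {L : Measure ℝ}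
    [IsProbabilityMeasure L] (hL : P.map ε = L) (x : ℝ) {C : ℝ} (hC : ∀ ω, |X ω| ≤ C) :
    ∫ ω, X ω * indicatorNoise L x (δ ω) (ε ω) ∂P = 0 ∧
      ∫ ω, indicatorNoise L x (δ ω) (ε ω) ^ 2 ∂P ≤ ∫ ω, |cdf L (x + δ ω) - cdf L x| ∂P := by
  have hX' : Measurable X := hX.mono hm le_rfl
  have hδ' : Measurable δ := hδ.mono hm le_rfl
  have hpair : Measurable[m] fun ω => (X ω, δ ω) := Measurable.prodMk hX hδ
  have hpair' : Measurable fun ω => (X ω, δ ω) := hpair.mono hm le_rfl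
  -- Independence turns the joint law into a product, so conditioning on the past becomes an inner
  -- integral over `ε` with the threshold held fixed.
  have hI : IndepFun (fun ω => (X ω, δ ω)) ε P := by
    rw [IndepFun_iff_Indep]
    exact (indep_of_indep_of_le_right hind hpair.comap_le).symm
  have hmap := (indepFun_iff_map_prod_eq_prod_map_map hpair'.aemeasurable hε.aemeasurable).1 hI
  rw [hL] at hmap
  have : IsProbabilityMeasure (P.map fun ω => (X ω, δ ω)) :=
    Measure.isProbabilityMeasure_map hpair'.aemeasurable
  -- `X` is bounded on `Ω`, but its coordinate on the product space is not; truncation makes the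
  -- integrand bounded there, as Fubini requires, without changing the integral.
  let clip : ℝ → ℝ := fun y => max (-C) (min C y)
  have hclipm : Measurable clip := measurable_const.max (measurable_const.min measurable_id)
  have hclip : ∀ ω, clip (X ω) = X ω := fun ω => by
    have := abs_le.1 (hC ω)
    simp [clip, this.1, this.2]
  rcases isEmpty_or_nonempty Ω with hΩ | ⟨⟨ω₀⟩⟩
  · constructor <;> simp [integral_of_isEmpty]
  have hC0 : 0 ≤ C := (abs_nonneg _).trans (hC ω₀)
  have hclipb : ∀ y, |clip y| ≤ C := fun y => by
    rw [abs_le]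
    exact ⟨le_max_left _ _, max_le (by linarith) (min_le_left _ _)⟩
  have hnm : Measurable fun a : (ℝ × ℝ) × ℝ => indicatorNoise L x a.1.2 a.2 :=
    (measurable_indicatorNoise L x).comp ((measurable_snd.comp measurable_fst).prodMk measurable_snd)
  constructor
  · have h1 : Measurable fun a : (ℝ × ℝ) × ℝ => clip a.1.1 * indicatorNoise L x a.1.2 a.2 :=
      (hclipm.comp (measurable_fst.comp measurable_fst)).mul hnm
    have h2 : ∫ ω, X ω * indicatorNoise L x (δ ω) (ε ω) ∂P =
        ∫ a, clip a.1.1 * indicatorNoise L x a.1.2 a.2 ∂(P.map fun ω => ((X ω, δ ω), ε ω)) := by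
      rw [integral_map (hpair'.prodMk hε).aemeasurable h1.aestronglyMeasurable]
      simp only [hclip]
    rw [h2, hmap, integral_prod]
    · simp only [integral_const_mul, integral_indicatorNoise, mul_zero, integral_zero]
    · refine integrable_of_abs_le h1 (C := C * 2) fun a => ?_
      rw [abs_mul]
      exact mul_le_mul (hclipb _) (abs_indicatorNoise_le _ _ _ _) (abs_nonneg _) hC0
  · have h1 : Measurable fun a : (ℝ × ℝ) × ℝ => indicatorNoise L x a.1.2 a.2 ^ 2 := hnm.pow_const 2
    have h2 : ∫ ω, indicatorNoise L x (δ ω) (ε ω) ^ 2 ∂P =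
        ∫ a, indicatorNoise L x a.1.2 a.2 ^ 2 ∂(P.map fun ω => ((X ω, δ ω), ε ω)) := by
      rw [integral_map (hpair'.prodMk hε).aemeasurable h1.aestronglyMeasurable]
    have hb : ∀ a : (ℝ × ℝ) × ℝ, |indicatorNoise L x a.1.2 a.2 ^ 2| ≤ 4 := fun a => by
      rw [abs_pow]
      have := pow_le_pow_left₀ (abs_nonneg _) (abs_indicatorNoise_le L x a.1.2 a.2) 2
      linarith
    have hint : Integrable (fun a : (ℝ × ℝ) × ℝ => indicatorNoise L x a.1.2 a.2 ^ 2)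
        ((P.map fun ω => (X ω, δ ω)).prod L) := integrable_of_abs_le h1 hb
    have hcm : Measurable fun a : ℝ × ℝ => |cdf L (x + a.2) - cdf L x| :=
      (((measurable_cdf L).comp (measurable_const.add measurable_snd)).sub measurable_const).abs
    have h3 : ∫ ω, |cdf L (x + δ ω) - cdf L x| ∂P =
        ∫ a, |cdf L (x + a.2) - cdf L x| ∂(P.map fun ω => (X ω, δ ω)) := by
      rw [integral_map hpair'.aemeasurable hcm.aestronglyMeasurable]
    rw [h2, hmap, integral_prod _ hint, h3]
    refine integral_mono hint.integral_prod_left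
      (integrable_of_abs_le hcm (C := 1) fun a => ?_) fun a => ?_
    · rw [abs_abs]
      exact abs_cdf_sub_le_one _ _ _
    · exact integral_indicatorNoise_sq_le L x a.2

/-- Second moment bound for a sum of indicator noises at predictable thresholds. -/
theorem integral_sum_indicatorNoise_sq_le {Ω : Type*} {m0 : MeasurableSpace Ω} {P : Measure Ω}
    [IsProbabilityMeasure P] {F : ℕ → MeasurableSpace Ω} (hF : ∀ k, F k ≤ m0) (hmono : Monotone F)
    {δ ε : ℕ → Ω → ℝ} (hδ : ∀ k, Measurable[F k] (δ k)) (hε : ∀ k, Measurable[F (k + 1)] (ε k))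
    (hind : ∀ k, Indep (MeasurableSpace.comap (ε k) inferInstance) (F k) P) {L : Measure ℝ}
    [IsProbabilityMeasure L] (hL : ∀ k, P.map (ε k) = L) (x : ℝ) (n : ℕ) :
    Integrable (fun ω => (∑ k ∈ Finset.range n, indicatorNoise L x (δ k ω) (ε k ω)) ^ 2) P ∧
    ∫ ω, (∑ k ∈ Finset.range n, indicatorNoise L x (δ k ω) (ε k ω)) ^ 2 ∂P ≤
      ∑ k ∈ Finset.range n, ∫ ω, |cdf L (x + δ k ω) - cdf L x| ∂P := by
  let S : ℕ → Ω → ℝ := fun n ω => ∑ k ∈ Finset.range n, indicatorNoise L x (δ k ω) (ε k ω)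
  have hε' : ∀ k, Measurable (ε k) := fun k => (hε k).mono (hF _) le_rfl
  have hNm : ∀ k, Measurable[F (k + 1)] fun ω => indicatorNoise L x (δ k ω) (ε k ω) := fun k =>
    (measurable_indicatorNoise L x).comp
      (Measurable.prodMk ((hδ k).mono (hmono (Nat.le_succ k)) le_rfl) (hε k))
  have hNm' : ∀ k, Measurable fun ω => indicatorNoise L x (δ k ω) (ε k ω) := fun k =>
    (hNm k).mono (hF _) le_rfl
  have hSm : ∀ n, Measurable[F n] (S n) := by
    intro n
    refine @Finset.measurable_fun_sum ℝ ℕ Ω _ _ _ (F n) _ _ fun k hk => ?_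
    exact (hNm k).mono (hmono (Finset.mem_range.1 hk)) le_rfl
  have hSb : ∀ n ω, |S n ω| ≤ n * 2 := by
    intro n ω
    refine (Finset.abs_sum_le_sum_abs _ _).trans ?_
    refine (Finset.sum_le_card_nsmul _ _ 2 fun k _ => abs_indicatorNoise_le _ _ _ _).trans ?_
    simp
  have hint : ∀ n, Integrable (fun ω => S n ω ^ 2) P := fun n => by
    refine integrable_of_abs_le (((hSm n).mono (hF n) le_rfl).pow_const 2) (C := (n * 2) ^ 2)
      fun ω => ?_
    rw [abs_pow]
    exact pow_le_pow_left₀ (abs_nonneg _) (hSb n ω) 2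
  refine ⟨hint n, ?_⟩
  change ∫ ω, S n ω ^ 2 ∂P ≤ _
  induction n with
  | zero => simp [S]
  | succ n ih =>
    obtain ⟨h1, h2⟩ := indicatorNoise_orthogonal (hF n) (hSm n) (hδ n) (hε' n) (hind n) (hL n) x
      (hSb n)
    have hexp : ∀ ω, S (n + 1) ω ^ 2 = S n ω ^ 2 +
        2 * (S n ω * indicatorNoise L x (δ n ω) (ε n ω)) +
        indicatorNoise L x (δ n ω) (ε n ω) ^ 2 := by
      intro ω
      simp only [S, Finset.sum_range_succ]
      ring
    have hi1 : Integrable (fun ω => S n ω * indicatorNoise L x (δ n ω) (ε n ω)) P := by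
      refine integrable_of_abs_le (((hSm n).mono (hF n) le_rfl).mul (hNm' n)) (C := n * 2 * 2)
        fun ω => ?_
      rw [abs_mul]
      exact mul_le_mul (hSb n ω) (abs_indicatorNoise_le _ _ _ _) (abs_nonneg _) (by positivity)
    have hi2 : Integrable (fun ω => indicatorNoise L x (δ n ω) (ε n ω) ^ 2) P := by
      refine integrable_of_abs_le ((hNm' n).pow_const 2) (C := 2 ^ 2) fun ω => ?_
      rw [abs_pow]
      exact pow_le_pow_left₀ (abs_nonneg _) (abs_indicatorNoise_le _ _ _ _) 2
    simp only [hexp]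
    have hi3 : Integrable (fun ω => S n ω ^ 2 +
        2 * (S n ω * indicatorNoise L x (δ n ω) (ε n ω))) P := (hint n).add (hi1.const_mul 2)
    rw [integral_add hi3 hi2, integral_add (hint n) (hi1.const_mul 2), integral_const_mul, h1,
      mul_zero, add_zero, Finset.sum_range_succ]
    exact add_le_add ih h2

theorem integral_sq_le_of_eLpNorm_le {Ω : Type*} [MeasurableSpace Ω] {P : Measure Ω}
    {f : Ω → ℝ} (hf : Measurable f) {K : ℝ} (h : eLpNorm f 2 P ≤ ENNReal.ofReal K) (hK : 0 ≤ K) :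
    MemLp f 2 P ∧ ∫ ω, f ω ^ 2 ∂P ≤ K ^ 2 := by
  have hm : MemLp f 2 P := ⟨hf.aestronglyMeasurable, h.trans_lt ENNReal.ofReal_lt_top⟩
  refine ⟨hm, ?_⟩
  rw [hm.eLpNorm_eq_integral_rpow_norm (by norm_num) (by norm_num),
    ENNReal.ofReal_le_ofReal_iff hK] at h
  simp only [ENNReal.toReal_ofNat, Real.rpow_ofNat, Real.norm_eq_abs, sq_abs] at h
  have h0 : 0 ≤ ∫ ω, f ω ^ 2 ∂P := integral_nonneg fun _ => sq_nonneg _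
  have h1 := pow_le_pow_left₀ (by positivity) h 2
  rw [← Real.rpow_natCast, ← Real.rpow_mul h0] at h1
  simpa using h1

/-! ### Mixture laws and the centred causal scheme -/

/-- The mixture of two laws with weights `1 - r` and `r`. -/
noncomputable def mixtureLaw (G₀ H : Measure ℝ) (r : ℝ) : Measure ℝ :=
  ENNReal.ofReal (1 - r) • G₀ + ENNReal.ofReal r • H

theorem isProbabilityMeasure_mixtureLaw (G₀ H : Measure ℝ) [IsProbabilityMeasure G₀]
    [IsProbabilityMeasure H] {r : ℝ} (h0 : 0 ≤ r) (h1 : r ≤ 1) :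
    IsProbabilityMeasure (mixtureLaw G₀ H r) := by
  constructor
  simp only [mixtureLaw, Measure.coe_add, Measure.coe_smul, Pi.add_apply, Pi.smul_apply,
    measure_univ, smul_eq_mul, mul_one]
  rw [← ENNReal.ofReal_add (by linarith) h0]
  simp

theorem cdf_mixtureLaw (G₀ H : Measure ℝ) [IsProbabilityMeasure G₀]
    [IsProbabilityMeasure H] {r : ℝ} (h0 : 0 ≤ r) (h1 : r ≤ 1) (x : ℝ) :
    cdf (mixtureLaw G₀ H r) x = mixtureCDF G₀ H r x := by
  have := isProbabilityMeasure_mixtureLaw G₀ H h0 h1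
  rw [cdf_eq_real, mixtureCDF, cdf_eq_real, cdf_eq_real, measureReal_def, mixtureLaw]
  simp only [Measure.coe_add, Measure.coe_smul, Pi.add_apply, Pi.smul_apply, smul_eq_mul]
  rw [ENNReal.toReal_add (by finiteness) (by finiteness), ENNReal.toReal_mul, ENNReal.toReal_mul,
    ENNReal.toReal_ofReal (by linarith), ENNReal.toReal_ofReal h0]
  rfl

/-- Both weights are at most one, so `G₀ + H` dominates every mixture and the moment bound does not
depend on `r`. -/
theorem eLpNorm_mixtureLaw_le (G₀ H : Measure ℝ) {r : ℝ} (h0 : 0 ≤ r) (h1 : r ≤ 1) :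
    eLpNorm id 2 (mixtureLaw G₀ H r) ≤ eLpNorm id 2 (G₀ + H) := by
  refine eLpNorm_mono_measure _ (Measure.le_iff'.2 fun s => ?_)
  simp only [mixtureLaw, Measure.coe_add, Measure.coe_smul, Pi.add_apply, Pi.smul_apply,
    smul_eq_mul]
  exact add_le_add (mul_le_of_le_one_left' (ENNReal.ofReal_le_one.2 (by linarith)))
    (mul_le_of_le_one_left' (ENNReal.ofReal_le_one.2 h1))

theorem eLpNorm_two_add_measure_ne_top {G H : Measure ℝ} (hG : MemLp id 2 G) (hH : MemLp id 2 H) :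
    eLpNorm id 2 (G + H) ≠ ⊤ := by
  have h1 := lintegral_rpow_enorm_lt_top_of_eLpNorm_lt_top (by norm_num) (by norm_num) hG.2
  have h2 := lintegral_rpow_enorm_lt_top_of_eLpNorm_lt_top (by norm_num) (by norm_num) hH.2
  refine ((eLpNorm_lt_top_iff_lintegral_rpow_enorm_lt_top (by norm_num) (by norm_num)).2 ?_).ne
  rw [lintegral_add_measure]
  exact ENNReal.add_lt_top.2 ⟨h1, h2⟩

theorem integral_mixtureLaw {G₀ H : Measure ℝ} [IsProbabilityMeasure G₀]
    [IsProbabilityMeasure H] (hG₀ : IsCenteredL2 G₀) (hH : IsCenteredL2 H) (r : ℝ) :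
    ∫ x, x ∂(mixtureLaw G₀ H r) = 0 := by
  have h1 : Integrable (fun x : ℝ => x) G₀ := hG₀.1.integrable (by norm_num)
  have h2 : Integrable (fun x : ℝ => x) H := hH.1.integrable (by norm_num)
  rw [mixtureLaw, integral_add_measure (h1.smul_measure (by finiteness))
    (h2.smul_measure (by finiteness)), integral_smul_measure, integral_smul_measure, hG₀.2, hH.2]
  simp

/-- The autoregressive scheme centred at its mean, with a causal version of the autoregression,
innovations of law `L`, and second moments bounded by `K ^ 2`. -/
structure IsCausalScheme {Ω : Type*} [MeasurableSpace Ω] (P : Measure Ω) {p : ℕ}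
    (β : EuclideanSpace ℝ (Fin p)) (L : Measure ℝ) (q : ℝ) (Q : Measure ℝ) (K : ℝ)
    (u ε z ξ : ℤ → Ω → ℝ) : Prop where
  measurable_ε : ∀ t, Measurable (ε t)
  measurable_z : ∀ t, Measurable (z t)
  measurable_ξ : ∀ t, Measurable (ξ t)
  indep : iIndepFun (Sum.elim ε (Sum.elim z ξ)) P
  law_ε : ∀ t, P.map (ε t) = L
  z_values : ∀ t, ∀ᵐ ω ∂P, z t ω = 0 ∨ z t ω = 1
  z_prob : ∀ t, P.real {ω | z t ω = 1} = q
  law_ξ : ∀ t, P.map (ξ t) = Q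
  recursion : ∀ t, ∀ᵐ ω ∂P, u t ω = ∑ j : Fin p, β j * u (t - ((j : ℤ) + 1)) ω + ε t ω
  causal : ∀ t, Measurable[pastSigma ε t] (u t)
  integral_ε : ∀ t, ∫ ω, ε t ω ∂P = 0
  eLpNorm_ε : ∀ t, eLpNorm (ε t) 2 P ≤ ENNReal.ofReal K
  eLpNorm_u : ∀ t, eLpNorm (u t) 2 P ≤ ENNReal.ofReal K

/-- A stationary scheme is, after centring, almost surely a causal one. -/
theorem IsStableAR.exists_causalScheme {p : ℕ} {β : EuclideanSpace ℝ (Fin p)}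
    (hβ : IsStableAR β) {ν μ : ℝ} (hμ : ν = (1 - ∑ j : Fin p, β j) * μ)
    {G₀ H : Measure ℝ} [IsProbabilityMeasure G₀] [IsProbabilityMeasure H]
    (hG₀ : IsCenteredL2 G₀) (hH : IsCenteredL2 H) :
    ∃ K : ℝ, 0 ≤ K ∧ ∀ {Ω : Type*} [MeasurableSpace Ω] (P : Measure Ω) [IsProbabilityMeasure P]
      (r q : ℝ) (Q : Measure ℝ) (v ε z ξ : ℤ → Ω → ℝ), 0 ≤ r → r ≤ 1 →
      IsARScheme P β ν (mixtureCDF G₀ H r) q Q v ε z ξ →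
      ∃ u : ℤ → Ω → ℝ, IsCausalScheme P β (mixtureLaw G₀ H r) q Q K u ε z ξ ∧
        ∀ t, ∀ᵐ ω ∂P, v t ω = u t ω + μ := by
  obtain ⟨B, hB, hcausal⟩ := hβ.exists_causal_modification
  set σ : ℝ := (eLpNorm id 2 (G₀ + H)).toReal with hσ
  have hσ0 : 0 ≤ σ := ENNReal.toReal_nonneg
  -- One constant serves both bounds: `σ` for the innovations and `B * σ` for the autoregression,
  -- where `B` depends on `β` only.
  refine ⟨max σ (B * σ), le_max_of_le_left hσ0, ?_⟩
  intro Ω _ P _ r q Q v ε z ξ hr0 hr1 hS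
  have hprob := isProbabilityMeasure_mixtureLaw G₀ H hr0 hr1
  have hlaw : ∀ t, P.map (ε t) = mixtureLaw G₀ H r := by
    intro t
    have := Measure.isProbabilityMeasure_map (μ := P) (hS.measurable_ε t).aemeasurable
    refine Measure.eq_of_cdf _ _ (StieltjesFunction.ext fun x => ?_)
    rw [cdf_mixtureLaw G₀ H hr0 hr1, ← hS.cdf_ε t x, cdf_eq_real,
      map_measureReal_apply (hS.measurable_ε t) measurableSet_Iic]
    rfl
  have hεn : ∀ t, eLpNorm (ε t) 2 P ≤ ENNReal.ofReal σ := by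
    intro t
    have h1 : eLpNorm (ε t) 2 P = eLpNorm id 2 (mixtureLaw G₀ H r) := by
      rw [← hlaw t, eLpNorm_map_measure aestronglyMeasurable_id (hS.measurable_ε t).aemeasurable]
      rfl
    rw [h1, hσ, ENNReal.ofReal_toReal
      (eLpNorm_two_add_measure_ne_top hG₀.1 hH.1)]
    exact eLpNorm_mixtureLaw_le G₀ H hr0 hr1
  have hid : ∀ t, IdentDistrib (fun ω => v t ω - μ) (fun ω => v 0 ω - μ) P P := by
    intro t
    have := (hS.stationary t).comp (u := fun y : ℤ → ℝ => y 0 - μ) (by fun_prop)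
    simpa [Function.comp_def] using this
  obtain ⟨u, hu1, hu2, hu3⟩ := hcausal P (fun t ω => v t ω - μ) ε σ hσ0
    (fun t => (hS.measurable_v t).sub_const μ) hS.measurable_ε hεn hid (fun t => by
      filter_upwards [hS.recursion t] with ω hω
      rw [hω, hμ]
      simp only [mul_sub, Finset.sum_sub_distrib, sub_mul, Finset.sum_mul]
      ring)
  refine ⟨u, ⟨hS.measurable_ε, hS.measurable_z, hS.measurable_ξ, hS.indep, hlaw, hS.z_values,
    hS.z_prob, hS.law_ξ, fun t => ?_, hu1, fun t => ?_, fun t => ?_, fun t => ?_⟩, fun t => ?_⟩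
  · have hall := ae_all_iff.2 hu2
    filter_upwards [hS.recursion t, hall] with ω hω hω2
    simp only [hω2]
    rw [hω, hμ]
    simp only [mul_sub, Finset.sum_sub_distrib, sub_mul, Finset.sum_mul]
    ring
  · rw [← integral_mixtureLaw hG₀ hH r, ← hlaw t]
    exact (integral_map (f := fun x : ℝ => x) (hS.measurable_ε t).aemeasurable
      aestronglyMeasurable_id).symm
  · exact (hεn t).trans (ENNReal.ofReal_le_ofReal (le_max_left _ _))
  · rw [eLpNorm_congr_ae (hu2 t)]
    exact (hu3 t).trans (ENNReal.ofReal_le_ofReal (le_max_right _ _))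
  · filter_upwards [hu2 t] with ω hω
    rw [hω]
    ring

/-! ### Predictable information and elementary moments -/

/-- The information available before time `t`: the earlier innovations and all outliers. -/
@[reducible]
def pastInfo {Ω : Type*} (ε z ξ : ℤ → Ω → ℝ) (t : ℤ) : MeasurableSpace Ω :=
  ⨆ i ∈ {i : ℤ ⊕ (ℤ ⊕ ℤ) | ∀ s, i = Sum.inl s → s < t},
    MeasurableSpace.comap (Sum.elim ε (Sum.elim z ξ) i) inferInstance

theorem measurable_pastInfo {Ω : Type*} {ε z ξ : ℤ → Ω → ℝ} {t : ℤ} {i : ℤ ⊕ (ℤ ⊕ ℤ)}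
    (h : ∀ s, i = Sum.inl s → s < t) :
    Measurable[pastInfo ε z ξ t] (Sum.elim ε (Sum.elim z ξ) i) := by
  have h1 : MeasurableSpace.comap (Sum.elim ε (Sum.elim z ξ) i) inferInstance ≤
    pastInfo ε z ξ t := le_iSup₂_of_le i h le_rfl
  exact (comap_measurable (Sum.elim ε (Sum.elim z ξ) i)).mono h1 le_rfl

theorem measurable_z_pastInfo {Ω : Type*} {ε z ξ : ℤ → Ω → ℝ} {s t : ℤ} :
    Measurable[pastInfo ε z ξ t] (z s) :=
  measurable_pastInfo (i := Sum.inr (Sum.inl s)) (by simp)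

theorem measurable_ξ_pastInfo {Ω : Type*} {ε z ξ : ℤ → Ω → ℝ} {s t : ℤ} :
    Measurable[pastInfo ε z ξ t] (ξ s) :=
  measurable_pastInfo (i := Sum.inr (Sum.inr s)) (by simp)

theorem pastInfo_mono {Ω : Type*} {ε z ξ : ℤ → Ω → ℝ} : Monotone (pastInfo ε z ξ) :=
  fun _ _ hst => biSup_mono fun _ hi s hs => (hi s hs).trans_le hst

theorem pastSigma_le_pastInfo {Ω : Type*} {ε z ξ : ℤ → Ω → ℝ} {s t : ℤ} (h : s < t) :
    pastSigma ε s ≤ pastInfo ε z ξ t := by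
  refine iSup₂_le fun r hr => ?_
  have := measurable_pastInfo (ε := ε) (z := z) (ξ := ξ) (t := t) (i := Sum.inl r)
    (fun s' hs' => by cases hs'; exact lt_of_le_of_lt hr h)
  exact this.comap_le

namespace IsCausalScheme

variable {Ω : Type*} [MeasurableSpace Ω] {P : Measure Ω} {p : ℕ}
    {β : EuclideanSpace ℝ (Fin p)} {L : Measure ℝ} {q : ℝ} {Q : Measure ℝ} {K : ℝ}
    {u ε z ξ : ℤ → Ω → ℝ}

theorem measurable_all (h : IsCausalScheme P β L q Q K u ε z ξ) (i : ℤ ⊕ (ℤ ⊕ ℤ)) :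
    Measurable (Sum.elim ε (Sum.elim z ξ) i) := by
  rcases i with i | i | i
  · exact h.measurable_ε i
  · exact h.measurable_z i
  · exact h.measurable_ξ i

theorem pastInfo_le (h : IsCausalScheme P β L q Q K u ε z ξ) (t : ℤ) :
    pastInfo ε z ξ t ≤ ‹MeasurableSpace Ω› :=
  iSup₂_le fun i _ => (h.measurable_all i).comap_le

/-- The threshold at time `t` involves the outlier of time `t`, so the conditioning information must
contain outliers beyond the strict past. Joint independence permits all of them at once: the index
of `ε t` is simply not among the generating indices. -/
theorem indep_pastInfo (h : IsCausalScheme P β L q Q K u ε z ξ) (t : ℤ) :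
    Indep (MeasurableSpace.comap (ε t) inferInstance) (pastInfo ε z ξ t) P := by
  have h1 := indep_iSup_of_disjoint (fun i => (h.measurable_all i).comap_le) h.indep
    (S := {Sum.inl t}) (T := {i : ℤ ⊕ (ℤ ⊕ ℤ) | ∀ s, i = Sum.inl s → s < t})
    (by
      rw [disjoint_singleton_left]
      intro hc
      exact lt_irrefl _ (hc t rfl))
  rwa [iSup_singleton] at h1

theorem measurable_u (h : IsCausalScheme P β L q Q K u ε z ξ) (t : ℤ) : Measurable (u t) := by
  have h1 := (pastSigma_le_pastInfo (z := z) (ξ := ξ) (lt_add_one t)).trans (h.pastInfo_le (t + 1))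
  exact (h.causal t).mono h1 le_rfl

theorem measurable_u_pastInfo (h : IsCausalScheme P β L q Q K u ε z ξ) {s t : ℤ} (hst : s < t) :
    Measurable[pastInfo ε z ξ t] (u s) :=
  (h.causal s).mono (pastSigma_le_pastInfo hst) le_rfl

theorem integral_u_sq (h : IsCausalScheme P β L q Q K u ε z ξ) (hK : 0 ≤ K) (t : ℤ) :
    Integrable (fun ω => u t ω ^ 2) P ∧ ∫ ω, u t ω ^ 2 ∂P ≤ K ^ 2 := by
  have := integral_sq_le_of_eLpNorm_le (h.measurable_u t) (h.eLpNorm_u t) hK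
  exact ⟨this.1.integrable_sq, this.2⟩

theorem integral_z [IsProbabilityMeasure P] (h : IsCausalScheme P β L q Q K u ε z ξ) (t : ℤ) :
    Integrable (z t) P ∧ ∫ ω, z t ω ∂P = q := by
  have hs : MeasurableSet {ω | z t ω = 1} := h.measurable_z t (measurableSet_singleton 1)
  have h1 : z t =ᵐ[P] {ω | z t ω = 1}.indicator 1 := by
    filter_upwards [h.z_values t] with ω hω
    rcases hω with hω | hω <;> simp [indicator, hω]
  refine ⟨((integrable_const (1 : ℝ)).indicator hs).congr h1.symm, ?_⟩
  rw [integral_congr_ae h1, integral_indicator_one hs, h.z_prob t]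

theorem integral_z_mul_z [IsProbabilityMeasure P]
    (h : IsCausalScheme P β L q Q K u ε z ξ) {s t : ℤ} (hst : s ≠ t) :
    Integrable (fun ω => z s ω * z t ω) P ∧ ∫ ω, z s ω * z t ω ∂P = q ^ 2 := by
  have hI : IndepFun (z s) (z t) P :=
    h.indep.indepFun (i := Sum.inr (Sum.inl s)) (j := Sum.inr (Sum.inl t)) (by simpa using hst)
  refine ⟨hI.integrable_mul (h.integral_z s).1 (h.integral_z t).1, ?_⟩
  rw [hI.integral_fun_mul_eq_mul_integral (h.measurable_z s).aestronglyMeasurable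
    (h.measurable_z t).aestronglyMeasurable, (h.integral_z s).2, (h.integral_z t).2, sq]

theorem integral_z_mul_comp [IsProbabilityMeasure P]
    (h : IsCausalScheme P β L q Q K u ε z ξ) (t : ℤ) {f : ℝ → ℝ}
    (hf : Measurable f) {C : ℝ} (hC : ∀ y, |f y| ≤ C) :
    Integrable (fun ω => z t ω * f (ξ t ω)) P ∧
      ∫ ω, z t ω * f (ξ t ω) ∂P = q * ∫ y, f y ∂Q := by
  have hI : IndepFun (z t) (fun ω => f (ξ t ω)) P :=
    (h.indep.indepFun (i := Sum.inr (Sum.inl t)) (j := Sum.inr (Sum.inr t)) (by simp)).comp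
      measurable_id hf
  have hfm : Measurable fun ω => f (ξ t ω) := hf.comp (h.measurable_ξ t)
  refine ⟨hI.integrable_mul (h.integral_z t).1 (integrable_of_abs_le hfm fun ω => hC _), ?_⟩
  rw [hI.integral_fun_mul_eq_mul_integral (h.measurable_z t).aestronglyMeasurable
    hfm.aestronglyMeasurable, (h.integral_z t).2, ← h.law_ξ t,
    integral_map (h.measurable_ξ t).aemeasurable hf.aestronglyMeasurable]

theorem q_nonneg (h : IsCausalScheme P β L q Q K u ε z ξ) : 0 ≤ q := by
  rw [← h.z_prob 0]
  exact measureReal_nonneg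

end IsCausalScheme

/-! ### Deterministic bounds for increments over one window -/

/-- The perturbation `τ₀ + ∑ τ_j U_j + l (1 + ∑ |U_j|)`: a linear form in the lagged values `U`
together with a band of half-width `l`. -/
noncomputable def bandForm {p : ℕ} (τ₀ : ℝ) (τ : Fin p → ℝ) (l : ℝ) (U : Fin p → ℝ) : ℝ :=
  τ₀ + ∑ j, τ j * U j + l * (1 + ∑ j, |U j|)

/-- The size `1 + ∑ |u_j|` of a vector of lagged values. -/
noncomputable def lagSize {p : ℕ} (u : Fin p → ℝ) : ℝ := 1 + ∑ j, |u j|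

/-- The size `|τ₀| + ∑ |τ_j| + |l|` of the parameters of a perturbation. -/
noncomputable def bandSize {p : ℕ} (τ₀ : ℝ) (τ : Fin p → ℝ) (l : ℝ) : ℝ :=
  |τ₀| + ∑ j, |τ j| + |l|

theorem one_le_lagSize {p : ℕ} (u : Fin p → ℝ) : 1 ≤ lagSize u := by
  have : 0 ≤ ∑ j, |u j| := Finset.sum_nonneg fun _ _ => abs_nonneg _
  unfold lagSize
  linarith

theorem bandSize_nonneg {p : ℕ} (τ₀ : ℝ) (τ : Fin p → ℝ) (l : ℝ) : 0 ≤ bandSize τ₀ τ l := by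
  have : 0 ≤ ∑ j, |τ j| := Finset.sum_nonneg fun _ _ => abs_nonneg _
  unfold bandSize
  positivity

theorem abs_bandForm_le {p : ℕ} (τ₀ : ℝ) (τ : Fin p → ℝ) (l : ℝ) (U : Fin p → ℝ) :
    |bandForm τ₀ τ l U| ≤ bandSize τ₀ τ l * lagSize U := by
  have hL := one_le_lagSize U
  have h1 : |∑ j, τ j * U j| ≤ (∑ j, |τ j|) * lagSize U := by
    refine (Finset.abs_sum_le_sum_abs _ _).trans ?_
    rw [Finset.sum_mul]
    refine Finset.sum_le_sum fun j _ => ?_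
    rw [abs_mul]
    refine mul_le_mul_of_nonneg_left ?_ (abs_nonneg _)
    have := Finset.single_le_sum (f := fun j => |U j|) (fun _ _ => abs_nonneg _)
      (Finset.mem_univ j)
    unfold lagSize
    linarith
  have h2 : |l * (1 + ∑ j, |U j|)| = |l| * lagSize U := by
    rw [abs_mul]
    congr 1
    exact abs_of_nonneg (zero_le_one.trans hL)
  have h3 : |τ₀| ≤ |τ₀| * lagSize U := le_mul_of_one_le_right (abs_nonneg _) hL
  calc |bandForm τ₀ τ l U| ≤ |τ₀| + |∑ j, τ j * U j| + |l * (1 + ∑ j, |U j|)| :=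
        abs_add_three _ _ _
    _ ≤ _ := by
      rw [h2]
      unfold bandSize
      nlinarith

theorem lagSize_sq_le {p : ℕ} (u : Fin p → ℝ) :
    lagSize u ^ 2 ≤ 2 * (1 + p * ∑ j, u j ^ 2) := by
  have h1 : (∑ j, |u j|) ^ 2 ≤ p * ∑ j, u j ^ 2 := by
    have := sq_sum_le_card_mul_sum_sq (s := Finset.univ) (f := fun j : Fin p => |u j|)
    simpa using this
  unfold lagSize
  nlinarith [sq_nonneg (1 - ∑ j, |u j|)]

section Increments

variable {p : ℕ} {F : ℝ → ℝ} {K : ℝ} (hK : 0 ≤ K) (hF1 : ∀ x y, |F y - F x| ≤ 1)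
  (hFL : ∀ x y, |F y - F x| ≤ K * |y - x|) (b z ξ : Fin (p + 1) → ℝ)
  (hz : ∀ j, z j = 0 ∨ z j = 1) (u : Fin p → ℝ) (τ₀ : ℝ) (τ : Fin p → ℝ) (l : ℝ) {h : ℝ}
  (hh : 0 ≤ h) (x : ℝ)

include hK hF1 hFL hz hh

/-- Crude bound for the increment of a Lipschitz function caused by outliers and a perturbation. -/
theorem abs_increment_le :
    |F (x + (∑ j, b j * (z j * ξ j) + h * bandForm τ₀ τ l fun j => u j + z j.succ * ξ j.succ)) - F x|
      ≤ ∑ j, z j + K * bandSize τ₀ τ l * h * lagSize u := by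
  have hz0 : ∀ j, 0 ≤ z j := fun j => by rcases hz j with h | h <;> simp [h]
  have hL := one_le_lagSize u
  have hc := bandSize_nonneg τ₀ τ l
  -- With an outlier present the trivial bound one is absorbed by `∑ z j`; without one only the
  -- perturbation remains and the Lipschitz bound applies.
  by_cases hex : ∃ j, z j = 1
  · obtain ⟨j, hj⟩ := hex
    have h1 := Finset.single_le_sum (f := z) (fun j _ => hz0 j) (Finset.mem_univ j)
    have h2 : 0 ≤ K * bandSize τ₀ τ l * h * lagSize u := by positivity
    exact (hF1 _ _).trans (by linarith)
  · push Not at hex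
    have h0 : ∀ j, z j = 0 := fun j => (hz j).resolve_right (hex j)
    simp only [h0, zero_mul, mul_zero, Finset.sum_const_zero, zero_add, add_zero]
    refine (hFL _ _).trans ?_
    rw [add_sub_cancel_left, abs_mul, abs_of_nonneg hh]
    have := mul_le_mul_of_nonneg_left (abs_bandForm_le τ₀ τ l u) (mul_nonneg hK hh)
    calc _ = K * h * |bandForm τ₀ τ l u| := by ring
      _ ≤ _ := this
      _ = _ := by ring

/-- First order expansion of the increment of a smooth function caused by outliers and a small
perturbation, with a remainder controlled by the number of outliers. -/
theorem abs_increment_sub_le {g : ℝ} (hg : |g| ≤ K)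
    (hT : ∀ y, |F (x + y) - F x - y * g| ≤ K * y ^ 2) :
    |F (x + (∑ j, b j * (z j * ξ j) + h * bandForm τ₀ τ l fun j => u j + z j.succ * ξ j.succ))
        - F x - ∑ j, (F (x + b j * (z j * ξ j)) - F x) - h * g * bandForm τ₀ τ l u|
      ≤ K * bandSize τ₀ τ l ^ 2 * h ^ 2 * lagSize u ^ 2 +
        (p + 2) * ∑ i, ∑ j, (if i = j then 0 else z i * z j) +
        2 * (K * bandSize τ₀ τ l) * h * ((∑ j, z j) * lagSize u) +
        ∑ j, z j * min 1 (K * bandSize τ₀ τ l * h * |ξ j|) := by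
  set c := bandSize τ₀ τ l with hcdef
  have hz0 : ∀ j, 0 ≤ z j := fun j => by rcases hz j with h | h <;> simp [h]
  have hL := one_le_lagSize u
  have hL0 : 0 ≤ lagSize u := zero_le_one.trans hL
  have hc : 0 ≤ c := bandSize_nonneg τ₀ τ l
  have hKc : 0 ≤ K * c * h := by positivity
  have hpair : ∀ i j, 0 ≤ (if i = j then 0 else z i * z j) := fun i j => by
    split_ifs
    · exact le_rfl
    · exact mul_nonneg (hz0 i) (hz0 j)
  have hS : 0 ≤ ∑ j, z j := Finset.sum_nonneg fun j _ => hz0 j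
  have hA : 0 ≤ K * c ^ 2 * h ^ 2 * lagSize u ^ 2 := by positivity
  have hB : 0 ≤ (p + 2 : ℝ) * ∑ i, ∑ j, (if i = j then 0 else z i * z j) :=
    mul_nonneg (by positivity) (Finset.sum_nonneg fun i _ => Finset.sum_nonneg fun j _ => hpair i j)
  have hC : 0 ≤ K * c * h * ((∑ j, z j) * lagSize u) := by positivity
  have hm : ∀ j, 0 ≤ z j * min 1 (K * c * h * |ξ j|) := fun j =>
    mul_nonneg (hz0 j) (le_min zero_le_one (by positivity))
  have hD : 0 ≤ ∑ j, z j * min 1 (K * c * h * |ξ j|) := Finset.sum_nonneg fun j _ => hm j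
  have hlin : |h * g * bandForm τ₀ τ l u| ≤ K * c * h * lagSize u := by
    rw [abs_mul, abs_mul, abs_of_nonneg hh]
    calc h * |g| * |bandForm τ₀ τ l u| ≤ h * K * (c * lagSize u) := by
          gcongr
          exact abs_bandForm_le τ₀ τ l u
      _ = _ := by ring
  -- Two outliers: everything is bounded trivially, the increment by `1` and the single-outlier sum
  -- by `p + 1`, whence the factor `p + 2` in front of the pair count, which is at least one here.
  by_cases h2 : ∃ i j, i ≠ j ∧ z i = 1 ∧ z j = 1
  · obtain ⟨i, j, hij, hi, hj⟩ := h2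
    have h3 : 1 ≤ ∑ i, ∑ j, (if i = j then 0 else z i * z j) := by
      have h4 := Finset.single_le_sum (f := fun i => ∑ j, (if i = j then 0 else z i * z j))
        (fun i _ => Finset.sum_nonneg fun j _ => hpair i j) (Finset.mem_univ i)
      have h5 := Finset.single_le_sum (f := fun j => (if i = j then 0 else z i * z j))
        (fun j _ => hpair i j) (Finset.mem_univ j)
      simp only [hij, if_false, hi, hj, mul_one] at h5
      simp only [hi] at h4
      linarith
    have h4 : 1 ≤ ∑ j, z j := by
      rw [← hi]
      exact Finset.single_le_sum (f := z) (fun j _ => hz0 j) (Finset.mem_univ i)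
    have h5 : |∑ j, (F (x + b j * (z j * ξ j)) - F x)| ≤ p + 1 := by
      refine (Finset.abs_sum_le_sum_abs _ _).trans ?_
      refine (Finset.sum_le_card_nsmul _ _ 1 fun j _ => hF1 _ _).trans ?_
      simp
    have h6 := hF1 x (x + (∑ j, b j * (z j * ξ j) +
      h * bandForm τ₀ τ l fun j => u j + z j.succ * ξ j.succ))
    have h7 : K * c * h * lagSize u ≤ K * c * h * ((∑ j, z j) * lagSize u) :=
      mul_le_mul_of_nonneg_left (le_mul_of_one_le_left hL0 h4) hKc
    have h8 : (p + 2 : ℝ) ≤ (p + 2) * ∑ i, ∑ j, (if i = j then 0 else z i * z j) :=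
      le_mul_of_one_le_right (by positivity) h3
    refine (abs_sub _ _).trans ((add_le_add_left (abs_sub _ _) _).trans ?_)
    linarith
  push Not at h2
  -- Exactly one outlier: the main term cancels the jump `F(x + b i ξ i) - F x`, leaving the effect
  -- of the perturbation. That effect is at most one and also Lipschitz in `ξ i`; keeping the
  -- minimum avoids any moment assumption on the outliers. The factor `2` in the bound comes from
  -- this Lipschitz term together with the linear Taylor term.
  by_cases hex : ∃ j, z j = 1
  · obtain ⟨i, hi⟩ := hex
    have h0 : ∀ j, j ≠ i → z j = 0 := fun j hj =>
      (hz j).resolve_right (h2 i j (Ne.symm hj) hi)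
    have hs1 : ∑ j, b j * (z j * ξ j) = b i * ξ i := by
      rw [Finset.sum_eq_single i (fun j _ hj => by simp [h0 j hj]) (by simp), hi, one_mul]
    have hs2 : ∑ j, (F (x + b j * (z j * ξ j)) - F x) = F (x + b i * ξ i) - F x := by
      rw [Finset.sum_eq_single i (fun j _ hj => by simp [h0 j hj]) (by simp), hi, one_mul]
    have hs3 : ∑ j, z j = 1 := by
      rw [Finset.sum_eq_single i (fun j _ hj => h0 j hj) (by simp), hi]
    have hs4 : ∑ j, z j * min 1 (K * c * h * |ξ j|) = min 1 (K * c * h * |ξ i|) := by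
      rw [Finset.sum_eq_single i (fun j _ hj => by simp [h0 j hj]) (by simp), hi, one_mul]
    have hs5 : lagSize (fun j : Fin p => u j + z j.succ * ξ j.succ) ≤ lagSize u + |ξ i| := by
      have h3 : ∑ j : Fin p, |z j.succ * ξ j.succ| ≤ |ξ i| := by
        have h4 : ∑ j : Fin (p + 1), |z j * ξ j| = |ξ i| := by
          rw [Finset.sum_eq_single i (fun j _ hj => by simp [h0 j hj]) (by simp), hi, one_mul]
        rw [Fin.sum_univ_succ] at h4
        linarith [abs_nonneg (z 0 * ξ 0)]
      have h5 : ∑ j : Fin p, |u j + z j.succ * ξ j.succ| ≤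
          ∑ j, |u j| + ∑ j : Fin p, |z j.succ * ξ j.succ| := by
        rw [← Finset.sum_add_distrib]
        exact Finset.sum_le_sum fun j _ => abs_add_le _ _
      unfold lagSize
      linarith
    rw [hs1, hs2, hs4]
    rw [hs3, one_mul]
    set e := bandForm τ₀ τ l fun j => u j + z j.succ * ξ j.succ with he
    have h6 : |F (x + (b i * ξ i + h * e)) - F (x + b i * ξ i)| ≤
        K * c * h * lagSize u + min 1 (K * c * h * |ξ i|) := by
      have h7 := hF1 (x + b i * ξ i) (x + (b i * ξ i + h * e))
      have h8 := hFL (x + b i * ξ i) (x + (b i * ξ i + h * e))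
      have h9 : x + (b i * ξ i + h * e) - (x + b i * ξ i) = h * e := by ring
      rw [h9, abs_mul, abs_of_nonneg hh] at h8
      have h10 : |e| ≤ c * (lagSize u + |ξ i|) :=
        (abs_bandForm_le _ _ _ _).trans (mul_le_mul_of_nonneg_left hs5 hc)
      have h11 : K * (h * |e|) ≤ K * c * h * lagSize u + K * c * h * |ξ i| := by
        calc K * (h * |e|) ≤ K * (h * (c * (lagSize u + |ξ i|))) := by gcongr
          _ = _ := by ring
      have h12 : 0 ≤ K * c * h * lagSize u := by positivity
      rcases le_total 1 (K * c * h * |ξ i|) with h13 | h13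
      · rw [min_eq_left h13]
        linarith
      · rw [min_eq_right h13]
        linarith
    have h14 : F (x + (b i * ξ i + h * e)) - F x - (F (x + b i * ξ i) - F x) -
        h * g * bandForm τ₀ τ l u =
        F (x + (b i * ξ i + h * e)) - F (x + b i * ξ i) - h * g * bandForm τ₀ τ l u := by ring
    rw [h14]
    refine (abs_sub _ _).trans ?_
    linarith
  · push Not at hex
    have h0 : ∀ j, z j = 0 := fun j => (hz j).resolve_right (hex j)
    have h3 := hT (h * bandForm τ₀ τ l u)
    have h4 : K * (h * bandForm τ₀ τ l u) ^ 2 ≤ K * c ^ 2 * h ^ 2 * lagSize u ^ 2 := by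
      have h5 := pow_le_pow_left₀ (abs_nonneg _) (abs_bandForm_le τ₀ τ l u) 2
      rw [sq_abs] at h5
      calc K * (h * bandForm τ₀ τ l u) ^ 2 = K * h ^ 2 * bandForm τ₀ τ l u ^ 2 := by ring
        _ ≤ K * h ^ 2 * (c * lagSize u) ^ 2 := by gcongr
        _ = _ := by ring
    have h6 : h * bandForm τ₀ τ l u * g = h * g * bandForm τ₀ τ l u := by ring
    rw [h6] at h3
    simp only [h0, zero_mul, mul_zero, Finset.sum_const_zero, zero_add, add_zero, sub_self,
      sub_zero, ite_self]
    exact h3.trans h4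

end Increments

/-! ### Moment bounds within one causal scheme -/

/-- The vector of the `p` lagged values of a process before time `t`. -/
def lagVec {Ω : Type*} (p : ℕ) (u : ℤ → Ω → ℝ) (t : ℤ) (ω : Ω) : Fin p → ℝ :=
  fun j => u (t - ((j : ℤ) + 1)) ω

/-- The vector of the values of a process at the times `t, t - 1, …, t - p`. -/
def windowVec {Ω : Type*} (p : ℕ) (z : ℤ → Ω → ℝ) (t : ℤ) (ω : Ω) : Fin (p + 1) → ℝ :=
  fun j => z (t - (j : ℤ)) ω

/-- The coefficients `-1, β₁, …, β_p` with which outliers enter the residuals. -/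
def outlierCoeff {p : ℕ} (β : EuclideanSpace ℝ (Fin p)) : Fin (p + 1) → ℝ := Fin.cons (-1) β

/-- The shift of the threshold caused by the outliers and by a perturbation of size `h`. -/
noncomputable def thresholdShift {Ω : Type*} {p : ℕ} (β : EuclideanSpace ℝ (Fin p)) (h τ₀ : ℝ)
    (τ : Fin p → ℝ) (l : ℝ) (u z ξ : ℤ → Ω → ℝ) (t : ℤ) (ω : Ω) : ℝ :=
  ∑ j, outlierCoeff β j * (windowVec p z t ω j * windowVec p ξ t ω j) +
    h * bandForm τ₀ τ l fun j => lagVec p u t ω j +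
      windowVec p z t ω j.succ * windowVec p ξ t ω j.succ

theorem measurable_thresholdShift {Ω : Type*} {m : MeasurableSpace Ω} {p : ℕ}
    (β : EuclideanSpace ℝ (Fin p)) (h τ₀ : ℝ) (τ : Fin p → ℝ) (l : ℝ) {u z ξ : ℤ → Ω → ℝ} {t : ℤ}
    (hu : ∀ s, s < t → Measurable (u s)) (hz : ∀ s, Measurable (z s))
    (hξ : ∀ s, Measurable (ξ s)) : Measurable (thresholdShift β h τ₀ τ l u z ξ t) := by
  have hu' : ∀ j : Fin p, Measurable (u (t - ((j : ℤ) + 1))) := fun j => hu _ (by omega)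
  unfold thresholdShift bandForm lagVec windowVec
  fun_prop

/-- Almost surely all outlier indicators are `0` or `1`. -/
theorem IsCausalScheme.ae_window_values {Ω : Type*} [MeasurableSpace Ω] {P : Measure Ω} {p : ℕ}
    {β : EuclideanSpace ℝ (Fin p)} {L : Measure ℝ} {q : ℝ} {Q : Measure ℝ} {K : ℝ}
    {u ε z ξ : ℤ → Ω → ℝ} (h : IsCausalScheme P β L q Q K u ε z ξ) (t : ℤ) :
    ∀ᵐ ω ∂P, ∀ j, windowVec p z t ω j = 0 ∨ windowVec p z t ω j = 1 :=
  ae_all_iff.2 fun _ => h.z_values _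

namespace IsCausalScheme

variable {Ω : Type*} [MeasurableSpace Ω] {P : Measure Ω} [IsProbabilityMeasure P] {p : ℕ}
    {β : EuclideanSpace ℝ (Fin p)} {L : Measure ℝ} {q : ℝ} {Q : Measure ℝ} {K : ℝ}
    {u ε z ξ : ℤ → Ω → ℝ}

theorem integral_lagSize_sq (h : IsCausalScheme P β L q Q K u ε z ξ) (hK : 0 ≤ K) (t : ℤ) :
    Integrable (fun ω => lagSize (lagVec p u t ω) ^ 2) P ∧
      ∫ ω, lagSize (lagVec p u t ω) ^ 2 ∂P ≤ 2 * (1 + p * (p * K ^ 2)) := by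
  have hm : Measurable fun ω => lagSize (lagVec p u t ω) := by
    have := h.measurable_u
    unfold lagSize lagVec
    fun_prop
  have hs : ∀ j : Fin p, Integrable (fun ω => lagVec p u t ω j ^ 2) P := fun j =>
    (h.integral_u_sq hK _).1
  have hs' : Integrable (fun ω => ∑ j, lagVec p u t ω j ^ 2) P :=
    integrable_finsetSum _ fun j _ => hs j
  have hi : Integrable (fun ω => 2 * (1 + p * ∑ j, lagVec p u t ω j ^ 2)) P :=
    (((integrable_const 1).add (hs'.const_mul p)).const_mul 2)
  have h1 : Integrable (fun ω => lagSize (lagVec p u t ω) ^ 2) P := by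
    refine hi.mono' (hm.pow_const 2).aestronglyMeasurable (Eventually.of_forall fun ω => ?_)
    rw [Real.norm_eq_abs, abs_of_nonneg (sq_nonneg _)]
    exact lagSize_sq_le _
  refine ⟨h1, (integral_mono h1 hi fun ω => lagSize_sq_le _).trans ?_⟩
  rw [integral_const_mul, integral_add (integrable_const 1) (hs'.const_mul p), integral_const_mul,
    integral_finsetSum _ fun j _ => hs j]
  have h2 : ∑ j : Fin p, ∫ ω, lagVec p u t ω j ^ 2 ∂P ≤ p * K ^ 2 := by
    refine (Finset.sum_le_card_nsmul _ _ (K ^ 2) fun j _ => (h.integral_u_sq hK _).2).trans ?_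
    simp
  simp only [integral_const, probReal_univ, smul_eq_mul, mul_one]
  gcongr

theorem integral_lagSize (h : IsCausalScheme P β L q Q K u ε z ξ) (hK : 0 ≤ K) (t : ℤ) :
    Integrable (fun ω => lagSize (lagVec p u t ω)) P ∧
      ∫ ω, lagSize (lagVec p u t ω) ∂P ≤ 2 * (1 + p * (p * K ^ 2)) := by
  have hm : Measurable fun ω => lagSize (lagVec p u t ω) := by
    have := h.measurable_u
    unfold lagSize lagVec
    fun_prop
  obtain ⟨h1, h2⟩ := h.integral_lagSize_sq hK t
  have hle : ∀ ω, lagSize (lagVec p u t ω) ≤ lagSize (lagVec p u t ω) ^ 2 := fun ω => by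
    nlinarith [one_le_lagSize (lagVec p u t ω)]
  have h3 : Integrable (fun ω => lagSize (lagVec p u t ω)) P := by
    refine h1.mono' hm.aestronglyMeasurable (Eventually.of_forall fun ω => ?_)
    rw [Real.norm_eq_abs, abs_of_nonneg (zero_le_one.trans (one_le_lagSize _))]
    exact hle ω
  exact ⟨h3, (integral_mono h3 h1 hle).trans h2⟩

theorem integral_sum_window (h : IsCausalScheme P β L q Q K u ε z ξ) (t : ℤ) :
    Integrable (fun ω => ∑ j, windowVec p z t ω j) P ∧
      ∫ ω, ∑ j, windowVec p z t ω j ∂P = (p + 1) * q := by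
  have hi : ∀ j : Fin (p + 1), Integrable (fun ω => windowVec p z t ω j) P :=
    fun j => (h.integral_z _).1
  refine ⟨integrable_finsetSum _ fun j _ => hi j, ?_⟩
  rw [integral_finsetSum _ fun j _ => hi j]
  have : ∀ j : Fin (p + 1), ∫ ω, windowVec p z t ω j ∂P = q := fun j => (h.integral_z _).2
  simp [this]

/-- Distinct positions in a window are distinct times, so independence gives `q ^ 2` per pair; with
`q` of order `n^{-1/2}` this makes windows with two outliers negligible. -/
theorem integral_window_pairs (h : IsCausalScheme P β L q Q K u ε z ξ) (t : ℤ) :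
    Integrable (fun ω => ∑ i, ∑ j, (if i = j then 0 else
      windowVec p z t ω i * windowVec p z t ω j)) P ∧
      ∫ ω, ∑ i, ∑ j, (if i = j then 0 else windowVec p z t ω i * windowVec p z t ω j) ∂P ≤
        (p + 1) ^ 2 * q ^ 2 := by
  have hi : ∀ i j : Fin (p + 1), Integrable (fun ω => if i = j then 0 else
      windowVec p z t ω i * windowVec p z t ω j) P ∧ ∫ ω, (if i = j then 0 else
      windowVec p z t ω i * windowVec p z t ω j) ∂P ≤ q ^ 2 := by
    intro i j
    by_cases hij : i = j
    · simp [hij, sq_nonneg]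
    · simp only [hij, if_false]
      have hne : t - (i : ℤ) ≠ t - (j : ℤ) := fun hc => hij (Fin.ext (by omega))
      exact ⟨(h.integral_z_mul_z hne).1, (h.integral_z_mul_z hne).2.le⟩
  have hi2 : ∀ i : Fin (p + 1), Integrable (fun ω => ∑ j, if i = j then 0 else
      windowVec p z t ω i * windowVec p z t ω j) P := fun i =>
    integrable_finsetSum _ fun j _ => (hi i j).1
  refine ⟨integrable_finsetSum _ fun i _ => hi2 i, ?_⟩
  rw [integral_finsetSum _ fun i _ => hi2 i]
  have h3 : ∀ i : Fin (p + 1), ∫ ω, ∑ j, (if i = j then 0 else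
      windowVec p z t ω i * windowVec p z t ω j) ∂P ≤ (p + 1) * q ^ 2 := by
    intro i
    rw [integral_finsetSum _ fun j _ => (hi i j).1]
    refine (Finset.sum_le_card_nsmul _ _ (q ^ 2) fun j _ => (hi i j).2).trans ?_
    simp
  refine (Finset.sum_le_card_nsmul _ _ _ fun i _ => h3 i).trans (le_of_eq ?_)
  simp
  ring

theorem integral_sum_window_mul_min (h : IsCausalScheme P β L q Q K u ε z ξ) (t : ℤ) {a : ℝ}
    (ha : 0 ≤ a) :
    Integrable (fun ω => ∑ j, windowVec p z t ω j * min 1 (a * |windowVec p ξ t ω j|)) P ∧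
      ∫ ω, ∑ j, windowVec p z t ω j * min 1 (a * |windowVec p ξ t ω j|) ∂P =
        (p + 1) * (q * ∫ y, min 1 (a * |y|) ∂Q) := by
  have hf : Measurable fun y : ℝ => min 1 (a * |y|) := by fun_prop
  have hb : ∀ y : ℝ, |min 1 (a * |y|)| ≤ 1 := fun y => by
    rw [abs_of_nonneg (le_min zero_le_one (by positivity))]
    exact min_le_left _ _
  have hi : ∀ j : Fin (p + 1), Integrable (fun ω => windowVec p z t ω j *
      min 1 (a * |windowVec p ξ t ω j|)) P := fun j => (h.integral_z_mul_comp _ hf hb).1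
  have hi2 : ∀ j : Fin (p + 1), ∫ ω, windowVec p z t ω j *
      min 1 (a * |windowVec p ξ t ω j|) ∂P = q * ∫ y, min 1 (a * |y|) ∂Q :=
    fun j => (h.integral_z_mul_comp _ hf hb).2
  refine ⟨integrable_finsetSum _ fun j _ => hi j, ?_⟩
  rw [integral_finsetSum _ fun j _ => hi j]
  simp [hi2]

/-- The expected increment of a bounded Lipschitz function at the shifted threshold is small. -/
theorem exists_increment_majorant (h : IsCausalScheme P β L q Q K u ε z ξ) (hK : 0 ≤ K)
    {F : ℝ → ℝ} {M : ℝ} (hM : 0 ≤ M) (hF1 : ∀ x y, |F y - F x| ≤ 1)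
    (hFL : ∀ x y, |F y - F x| ≤ M * |y - x|) (x τ₀ : ℝ) (τ : Fin p → ℝ) (l : ℝ) {s : ℝ}
    (hs : 0 ≤ s) (t : ℤ) :
    ∃ Y : Ω → ℝ, Integrable Y P ∧
      (∀ᵐ ω ∂P, |F (x + thresholdShift β s τ₀ τ l u z ξ t ω) - F x| ≤ Y ω) ∧
      ∫ ω, Y ω ∂P ≤ (p + 1) * q + M * bandSize τ₀ τ l * s * (2 * (1 + p * (p * K ^ 2))) := by
  obtain ⟨h1, h2⟩ := h.integral_sum_window t
  obtain ⟨h3, h4⟩ := h.integral_lagSize hK t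
  refine ⟨fun ω => ∑ j, windowVec p z t ω j +
    M * bandSize τ₀ τ l * s * lagSize (lagVec p u t ω), h1.add (h3.const_mul _), ?_, ?_⟩
  · filter_upwards [h.ae_window_values t] with ω hω
    exact abs_increment_le hM hF1 hFL _ _ _ hω _ _ _ _ hs x
  · rw [integral_add h1 (h3.const_mul _), integral_const_mul, h2]
    have := bandSize_nonneg τ₀ τ l
    gcongr

/-- The remainder of the first order expansion of the increment at the shifted threshold. -/
theorem exists_remainder_majorant (h : IsCausalScheme P β L q Q K u ε z ξ) (hK : 0 ≤ K)
    {F : ℝ → ℝ} {M : ℝ} (hM : 0 ≤ M) (hF1 : ∀ x y, |F y - F x| ≤ 1)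
    (hFL : ∀ x y, |F y - F x| ≤ M * |y - x|) {x g : ℝ} (hg : |g| ≤ M)
    (hT : ∀ y, |F (x + y) - F x - y * g| ≤ M * y ^ 2) (τ₀ : ℝ) (τ : Fin p → ℝ) (l : ℝ) {s Γ : ℝ}
    (hs : 0 < s) (hq : q ≤ Γ * s) (t : ℤ) :
    ∃ Y : Ω → ℝ, Integrable Y P ∧
      (∀ᵐ ω ∂P, |F (x + thresholdShift β s τ₀ τ l u z ξ t ω) - F x -
        ∑ j, (F (x + outlierCoeff β j * (windowVec p z t ω j * windowVec p ξ t ω j)) - F x) -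
        s * g * bandForm τ₀ τ l (lagVec p u t ω)| ≤ Y ω) ∧
      ∫ ω, Y ω ∂P ≤ s * (M * bandSize τ₀ τ l ^ 2 * (2 * (1 + p * (p * K ^ 2))) * s +
        (p + 2) * (p + 1) ^ 2 * Γ ^ 2 * s +
        2 * (M * bandSize τ₀ τ l) * (p + 1) * (Γ + 2 * (1 + p * (p * K ^ 2))) * √s +
        (p + 1) * Γ * ∫ y, min 1 (M * bandSize τ₀ τ l * s * |y|) ∂Q) := by
  set KM : ℝ := 2 * (1 + p * (p * K ^ 2)) with hKM
  set c := bandSize τ₀ τ l with hc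
  have hc0 : 0 ≤ c := bandSize_nonneg τ₀ τ l
  obtain ⟨h1, h2⟩ := h.integral_sum_window t
  obtain ⟨h3, h4⟩ := h.integral_lagSize_sq hK t
  obtain ⟨h5, h6⟩ := h.integral_window_pairs t
  obtain ⟨h7, h8⟩ := h.integral_sum_window_mul_min t (a := M * c * s) (by positivity)
  have hθ : 0 < √s := Real.sqrt_pos.2 hs
  have hθ2 : √s * √s = s := Real.mul_self_sqrt hs.le
  let Y1 : Ω → ℝ := fun ω => M * c ^ 2 * s ^ 2 * lagSize (lagVec p u t ω) ^ 2
  let Y2 : Ω → ℝ := fun ω => (p + 2) * ∑ i, ∑ j, (if i = j then 0 else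
    windowVec p z t ω i * windowVec p z t ω j)
  let Y3 : Ω → ℝ := fun ω => 2 * (M * c) * s * ((√s)⁻¹ * ∑ j, windowVec p z t ω j +
    (p + 1) * √s * lagSize (lagVec p u t ω) ^ 2)
  let Y4 : Ω → ℝ := fun ω => ∑ j, windowVec p z t ω j * min 1 (M * c * s * |windowVec p ξ t ω j|)
  have i1 : Integrable Y1 P := h3.const_mul _
  have i2 : Integrable Y2 P := h5.const_mul _
  have i3 : Integrable Y3 P := ((h1.const_mul _).add (h3.const_mul _)).const_mul _
  have i12 : Integrable (fun ω => Y1 ω + Y2 ω) P := i1.add i2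
  have i123 : Integrable (fun ω => Y1 ω + Y2 ω + Y3 ω) P := i12.add i3
  refine ⟨fun ω => Y1 ω + Y2 ω + Y3 ω + Y4 ω, i123.add h7, ?_, ?_⟩
  · filter_upwards [h.ae_window_values t] with ω hω
    refine (abs_increment_sub_le hM hF1 hFL (outlierCoeff β) (windowVec p z t ω)
      (windowVec p ξ t ω) hω (lagVec p u t ω) τ₀ τ l hs.le x hg hT).trans ?_
    -- Weighted AM–GM, using that each `z` is `0` or `1`. Since `z` has mean at most `Γ s`, the
    -- weight `√s` balances the two terms at order `√s`, and the mixed term needs no independence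
    -- between outliers and autoregression.
    have key : (∑ j, windowVec p z t ω j) * lagSize (lagVec p u t ω) ≤
        (√s)⁻¹ * ∑ j, windowVec p z t ω j + (p + 1) * √s * lagSize (lagVec p u t ω) ^ 2 := by
      set ℓ := lagSize (lagVec p u t ω)
      have h9 : ∀ j, windowVec p z t ω j * ℓ ≤ (√s)⁻¹ * windowVec p z t ω j + √s * ℓ ^ 2 := by
        intro j
        rcases hω j with h0 | h0 <;> rw [h0]
        · simp only [zero_mul, mul_zero, zero_add]
          positivity
        · have h10 : (√s)⁻¹ * √s = 1 := inv_mul_cancel₀ hθ.ne'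
          have h11 : 0 < (√s)⁻¹ := by positivity
          have h12 : 0 ≤ (√s)⁻¹ * (1 - √s * ℓ) ^ 2 := by positivity
          have h13 : (√s)⁻¹ * (1 - √s * ℓ) ^ 2 = (√s)⁻¹ - 2 * ℓ + √s * ℓ ^ 2 := by
            field_simp
            ring
          have h14 : 1 ≤ ℓ := one_le_lagSize _
          linarith
      rw [Finset.sum_mul, Finset.mul_sum]
      refine (Finset.sum_le_sum fun j _ => h9 j).trans (le_of_eq ?_)
      rw [Finset.sum_add_distrib]
      simp
      ring
    have := mul_le_mul_of_nonneg_left key (show 0 ≤ 2 * (M * c) * s by positivity)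
    simp only [Y1, Y2, Y3, Y4]
    linarith
  · rw [integral_add i123 h7, integral_add i12 i3, integral_add i1 i2]
    have e1 : ∫ ω, Y1 ω ∂P ≤ s * (M * c ^ 2 * KM * s) := by
      simp only [Y1]
      rw [integral_const_mul]
      calc _ ≤ M * c ^ 2 * s ^ 2 * KM := by gcongr
        _ = _ := by ring
    have hq0 := h.q_nonneg
    have hΓ : 0 ≤ Γ := by
      by_contra hneg
      push Not at hneg
      nlinarith
    have e2 : ∫ ω, Y2 ω ∂P ≤ s * ((p + 2) * (p + 1) ^ 2 * Γ ^ 2 * s) := by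
      simp only [Y2]
      rw [integral_const_mul]
      calc _ ≤ (p + 2) * ((p + 1) ^ 2 * (Γ * s) ^ 2) := by
            refine mul_le_mul_of_nonneg_left (h6.trans ?_) (by positivity)
            gcongr
        _ = _ := by ring
    have e3 : ∫ ω, Y3 ω ∂P ≤ s * (2 * (M * c) * (p + 1) * (Γ + KM) * √s) := by
      simp only [Y3]
      rw [integral_const_mul, integral_add (h1.const_mul _) (h3.const_mul _), integral_const_mul,
        integral_const_mul, h2]
      calc _ ≤ 2 * (M * c) * s * ((√s)⁻¹ * ((p + 1) * (Γ * s)) + (p + 1) * √s * KM) := by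
            gcongr
        _ = 2 * (M * c) * s * ((√s)⁻¹ * ((p + 1) * (Γ * (√s * √s))) + (p + 1) * √s * KM) := by
            rw [hθ2]
        _ = _ := by
            field_simp
    have e4 : ∫ ω, Y4 ω ∂P ≤ s * ((p + 1) * Γ * ∫ y, min 1 (M * c * s * |y|) ∂Q) := by
      rw [h8]
      have : 0 ≤ ∫ y, min 1 (M * c * s * |y|) ∂Q :=
        integral_nonneg fun y => le_min zero_le_one (by positivity)
      calc _ ≤ (p + 1) * (Γ * s * ∫ y, min 1 (M * c * s * |y|) ∂Q) := by gcongr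
        _ = _ := by ring
    linarith

/-- Second moment bound for the sum of the indicator noises at the shifted thresholds. -/
theorem integral_sum_noise_sq_le [IsProbabilityMeasure L]
    (h : IsCausalScheme P β L q Q K u ε z ξ) (hK : 0 ≤ K) {M : ℝ} (hM : 0 ≤ M)
    (hFL : ∀ x y, |cdf L y - cdf L x| ≤ M * |y - x|) (x τ₀ : ℝ) (τ : Fin p → ℝ) (l : ℝ) {s : ℝ}
    (hs : 0 ≤ s) (n : ℕ) :
    Integrable (fun ω => (∑ k ∈ Finset.range n, indicatorNoise L x
      (thresholdShift β s τ₀ τ l u z ξ (k + 1) ω) (ε (k + 1) ω)) ^ 2) P ∧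
    ∫ ω, (∑ k ∈ Finset.range n, indicatorNoise L x
      (thresholdShift β s τ₀ τ l u z ξ (k + 1) ω) (ε (k + 1) ω)) ^ 2 ∂P ≤
      n * ((p + 1) * q + M * bandSize τ₀ τ l * s * (2 * (1 + p * (p * K ^ 2)))) := by
  have hδ : ∀ k : ℕ, Measurable[pastInfo ε z ξ (k + 1)]
      (thresholdShift β s τ₀ τ l u z ξ (k + 1)) := fun k =>
    @measurable_thresholdShift Ω (pastInfo ε z ξ (k + 1)) p β s τ₀ τ l u z ξ (k + 1)
      (fun r hr => h.measurable_u_pastInfo hr) (fun r => measurable_z_pastInfo)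
      (fun r => measurable_ξ_pastInfo)
  -- The summand with index `k` belongs to time `k + 1`, so its predictable information is
  -- `pastInfo` at `k + 1`, which contains innovations only up to time `k`.
  obtain ⟨h1, h2⟩ := integral_sum_indicatorNoise_sq_le (P := P)
    (F := fun k : ℕ => pastInfo ε z ξ (k + 1)) (fun k => h.pastInfo_le _)
    (fun a b hab => pastInfo_mono (by simpa using hab)) hδ
    (ε := fun k => ε (k + 1))
    (fun k => measurable_pastInfo (i := Sum.inl ((k : ℤ) + 1)) fun s hs => by
      cases hs
      push_cast
      omega)
    (fun k => h.indep_pastInfo _) (fun k => h.law_ε _) x n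
  refine ⟨h1, h2.trans ?_⟩
  refine (Finset.sum_le_card_nsmul _ _ _ fun k _ => ?_).trans
    (le_of_eq (by rw [Finset.card_range, nsmul_eq_mul]))
  obtain ⟨Y, hY1, hY2, hY3⟩ := h.exists_increment_majorant hK hM
    (fun a b => abs_cdf_sub_le_one L b a) hFL x τ₀ τ l hs (k + 1)
  refine (integral_mono_ae ?_ hY1 hY2).trans hY3
  refine integrable_of_abs_le (C := 1) ?_ fun ω => by
    rw [abs_abs]
    exact abs_cdf_sub_le_one _ _ _
  exact (((measurable_cdf L).comp (((hδ k).mono (h.pastInfo_le _) le_rfl).const_add x)).sub_const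
    _).abs

/-- Second moment bound for the centred sum of a function of the outliers. -/
theorem integral_sum_outlier_sq_le (h : IsCausalScheme P β L q Q K u ε z ξ) {f : ℝ → ℝ}
    (hf : Measurable f) (hf0 : f 0 = 0) (hf1 : ∀ y, |f y| ≤ 1) (a : ℤ) (n : ℕ) :
    Integrable (fun ω => (∑ k ∈ Finset.range n, (f (z (k + a) ω * ξ (k + a) ω) -
      q * ∫ y, f y ∂Q)) ^ 2) P ∧
    ∫ ω, (∑ k ∈ Finset.range n, (f (z (k + a) ω * ξ (k + a) ω) - q * ∫ y, f y ∂Q)) ^ 2 ∂P ≤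
      n * q := by
  let ζ : ℕ → Ω → ℝ := fun k ω => f (z (k + a) ω * ξ (k + a) ω)
  have hζm : ∀ k, Measurable (ζ k) := fun k =>
    hf.comp ((h.measurable_z _).mul (h.measurable_ξ _))
  have hζ2 : ∀ k, MemLp (ζ k) 2 P := fun k =>
    MemLp.of_bound (hζm k).aestronglyMeasurable 1 (Eventually.of_forall fun ω => hf1 _)
  have hζz : ∀ k, ζ k =ᵐ[P] fun ω => z (k + a) ω * f (ξ (k + a) ω) := fun k => by
    filter_upwards [h.z_values (k + a)] with ω hω
    rcases hω with h0 | h0 <;> simp [ζ, h0, hf0]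
  have hmean : ∀ k, ∫ ω, ζ k ω ∂P = q * ∫ y, f y ∂Q := fun k => by
    rw [integral_congr_ae (hζz k)]
    exact (h.integral_z_mul_comp _ hf hf1).2
  have hsq : ∀ k, ∫ ω, ζ k ω ^ 2 ∂P ≤ q := fun k => by
    rw [← (h.integral_z (k + a)).2]
    refine integral_mono_ae (hζ2 k).integrable_sq (h.integral_z _).1 ?_
    filter_upwards [h.z_values (k + a)] with ω hω
    rcases hω with h0 | h0
    · simp [ζ, h0, hf0]
    · have := pow_le_pow_left₀ (abs_nonneg _) (hf1 (z (k + a) ω * ξ (k + a) ω)) 2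
      rw [sq_abs, one_pow] at this
      rw [h0]
      simpa [ζ, h0] using this
  have hind : Set.Pairwise ↑(Finset.range n) fun i j => ζ i ⟂ᵢ[P] ζ j := by
    intro i _ j _ hij
    have h1 := h.indep.indepFun_prodMk_prodMk h.measurable_all
      (Sum.inr (Sum.inl ((i : ℤ) + a))) (Sum.inr (Sum.inr ((i : ℤ) + a)))
      (Sum.inr (Sum.inl ((j : ℤ) + a))) (Sum.inr (Sum.inr ((j : ℤ) + a)))
      (by simpa using hij) (by simp) (by simp) (by simpa using hij)
    exact h1.comp (φ := fun y : ℝ × ℝ => f (y.1 * y.2)) (ψ := fun y : ℝ × ℝ => f (y.1 * y.2))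
      (hf.comp (measurable_fst.mul measurable_snd)) (hf.comp (measurable_fst.mul measurable_snd))
  have hsum2 : MemLp (∑ k ∈ Finset.range n, ζ k) 2 P := memLp_finsetSum' _ fun k _ => hζ2 k
  have hvar := IndepFun.variance_sum (fun k _ => hζ2 k) hind
  have hmeansum : ∫ ω, (∑ k ∈ Finset.range n, ζ k) ω ∂P = n * (q * ∫ y, f y ∂Q) := by
    simp only [Finset.sum_apply]
    rw [integral_finsetSum _ fun k _ => (hζ2 k).integrable (by norm_num)]
    simp [hmean]
  have hrw : ∀ ω, ∑ k ∈ Finset.range n, (f (z (k + a) ω * ξ (k + a) ω) - q * ∫ y, f y ∂Q) =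
      (∑ k ∈ Finset.range n, ζ k) ω - ∫ ω, (∑ k ∈ Finset.range n, ζ k) ω ∂P := by
    intro ω
    rw [hmeansum, Finset.sum_sub_distrib, Finset.sum_apply]
    simp [ζ]
  simp only [hrw]
  refine ⟨(hsum2.sub (memLp_const _)).integrable_sq, ?_⟩
  rw [← variance_eq_integral hsum2.1.aemeasurable, hvar]
  refine (Finset.sum_le_card_nsmul _ _ q fun k _ => ?_).trans
    (le_of_eq (by rw [Finset.card_range, nsmul_eq_mul]))
  exact (variance_le_expectation_sq (hζ2 k).1).trans (hsq k)

/-- Second moment bound for the sum of the innovations. -/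
theorem integral_sum_innovations_sq_le (h : IsCausalScheme P β L q Q K u ε z ξ) (hK : 0 ≤ K)
    (n : ℕ) :
    Integrable (fun ω => (∑ k ∈ Finset.range n, ε (k + 1) ω) ^ 2) P ∧
    ∫ ω, (∑ k ∈ Finset.range n, ε (k + 1) ω) ^ 2 ∂P ≤ n * K ^ 2 := by
  have h2 : ∀ k : ℕ, MemLp (ε (k + 1)) 2 P ∧ ∫ ω, ε (k + 1) ω ^ 2 ∂P ≤ K ^ 2 := fun k =>
    integral_sq_le_of_eLpNorm_le (h.measurable_ε _) (h.eLpNorm_ε _) hK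
  have hind : Set.Pairwise ↑(Finset.range n) fun i j : ℕ => ε (i + 1) ⟂ᵢ[P] ε (j + 1) := by
    intro i _ j _ hij
    exact h.indep.indepFun (i := Sum.inl ((i : ℤ) + 1)) (j := Sum.inl ((j : ℤ) + 1))
      (by simpa using hij)
  have hsum2 : MemLp (∑ k ∈ Finset.range n, ε (k + 1)) 2 P := memLp_finsetSum' _ fun k _ => (h2 k).1
  have hvar := IndepFun.variance_sum (X := fun k : ℕ => ε (k + 1)) (fun k _ => (h2 k).1) hind
  have hmeansum : ∫ ω, (∑ k ∈ Finset.range n, ε (k + 1)) ω ∂P = 0 := by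
    simp only [Finset.sum_apply]
    rw [integral_finsetSum _ fun k _ => (h2 k).1.integrable (by norm_num)]
    simp [h.integral_ε]
  have hrw : ∀ ω, ∑ k ∈ Finset.range n, ε (k + 1) ω =
      (∑ k ∈ Finset.range n, ε (k + 1)) ω - ∫ ω, (∑ k ∈ Finset.range n, ε (k + 1)) ω ∂P := by
    intro ω
    rw [hmeansum, Finset.sum_apply, sub_zero]
  simp only [hrw]
  refine ⟨(hsum2.sub (memLp_const _)).integrable_sq, ?_⟩
  rw [← variance_eq_integral hsum2.1.aemeasurable, hvar]
  refine (Finset.sum_le_card_nsmul _ _ (K ^ 2) fun k _ => ?_).trans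
    (le_of_eq (by rw [Finset.card_range, nsmul_eq_mul]))
  exact (variance_le_expectation_sq (h2 k).1.1).trans (h2 k).2

end IsCausalScheme

/-! ### Normalized sums along local sequences -/

theorem inv_sqrt_mul_inv_sqrt {n : ℕ} (hn : 1 ≤ n) : (√(n : ℝ))⁻¹ * (n * (√(n : ℝ))⁻¹) = 1 := by
  have h : (0 : ℝ) < n := by exact_mod_cast hn
  have h1 : √(n : ℝ) * √(n : ℝ) = n := Real.mul_self_sqrt h.le
  have h2 : 0 < √(n : ℝ) := Real.sqrt_pos.2 h
  field_simp
  rw [sq, h1]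

theorem tendsto_inv_sqrt_natCast : Tendsto (fun n : ℕ => (√(n : ℝ))⁻¹) atTop (𝓝 0) :=
  (Real.tendsto_sqrt_atTop.comp tendsto_natCast_atTop_atTop).inv_tendsto_atTop

/-- A normalized sum vanishes in probability if its terms have small integrable majorants. -/
theorem VanishesInProb.of_majorants {Ω : ℕ → Type*} [∀ n, MeasurableSpace (Ω n)]
    {P : ∀ n, Measure (Ω n)} {X : ∀ n, ℕ → Ω n → ℝ} {B : ℕ → ℝ} (hB : Tendsto B atTop (𝓝 0))
    (h : ∀ n, 1 ≤ n → ∀ k, ∃ Y : Ω n → ℝ, Integrable Y (P n) ∧ (∀ᵐ ω ∂P n, |X n k ω| ≤ Y ω) ∧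
      ∫ ω, Y ω ∂P n ≤ (√(n : ℝ))⁻¹ * B n) :
    VanishesInProb P (fun n ω => (√(n : ℝ))⁻¹ * ∑ k ∈ Finset.range n, X n k ω) := by
  choose! Y hY1 hY2 hY3 using h
  have hV : VanishesInProb P (fun n ω => (√(n : ℝ))⁻¹ * ∑ k ∈ Finset.range n, Y n k ω) := by
    refine VanishesInProb.of_integral_abs hB ?_
    filter_upwards [eventually_ge_atTop 1] with n hn
    have hi : Integrable (fun ω => (√(n : ℝ))⁻¹ * ∑ k ∈ Finset.range n, Y n k ω) (P n) :=
      (integrable_finsetSum _ fun k _ => hY1 n hn k).const_mul _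
    refine ⟨hi, ?_⟩
    have hall := ae_all_iff.2 (hY2 n hn)
    have h1 : ∫ ω, |(√(n : ℝ))⁻¹ * ∑ k ∈ Finset.range n, Y n k ω| ∂P n =
        ∫ ω, (√(n : ℝ))⁻¹ * ∑ k ∈ Finset.range n, Y n k ω ∂P n := by
      refine integral_congr_ae ?_
      filter_upwards [hall] with ω hω
      exact abs_of_nonneg (mul_nonneg (by positivity)
        (Finset.sum_nonneg fun k _ => (abs_nonneg _).trans (hω k)))
    rw [h1, integral_const_mul, integral_finsetSum _ fun k _ => hY1 n hn k]
    calc _ ≤ (√(n : ℝ))⁻¹ * (n * ((√(n : ℝ))⁻¹ * B n)) := by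
          refine mul_le_mul_of_nonneg_left ?_ (by positivity)
          refine (Finset.sum_le_card_nsmul _ _ _ fun k _ => hY3 n hn k).trans (le_of_eq ?_)
          rw [Finset.card_range, nsmul_eq_mul]
      _ = (√(n : ℝ))⁻¹ * (n * (√(n : ℝ))⁻¹) * B n := by ring
      _ = B n := by rw [inv_sqrt_mul_inv_sqrt hn, one_mul]
  refine hV.mono ?_
  filter_upwards [eventually_ge_atTop 1] with n hn
  filter_upwards [ae_all_iff.2 (hY2 n hn)] with ω hω
  rw [abs_mul, abs_mul]
  refine mul_le_mul_of_nonneg_left ?_ (abs_nonneg _)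
  exact (Finset.abs_sum_le_sum_abs _ _).trans
    ((Finset.sum_le_sum fun k _ => hω k).trans (le_abs_self _))

/-- Truncated outliers of vanishing scale have vanishing mean. -/
theorem tendsto_integral_min_one_mul_abs (Q : Measure ℝ) [IsProbabilityMeasure Q] {a : ℕ → ℝ}
    (ha0 : ∀ n, 0 ≤ a n) (ha : Tendsto a atTop (𝓝 0)) :
    Tendsto (fun n => ∫ y, min 1 (a n * |y|) ∂Q) atTop (𝓝 0) := by
  have h1 : Tendsto (fun n => ∫ y, min 1 (a n * |y|) ∂Q) atTop (𝓝 (∫ _, (0 : ℝ) ∂Q)) := by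
    refine tendsto_integral_of_dominated_convergence (fun _ => 1) (fun n => ?_)
      (integrable_const 1) (fun n => Eventually.of_forall fun y => ?_)
      (Eventually.of_forall fun y => ?_)
    · exact Measurable.aestronglyMeasurable (by fun_prop)
    · rw [Real.norm_eq_abs, abs_of_nonneg (le_min zero_le_one
        (mul_nonneg (ha0 n) (abs_nonneg y)))]
      exact min_le_left _ _
    · have h2 : Tendsto (fun n => min 1 (a n * |y|)) atTop (𝓝 (min 1 (0 * |y|))) :=
        tendsto_const_nhds.min (ha.mul_const |y|)
      simpa using h2
  simpa using h1

/-- Each difference splits into `j + 1` unit steps, and each step telescopes in `k`. Lagging a sum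
thus changes it only by boundary values, whose number does not grow with `n`. -/
theorem sum_range_sub_shift (a : ℤ → ℝ) (n j : ℕ) :
    ∑ k ∈ Finset.range n, (a (k + 1) - a (k - j)) =
      ∑ i ∈ Finset.range (j + 1), (a (n - i) - a (-i)) := by
  have h1 : ∀ k : ℕ, a (k + 1) - a (k - j) =
      ∑ i ∈ Finset.range (j + 1), (a (k + 1 - i) - a (k - i)) := by
    intro k
    have := Finset.sum_range_sub' (fun i : ℕ => a (k + 1 - i)) (j + 1)
    simp only [Nat.cast_zero, sub_zero] at this
    have h2 : (k : ℤ) + 1 - ((j + 1 : ℕ) : ℤ) = k - j := by push_cast; ring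
    rw [h2] at this
    rw [← this]
    refine Finset.sum_congr rfl fun i _ => ?_
    congr 2
    push_cast
    ring
  simp only [h1]
  rw [Finset.sum_comm]
  refine Finset.sum_congr rfl fun i _ => ?_
  have := Finset.sum_range_sub (fun k : ℕ => a (k - i)) n
  simp only [Nat.cast_zero, zero_sub] at this
  rw [← this]
  refine Finset.sum_congr rfl fun k _ => ?_
  push_cast
  rfl

/-- A sequence of causal schemes with contamination and alternative levels of order `1 / √n`. -/
structure IsLocalSequence {Ω : ℕ → Type*} [∀ n, MeasurableSpace (Ω n)] (P : ∀ n, Measure (Ω n))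
    {p : ℕ} (β : EuclideanSpace ℝ (Fin p)) (G₀ H Q : Measure ℝ) (K Γ R : ℝ) (r q : ℕ → ℝ)
    (u ε z ξ : ∀ n, ℤ → Ω n → ℝ) : Prop where
  scheme : ∀ n, 1 ≤ n →
    IsCausalScheme (P n) β (mixtureLaw G₀ H (r n)) (q n) Q K (u n) (ε n) (z n) (ξ n)
  K_nonneg : 0 ≤ K
  r_nonneg : ∀ n, 0 ≤ r n
  r_le_one : ∀ n, r n ≤ 1
  r_le : ∀ n, 1 ≤ n → r n ≤ R * (√(n : ℝ))⁻¹
  q_le : ∀ n, 1 ≤ n → q n ≤ Γ * (√(n : ℝ))⁻¹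

namespace IsLocalSequence

variable {Ω : ℕ → Type*} [∀ n, MeasurableSpace (Ω n)] {P : ∀ n, Measure (Ω n)}
    {p : ℕ} {β : EuclideanSpace ℝ (Fin p)} {G₀ H Q : Measure ℝ} {K Γ R : ℝ} {r q : ℕ → ℝ}
    {u ε z ξ : ∀ n, ℤ → Ω n → ℝ}

theorem tendsto_q (h : IsLocalSequence P β G₀ H Q K Γ R r q u ε z ξ) :
    Tendsto q atTop (𝓝 0) := by
  have h1 : Tendsto (fun n : ℕ => Γ * (√(n : ℝ))⁻¹) atTop (𝓝 0) := by
    simpa using tendsto_inv_sqrt_natCast.const_mul Γ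
  refine tendsto_of_tendsto_of_tendsto_of_le_of_le' tendsto_const_nhds h1 ?_ ?_
  · filter_upwards [eventually_ge_atTop 1] with n hn using (h.scheme n hn).q_nonneg
  · filter_upwards [eventually_ge_atTop 1] with n hn using h.q_le n hn

theorem cdf_mixture_sub [IsProbabilityMeasure G₀] [IsProbabilityMeasure H]
    (h : IsLocalSequence P β G₀ H Q K Γ R r q u ε z ξ) (n : ℕ) (x y : ℝ) :
    cdf (mixtureLaw G₀ H (r n)) y - cdf (mixtureLaw G₀ H (r n)) x =
      (1 - r n) * (cdf G₀ y - cdf G₀ x) + r n * (cdf H y - cdf H x) := by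
  rw [cdf_mixtureLaw G₀ H (h.r_nonneg n) (h.r_le_one n),
    cdf_mixtureLaw G₀ H (h.r_nonneg n) (h.r_le_one n), mixtureCDF, mixtureCDF]
  ring

/-- A single value of the autoregression, divided by `n`, vanishes in probability. -/
theorem vanishes_value (h : IsLocalSequence P β G₀ H Q K Γ R r q u ε z ξ) (s : ℕ → ℤ) :
    VanishesInProb P (fun n ω => (n : ℝ)⁻¹ * u n (s n) ω) := by
  have hb : Tendsto (fun n : ℕ => ((n : ℝ)⁻¹) ^ 2 * K ^ 2) atTop (𝓝 0) := by
    simpa using (tendsto_natCast_atTop_atTop.inv_tendsto_atTop.pow 2).mul_const (K ^ 2)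
  refine VanishesInProb.of_integral_sq hb ?_
  filter_upwards [eventually_ge_atTop 1] with n hn
  obtain ⟨h1, h2⟩ := (h.scheme n hn).integral_u_sq h.K_nonneg (s n)
  simp only [mul_pow]
  refine ⟨h1.const_mul _, ?_⟩
  rw [integral_const_mul]
  gcongr

variable [∀ n, IsProbabilityMeasure (P n)]

/-- By orthogonality the second moment is an average of expected increments of the mixture
distribution function, and these tend to zero because both the outlier rate and the perturbation
scale do. -/
theorem vanishes_noise [IsProbabilityMeasure G₀] [IsProbabilityMeasure H]
    (h : IsLocalSequence P β G₀ H Q K Γ R r q u ε z ξ) (hG : HasSmoothCDF G₀)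
    (hH : HasSmoothCDF H) (x τ₀ : ℝ) (τ : Fin p → ℝ) (l : ℝ) :
    VanishesInProb P (fun n ω => (√(n : ℝ))⁻¹ * ∑ k ∈ Finset.range n,
      indicatorNoise (mixtureLaw G₀ H (r n)) x
        (thresholdShift β (√(n : ℝ))⁻¹ τ₀ τ l (u n) (z n) (ξ n) (k + 1) ω) (ε n (k + 1) ω)) := by
  obtain ⟨M₁, hM₁, -, hL₁, -⟩ := hG.exists_bounds
  obtain ⟨M₂, hM₂, -, hL₂, -⟩ := hH.exists_bounds
  set M := M₁ + M₂ with hM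
  have hM0 : 0 ≤ M := add_nonneg hM₁ hM₂
  have hb : Tendsto (fun n : ℕ => (p + 1) * q n +
      M * bandSize τ₀ τ l * (√(n : ℝ))⁻¹ * (2 * (1 + p * (p * K ^ 2)))) atTop (𝓝 0) := by
    have h1 := (h.tendsto_q.const_mul ((p : ℝ) + 1)).add
      ((tendsto_inv_sqrt_natCast.const_mul (M * bandSize τ₀ τ l)).mul_const
        (2 * (1 + p * (p * K ^ 2))))
    simpa using h1
  refine VanishesInProb.of_integral_sq hb ?_
  filter_upwards [eventually_ge_atTop 1] with n hn
  have := isProbabilityMeasure_mixtureLaw G₀ H (h.r_nonneg n) (h.r_le_one n)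
  have hLip : ∀ x y, |cdf (mixtureLaw G₀ H (r n)) y - cdf (mixtureLaw G₀ H (r n)) x| ≤
      M * |y - x| := by
    intro x y
    rw [h.cdf_mixture_sub]
    refine (abs_add_le _ _).trans ?_
    rw [abs_mul, abs_mul, abs_of_nonneg (h.r_nonneg n),
      abs_of_nonneg (show 0 ≤ 1 - r n by linarith [h.r_le_one n])]
    have h1 : (1 - r n) * |cdf G₀ y - cdf G₀ x| ≤ 1 * (M₁ * |y - x|) :=
      mul_le_mul (by linarith [h.r_nonneg n]) (hL₁ x y) (abs_nonneg _) zero_le_one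
    have h2 : r n * |cdf H y - cdf H x| ≤ 1 * (M₂ * |y - x|) :=
      mul_le_mul (h.r_le_one n) (hL₂ x y) (abs_nonneg _) zero_le_one
    rw [hM, add_mul]
    linarith
  obtain ⟨h1, h2⟩ := (h.scheme n hn).integral_sum_noise_sq_le h.K_nonneg hM0 hLip x τ₀ τ l
    (s := (√(n : ℝ))⁻¹) (by positivity) n
  simp only [mul_pow]
  refine ⟨h1.const_mul _, ?_⟩
  rw [integral_const_mul]
  calc _ ≤ ((√(n : ℝ))⁻¹) ^ 2 * (n * ((p + 1) * q n +
        M * bandSize τ₀ τ l * (√(n : ℝ))⁻¹ * (2 * (1 + p * (p * K ^ 2))))) := by gcongr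
    _ = (√(n : ℝ))⁻¹ * (n * (√(n : ℝ))⁻¹) * ((p + 1) * q n +
        M * bandSize τ₀ τ l * (√(n : ℝ))⁻¹ * (2 * (1 + p * (p * K ^ 2)))) := by ring
    _ = _ := by rw [inv_sqrt_mul_inv_sqrt hn, one_mul]

/-- The difference equals `r n` times the increment of `H` minus that of `G₀`. The factor `r n` of
order `n^{-1/2}` offsets the normalization, and the increments themselves are small in mean. -/
theorem vanishes_alternative [IsProbabilityMeasure G₀] [IsProbabilityMeasure H]
    (h : IsLocalSequence P β G₀ H Q K Γ R r q u ε z ξ) (hG : HasSmoothCDF G₀)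
    (hH : HasSmoothCDF H) (x τ₀ : ℝ) (τ : Fin p → ℝ) (l : ℝ) :
    VanishesInProb P (fun n ω => (√(n : ℝ))⁻¹ * ∑ k ∈ Finset.range n,
      (cdf (mixtureLaw G₀ H (r n))
          (x + thresholdShift β (√(n : ℝ))⁻¹ τ₀ τ l (u n) (z n) (ξ n) (k + 1) ω) -
        cdf (mixtureLaw G₀ H (r n)) x -
        (cdf G₀ (x + thresholdShift β (√(n : ℝ))⁻¹ τ₀ τ l (u n) (z n) (ξ n) (k + 1) ω) -
          cdf G₀ x))) := by
  obtain ⟨M₁, hM₁, -, hL₁, -⟩ := hG.exists_bounds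
  obtain ⟨M₂, hM₂, -, hL₂, -⟩ := hH.exists_bounds
  set D : ℝ := 2 * (1 + p * (p * K ^ 2)) with hD
  have hb : Tendsto (fun n : ℕ => R * (((p + 1) * q n +
      M₂ * bandSize τ₀ τ l * (√(n : ℝ))⁻¹ * D) + ((p + 1) * q n +
      M₁ * bandSize τ₀ τ l * (√(n : ℝ))⁻¹ * D))) atTop (𝓝 0) := by
    have h1 := (h.tendsto_q.const_mul ((p : ℝ) + 1)).add
      ((tendsto_inv_sqrt_natCast.const_mul (M₁ * bandSize τ₀ τ l)).mul_const D)
    have h2 := (h.tendsto_q.const_mul ((p : ℝ) + 1)).add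
      ((tendsto_inv_sqrt_natCast.const_mul (M₂ * bandSize τ₀ τ l)).mul_const D)
    simpa using (h2.add h1).const_mul R
  refine VanishesInProb.of_majorants hb fun n hn k => ?_
  obtain ⟨Y₁, i₁, b₁, e₁⟩ := (h.scheme n hn).exists_increment_majorant h.K_nonneg hM₁
    (fun a b => abs_cdf_sub_le_one G₀ b a) hL₁ x τ₀ τ l (s := (√(n : ℝ))⁻¹) (by positivity) (k + 1)
  obtain ⟨Y₂, i₂, b₂, e₂⟩ := (h.scheme n hn).exists_increment_majorant h.K_nonneg hM₂
    (fun a b => abs_cdf_sub_le_one H b a) hL₂ x τ₀ τ l (s := (√(n : ℝ))⁻¹) (by positivity) (k + 1)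
  refine ⟨fun ω => r n * (Y₂ ω + Y₁ ω), (i₂.add i₁).const_mul _, ?_, ?_⟩
  · filter_upwards [b₁, b₂] with ω h₁ h₂
    rw [h.cdf_mixture_sub]
    set y := x + thresholdShift β (√(n : ℝ))⁻¹ τ₀ τ l (u n) (z n) (ξ n) (k + 1) ω
    have h3 : (1 - r n) * (cdf G₀ y - cdf G₀ x) + r n * (cdf H y - cdf H x) -
        (cdf G₀ y - cdf G₀ x) = r n * ((cdf H y - cdf H x) - (cdf G₀ y - cdf G₀ x)) := by ring
    rw [h3, abs_mul, abs_of_nonneg (h.r_nonneg n)]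
    exact mul_le_mul_of_nonneg_left ((abs_sub _ _).trans (add_le_add h₂ h₁)) (h.r_nonneg n)
  · rw [integral_const_mul, integral_add i₂ i₁]
    have h4 := (h.scheme n hn).q_nonneg
    have h5 := bandSize_nonneg τ₀ τ l
    calc _ ≤ (R * (√(n : ℝ))⁻¹) * (((p + 1) * q n + M₂ * bandSize τ₀ τ l * (√(n : ℝ))⁻¹ * D) +
          ((p + 1) * q n + M₁ * bandSize τ₀ τ l * (√(n : ℝ))⁻¹ * D)) := by
          refine mul_le_mul_of_nonneg (h.r_le n hn) (add_le_add e₂ e₁) (h.r_nonneg n) ?_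
          positivity
      _ = _ := by ring

theorem vanishes_remainder [IsProbabilityMeasure Q]
    (h : IsLocalSequence P β G₀ H Q K Γ R r q u ε z ξ) (hG : HasSmoothCDF G₀)
    (x τ₀ : ℝ) (τ : Fin p → ℝ) (l : ℝ) :
    VanishesInProb P (fun n ω => (√(n : ℝ))⁻¹ * ∑ k ∈ Finset.range n,
      (cdf G₀ (x + thresholdShift β (√(n : ℝ))⁻¹ τ₀ τ l (u n) (z n) (ξ n) (k + 1) ω) - cdf G₀ x -
        ∑ j, (cdf G₀ (x + outlierCoeff β j *
          (windowVec p (z n) (k + 1) ω j * windowVec p (ξ n) (k + 1) ω j)) - cdf G₀ x) -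
        (√(n : ℝ))⁻¹ * deriv (fun y => cdf G₀ y) x *
          bandForm τ₀ τ l (lagVec p (u n) (k + 1) ω))) := by
  obtain ⟨M, hM, hg, hL, hT⟩ := hG.exists_bounds
  have hc := bandSize_nonneg τ₀ τ l
  have hs := tendsto_inv_sqrt_natCast
  -- The truncated outlier term vanishes by dominated convergence, so the law `Q` may have
  -- arbitrarily heavy tails.
  have hmin := tendsto_integral_min_one_mul_abs Q
    (a := fun n : ℕ => M * bandSize τ₀ τ l * (√(n : ℝ))⁻¹) (fun n => by positivity)
    (by simpa using hs.const_mul (M * bandSize τ₀ τ l))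
  have hsq : Tendsto (fun n : ℕ => √(√(n : ℝ))⁻¹) atTop (𝓝 0) := by
    simpa [Function.comp_def] using (Real.continuous_sqrt.tendsto 0).comp hs
  refine VanishesInProb.of_majorants (B := fun n : ℕ =>
    M * bandSize τ₀ τ l ^ 2 * (2 * (1 + p * (p * K ^ 2))) * (√(n : ℝ))⁻¹ +
        (p + 2) * (p + 1) ^ 2 * Γ ^ 2 * (√(n : ℝ))⁻¹ +
        2 * (M * bandSize τ₀ τ l) * (p + 1) * (Γ + 2 * (1 + p * (p * K ^ 2))) * √(√(n : ℝ))⁻¹ +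
        (p + 1) * Γ * ∫ y, min 1 (M * bandSize τ₀ τ l * (√(n : ℝ))⁻¹ * |y|) ∂Q) ?_
    fun n hn k => ?_
  · have h1 := (((hs.const_mul (M * bandSize τ₀ τ l ^ 2 * (2 * (1 + p * (p * K ^ 2))))).add
      (hs.const_mul ((p + 2) * (p + 1) ^ 2 * Γ ^ 2))).add
      (hsq.const_mul (2 * (M * bandSize τ₀ τ l) * (p + 1) * (Γ + 2 * (1 + p * (p * K ^ 2)))))).add
      (hmin.const_mul ((p + 1) * Γ))
    simpa using h1
  · have hn' : (0 : ℝ) < n := by exact_mod_cast hn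
    exact (h.scheme n hn).exists_remainder_majorant h.K_nonneg hM
      (fun a b => abs_cdf_sub_le_one G₀ b a) hL (hg x) (hT x) τ₀ τ l
      (inv_pos.2 (Real.sqrt_pos.2 hn')) (h.q_le n hn) (k + 1)

/-- A law of large numbers for rare events: the normalized centred sums have variance at most `q n`,
which tends to zero, while the centring adds up to `√n q n` times the shift. -/
theorem vanishes_outliers [IsProbabilityMeasure Q]
    (h : IsLocalSequence P β G₀ H Q K Γ R r q u ε z ξ) {γ : ℕ → ℝ}
    (hγ : ∀ᶠ n : ℕ in atTop, √(n : ℝ) * q n = γ n) (x : ℝ) :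
    VanishesInProb P (fun n ω => (√(n : ℝ))⁻¹ * ∑ k ∈ Finset.range n,
      ∑ j, (cdf G₀ (x + outlierCoeff β j *
          (windowVec p (z n) (k + 1) ω j * windowVec p (ξ n) (k + 1) ω j)) - cdf G₀ x) -
      γ n * outlierShift G₀ Q β x) := by
  let f : Fin (p + 1) → ℝ → ℝ := fun j y => cdf G₀ (x + outlierCoeff β j * y) - cdf G₀ x
  have hfm : ∀ j, Measurable (f j) := fun j =>
    ((measurable_cdf G₀).comp ((measurable_const_mul _).const_add x)).sub_const _
  have hf1 : ∀ j y, |f j y| ≤ 1 := fun j y => abs_cdf_sub_le_one _ _ _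
  have hf0 : ∀ j, f j 0 = 0 := fun j => by simp [f]
  have hshift : outlierShift G₀ Q β x = ∑ j, ∫ y, f j y ∂Q := by
    have h1 : ∀ j, ∫ y, f j y ∂Q = ∫ y, cdf G₀ (x + outlierCoeff β j * y) ∂Q - cdf G₀ x := by
      intro j
      have h2 : Integrable (fun y => cdf G₀ (x + outlierCoeff β j * y)) Q :=
        integrable_of_abs_le (C := 1)
          ((measurable_cdf G₀).comp ((measurable_const_mul _).const_add x)) fun y => by
            rw [abs_of_nonneg (cdf_nonneg _ _)]
            exact cdf_le_one _ _
      simp only [f]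
      rw [integral_sub h2 (integrable_const _)]
      simp
    rw [Fin.sum_univ_succ]
    simp only [h1]
    simp [outlierShift, outlierCoeff]
  -- Windows overlap, so the terms are dependent across `j`. For a fixed position `j` the summands
  -- are independent over time, and there are only `p + 1` positions.
  have hj : ∀ j : Fin (p + 1), VanishesInProb P (fun n ω => (√(n : ℝ))⁻¹ * ∑ k ∈ Finset.range n,
      (f j (z n (k + (1 - (j : ℤ))) ω * ξ n (k + (1 - (j : ℤ))) ω) - q n * ∫ y, f j y ∂Q)) := by
    intro j
    refine VanishesInProb.of_integral_sq h.tendsto_q ?_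
    filter_upwards [eventually_ge_atTop 1] with n hn
    obtain ⟨h1, h2⟩ := (h.scheme n hn).integral_sum_outlier_sq_le (hfm j) (hf0 j) (hf1 j)
      (1 - (j : ℤ)) n
    simp only [mul_pow]
    refine ⟨h1.const_mul _, ?_⟩
    rw [integral_const_mul]
    calc _ ≤ ((√(n : ℝ))⁻¹) ^ 2 * (n * q n) := by gcongr
      _ = (√(n : ℝ))⁻¹ * (n * (√(n : ℝ))⁻¹) * q n := by ring
      _ = _ := by rw [inv_sqrt_mul_inv_sqrt hn, one_mul]
  refine (VanishesInProb.sum Finset.univ fun j _ => hj j).congr ?_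
  filter_upwards [hγ, eventually_ge_atTop 1] with n hn hn1
  refine Eventually.of_forall fun ω => ?_
  have hn' : (0 : ℝ) < n := by exact_mod_cast hn1
  have hs : (√(n : ℝ))⁻¹ * n = √(n : ℝ) := by
    rw [inv_mul_eq_div, Real.div_sqrt]
  rw [← Finset.mul_sum, hshift, Finset.sum_comm, ← hn]
  have h3 : ∀ (k : ℕ) (j : Fin (p + 1)), f j (z n (k + (1 - (j : ℤ))) ω *
      ξ n (k + (1 - (j : ℤ))) ω) = cdf G₀ (x + outlierCoeff β j *
          (windowVec p (z n) (k + 1) ω j * windowVec p (ξ n) (k + 1) ω j)) - cdf G₀ x := by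
    intro k j
    have h4 : (k : ℤ) + (1 - (j : ℤ)) = k + 1 - j := by ring
    simp only [f, windowVec, h4]
  simp only [Finset.sum_sub_distrib, h3, Finset.sum_const, Finset.card_range, nsmul_eq_mul,
    mul_sub]
  simp only [← Finset.mul_sum, ← mul_assoc, hs]

/-- The mean of the centred autoregression vanishes in probability. -/
theorem vanishes_mean (h : IsLocalSequence P β G₀ H Q K Γ R r q u ε z ξ) (hβ : IsStableAR β)
    (j : Fin p) :
    VanishesInProb P (fun n ω => (n : ℝ)⁻¹ * ∑ k ∈ Finset.range n, lagVec p (u n) (k + 1) ω j) := by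
  have hE : VanishesInProb P (fun n ω => (n : ℝ)⁻¹ * ∑ k ∈ Finset.range n, ε n (k + 1) ω) := by
    have hb : Tendsto (fun n : ℕ => (n : ℝ)⁻¹ * K ^ 2) atTop (𝓝 0) := by
      simpa using tendsto_natCast_atTop_atTop.inv_tendsto_atTop.mul_const (K ^ 2)
    refine VanishesInProb.of_integral_sq hb ?_
    filter_upwards [eventually_ge_atTop 1] with n hn
    obtain ⟨h1, h2⟩ := (h.scheme n hn).integral_sum_innovations_sq_le h.K_nonneg n
    simp only [mul_pow]
    refine ⟨h1.const_mul _, ?_⟩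
    rw [integral_const_mul]
    have hn' : (0 : ℝ) < n := by exact_mod_cast hn
    calc _ ≤ ((n : ℝ)⁻¹) ^ 2 * (n * K ^ 2) := by gcongr
      _ = _ := by field_simp
  have hD : ∀ j : ℕ, VanishesInProb P (fun n ω =>
      (n : ℝ)⁻¹ * ∑ k ∈ Finset.range n, (u n (k + 1) ω - u n (k - j) ω)) := by
    intro j
    refine (VanishesInProb.sum (Finset.range (j + 1)) fun i _ =>
      (h.vanishes_value fun n => (n : ℤ) - i).sub (h.vanishes_value fun _ => -(i : ℤ))).congr ?_
    refine Eventually.of_forall fun n => Eventually.of_forall fun ω => ?_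
    rw [sum_range_sub_shift (fun t => u n t ω), Finset.mul_sum]
    exact Finset.sum_congr rfl fun i _ => by ring
  have hU : VanishesInProb P (fun n ω => (n : ℝ)⁻¹ * ∑ k ∈ Finset.range n, u n (k + 1) ω) := by
    have hne := hβ.one_sub_sum_ne_zero
    -- Averaging the recursion: `(1 - ∑ β)` times the mean of `u` equals the mean of `ε` minus `∑ β
    -- i` times the mean of `u (k+1) - u (k-i)`, and the latter consists of boundary terms only.
    refine (((hE.sub (VanishesInProb.sum (Finset.univ : Finset (Fin p)) fun i _ =>
      (hD (i : ℕ)).const_mul (β i))).const_mul (1 - ∑ j : Fin p, β j)⁻¹)).congr ?_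
    filter_upwards [eventually_ge_atTop 1] with n hn
    filter_upwards [ae_all_iff.2 (h.scheme n hn).recursion] with ω hω
    rw [eq_inv_mul_iff_mul_eq₀ hne]
    have h1 : ∑ k ∈ Finset.range n, ε n (k + 1) ω = ∑ k ∈ Finset.range n, u n (k + 1) ω -
        ∑ i : Fin p, β i * ∑ k ∈ Finset.range n, u n (k - (i : ℕ)) ω := by
      simp only [Finset.mul_sum]
      rw [Finset.sum_comm, ← Finset.sum_sub_distrib]
      refine Finset.sum_congr rfl fun k _ => ?_
      rw [hω (k + 1)]
      have h2 : ∀ i : Fin p, (k : ℤ) + 1 - ((i : ℤ) + 1) = k - (i : ℕ) := fun i => by ring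
      simp only [h2]
      ring
    rw [h1]
    simp only [Finset.sum_sub_distrib, mul_sub, sub_mul, Finset.sum_mul, one_mul]
    have h3 : ∀ i : Fin p, β i * ((n : ℝ)⁻¹ * ∑ k ∈ Finset.range n, u n (k + 1) ω) =
      (n : ℝ)⁻¹ * (β i * ∑ k ∈ Finset.range n, u n (k + 1) ω) := fun i => by ring
    have h4 : ∀ i : Fin p, β i * ((n : ℝ)⁻¹ * ∑ k ∈ Finset.range n, u n (k - (i : ℕ)) ω) =
      (n : ℝ)⁻¹ * (β i * ∑ k ∈ Finset.range n, u n (k - (i : ℕ)) ω) := fun i => by ring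
    simp only [h3, h4, ← Finset.mul_sum]
    ring
  refine (hU.sub (hD (j : ℕ))).congr ?_
  refine Eventually.of_forall fun n => Eventually.of_forall fun ω => ?_
  have h2 : ∀ k : ℕ, (k : ℤ) + 1 - ((j : ℤ) + 1) = k - (j : ℕ) := fun k => by ring
  simp only [lagVec, h2, Finset.sum_sub_distrib]
  ring

/-- Averages of the sizes of the lagged values are bounded in probability. -/
theorem tight_average (h : IsLocalSequence P β G₀ H Q K Γ R r q u ε z ξ) {η : ENNReal}
    (hη : 0 < η) : ∃ B : ℝ, 0 ≤ B ∧ ∀ n, 1 ≤ n →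
      P n {ω | B < (n : ℝ)⁻¹ * ∑ k ∈ Finset.range n, lagSize (lagVec p (u n) (k + 1) ω)} ≤ η := by
  set D : ℝ := 2 * (1 + p * (p * K ^ 2)) with hD
  have hD0 : 0 < D := by positivity
  -- The level `η` may be infinite; capping it at one makes it a positive real, as needed for the
  -- Markov bound.
  set η' : ENNReal := min η 1
  have hη'0 : 0 < η'.toReal := ENNReal.toReal_pos (by simp [η', hη.ne']) (by simp [η'])
  refine ⟨D / η'.toReal, by positivity, fun n hn => ?_⟩
  have hn' : (0 : ℝ) < n := by exact_mod_cast hn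
  let A : Ω n → ℝ := fun ω => (n : ℝ)⁻¹ * ∑ k ∈ Finset.range n, lagSize (lagVec p (u n) (k + 1) ω)
  have hL : ∀ k : ℕ, Integrable (fun ω => lagSize (lagVec p (u n) (k + 1) ω)) (P n) ∧
      ∫ ω, lagSize (lagVec p (u n) (k + 1) ω) ∂P n ≤ D := fun k =>
    (h.scheme n hn).integral_lagSize h.K_nonneg _
  have hA : Integrable A (P n) := (integrable_finsetSum _ fun k _ => (hL k).1).const_mul _
  have hA0 : ∀ ω, 0 ≤ A ω := fun ω => mul_nonneg (by positivity)
    (Finset.sum_nonneg fun k _ => zero_le_one.trans (one_le_lagSize _))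
  have hAD : ∫ ω, A ω ∂P n ≤ D := by
    simp only [A]
    rw [integral_const_mul, integral_finsetSum _ fun k _ => (hL k).1]
    calc _ ≤ (n : ℝ)⁻¹ * (n * D) := by
          refine mul_le_mul_of_nonneg_left ?_ (by positivity)
          refine (Finset.sum_le_card_nsmul _ _ D fun k _ => (hL k).2).trans (le_of_eq ?_)
          rw [Finset.card_range, nsmul_eq_mul]
      _ = D := by field_simp
  have hmk := mul_meas_ge_le_integral_of_nonneg (μ := P n) (Eventually.of_forall hA0) hA
    (D / η'.toReal)
  have hle : (P n).real {ω | D / η'.toReal ≤ A ω} ≤ η'.toReal := by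
    have h1 : D / η'.toReal * (P n).real {ω | D / η'.toReal ≤ A ω} ≤ D := hmk.trans hAD
    rw [div_mul_eq_mul_div, div_le_iff₀ hη'0] at h1
    exact le_of_mul_le_mul_left h1 hD0
  calc P n {ω | D / η'.toReal < A ω} ≤ P n {ω | D / η'.toReal ≤ A ω} :=
        measure_mono (by
          intro ω hω
          rw [mem_ofPred_eq] at hω ⊢
          exact hω.le)
    _ ≤ η' := by
        rw [measureReal_def] at hle
        exact (ENNReal.toReal_le_toReal (by finiteness) (by simp [η'])).1 hle
    _ ≤ η := min_le_left _ _

end IsLocalSequence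

/-! ### Random parameters: compactness and bracketing -/

theorem abs_le_norm_of_prod {p : ℕ} (T : ℝ × (Fin p → ℝ)) :
    |T.1| ≤ ‖T‖ ∧ ∀ j, |T.2 j| ≤ ‖T‖ :=
  ⟨norm_fst_le T, fun j => (norm_le_pi_norm T.2 j).trans (norm_snd_le T)⟩

/-- Perturbations with close parameters differ by at most the band around one of them. -/
theorem bandForm_between {p : ℕ} (T c : ℝ × (Fin p → ℝ)) {l : ℝ} (h : dist T c ≤ l)
    (U : Fin p → ℝ) :
    bandForm c.1 c.2 (-l) U ≤ bandForm T.1 T.2 0 U ∧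
      bandForm T.1 T.2 0 U ≤ bandForm c.1 c.2 l U := by
  rw [dist_eq_norm] at h
  obtain ⟨h1, h2⟩ := abs_le_norm_of_prod (T - c)
  have h3 : |T.1 - c.1| ≤ l := h1.trans h
  have h4 : |∑ j, T.2 j * U j - ∑ j, c.2 j * U j| ≤ l * ∑ j, |U j| := by
    rw [← Finset.sum_sub_distrib, Finset.mul_sum]
    refine (Finset.abs_sum_le_sum_abs _ _).trans (Finset.sum_le_sum fun j _ => ?_)
    rw [← sub_mul, abs_mul]
    exact mul_le_mul_of_nonneg_right ((h2 j).trans h) (abs_nonneg _)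
  rw [abs_le] at h3 h4
  unfold bandForm
  constructor <;> linarith

theorem thresholdShift_between {Ω : Type*} {p : ℕ} (β : EuclideanSpace ℝ (Fin p)) {s : ℝ}
    (hs : 0 ≤ s) (T c : ℝ × (Fin p → ℝ)) {l : ℝ} (h : dist T c ≤ l) (u z ξ : ℤ → Ω → ℝ) (t : ℤ)
    (ω : Ω) :
    thresholdShift β s c.1 c.2 (-l) u z ξ t ω ≤ thresholdShift β s T.1 T.2 0 u z ξ t ω ∧
      thresholdShift β s T.1 T.2 0 u z ξ t ω ≤ thresholdShift β s c.1 c.2 l u z ξ t ω := by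
  obtain ⟨h1, h2⟩ := bandForm_between T c h fun j => lagVec p u t ω j +
      windowVec p z t ω j.succ * windowVec p ξ t ω j.succ
  unfold thresholdShift
  constructor <;> gcongr

theorem indicator_Iic_mono {a b : ℝ} (h : a ≤ b) (e : ℝ) :
    (Iic a).indicator (1 : ℝ → ℝ) e ≤ (Iic b).indicator 1 e :=
  indicator_le_indicator_of_subset (Iic_subset_Iic.2 h) (fun _ => zero_le_one) e

/-- The normalized increment of the empirical distribution function of the innovations at the
thresholds shifted by the outliers and a perturbation. -/
noncomputable def shiftedIncrement {Ω : Type*} {p : ℕ} (β : EuclideanSpace ℝ (Fin p)) (n : ℕ)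
    (x τ₀ : ℝ) (τ : Fin p → ℝ) (l : ℝ) (u ε z ξ : ℤ → Ω → ℝ) (ω : Ω) : ℝ :=
  (√(n : ℝ))⁻¹ * ∑ k ∈ Finset.range n,
    ((Iic (x + thresholdShift β (√(n : ℝ))⁻¹ τ₀ τ l u z ξ (k + 1) ω)).indicator 1
      (ε (k + 1) ω) - (Iic x).indicator 1 (ε (k + 1) ω))

theorem shiftedIncrement_mono {Ω : Type*} {p : ℕ} (β : EuclideanSpace ℝ (Fin p)) (n : ℕ)
    (x : ℝ) {τ₀ τ₀' : ℝ} {τ τ' : Fin p → ℝ} {l l' : ℝ} {u ε z ξ : ℤ → Ω → ℝ} {ω : Ω}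
    (h : ∀ t, thresholdShift β (√(n : ℝ))⁻¹ τ₀ τ l u z ξ t ω ≤
      thresholdShift β (√(n : ℝ))⁻¹ τ₀' τ' l' u z ξ t ω) :
    shiftedIncrement β n x τ₀ τ l u ε z ξ ω ≤ shiftedIncrement β n x τ₀' τ' l' u ε z ξ ω := by
  unfold shiftedIncrement
  refine mul_le_mul_of_nonneg_left (Finset.sum_le_sum fun k _ => ?_) (by positivity)
  exact sub_le_sub_right (indicator_Iic_mono (by linarith [h (k + 1)]) _) _

namespace IsLocalSequence

variable {Ω : ℕ → Type*} [∀ n, MeasurableSpace (Ω n)] {P : ∀ n, Measure (Ω n)}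
    [∀ n, IsProbabilityMeasure (P n)]
    {p : ℕ} {β : EuclideanSpace ℝ (Fin p)} {G₀ H Q : Measure ℝ} {K Γ R : ℝ} {r q : ℕ → ℝ}
    {u ε z ξ : ∀ n, ℤ → Ω n → ℝ} [IsProbabilityMeasure G₀] [IsProbabilityMeasure H]
    [IsProbabilityMeasure Q]

/-- First order expansion of the shifted increment for fixed parameters. -/
theorem vanishes_shiftedIncrement (h : IsLocalSequence P β G₀ H Q K Γ R r q u ε z ξ)
    (hβ : IsStableAR β) (hG : HasSmoothCDF G₀) (hH : HasSmoothCDF H) {γ : ℕ → ℝ}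
    (hγ : ∀ᶠ n : ℕ in atTop, √(n : ℝ) * q n = γ n) (x τ₀ : ℝ) (τ : Fin p → ℝ) (l : ℝ) :
    VanishesInProb P (fun n ω =>
      shiftedIncrement β n x τ₀ τ l (u n) (ε n) (z n) (ξ n) ω - γ n * outlierShift G₀ Q β x -
        deriv (fun y => cdf G₀ y) x * (τ₀ + l * ((n : ℝ)⁻¹ *
          ∑ k ∈ Finset.range n, lagSize (lagVec p (u n) (k + 1) ω)))) := by
  set g := deriv (fun y => cdf G₀ y) x with hg
  -- The `τ j` terms enter through sample means of lagged values and vanish; of the linear form only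
  -- `τ₀` and the band survive.
  have hmean := (VanishesInProb.sum (Finset.univ : Finset (Fin p)) fun j _ =>
    (h.vanishes_mean hβ j).const_mul (τ j)).const_mul g
  refine (((((h.vanishes_noise hG hH x τ₀ τ l).add (h.vanishes_alternative hG hH x τ₀ τ l)).add
    (h.vanishes_remainder hG x τ₀ τ l)).add (h.vanishes_outliers hγ x)).add hmean).congr ?_
  filter_upwards [eventually_ge_atTop 1] with n hn
  refine Eventually.of_forall fun ω => ?_
  have hn' : (0 : ℝ) < n := by exact_mod_cast hn
  have hh : (√(n : ℝ))⁻¹ * (√(n : ℝ))⁻¹ = (n : ℝ)⁻¹ := by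
    rw [← mul_inv, Real.mul_self_sqrt hn'.le]
  have hband : (n : ℝ)⁻¹ * ∑ k ∈ Finset.range n, bandForm τ₀ τ l (lagVec p (u n) (k + 1) ω) =
      τ₀ + ∑ j, τ j * ((n : ℝ)⁻¹ * ∑ k ∈ Finset.range n, lagVec p (u n) (k + 1) ω j) +
        l * ((n : ℝ)⁻¹ * ∑ k ∈ Finset.range n, lagSize (lagVec p (u n) (k + 1) ω)) := by
    simp only [bandForm, lagSize, Finset.sum_add_distrib (s := Finset.range n), mul_add]
    rw [Finset.sum_comm (s := Finset.range n) (f := fun k j => τ j * lagVec p (u n) (k + 1) ω j)]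
    simp only [Finset.sum_const, Finset.card_range, nsmul_eq_mul, ← Finset.mul_sum]
    have h1 : ∀ y, (n : ℝ)⁻¹ * (n * y) = y := fun y => by field_simp
    have h2 : ∑ j, τ j * ((n : ℝ)⁻¹ * ∑ k ∈ Finset.range n, lagVec p (u n) (k + 1) ω j) =
        (n : ℝ)⁻¹ * ∑ j, τ j * ∑ k ∈ Finset.range n, lagVec p (u n) (k + 1) ω j := by
      rw [Finset.mul_sum]
      exact Finset.sum_congr rfl fun j _ => by ring
    rw [h1, h1, h2]
    linear_combination (-l) * inv_mul_cancel₀ hn'.ne'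
  have hlin : (√(n : ℝ))⁻¹ * ∑ k ∈ Finset.range n, (√(n : ℝ))⁻¹ * g *
      bandForm τ₀ τ l (lagVec p (u n) (k + 1) ω) = g * (τ₀ + ∑ j, τ j * ((n : ℝ)⁻¹ *
        ∑ k ∈ Finset.range n, lagVec p (u n) (k + 1) ω j) + l * ((n : ℝ)⁻¹ *
          ∑ k ∈ Finset.range n, lagSize (lagVec p (u n) (k + 1) ω))) := by
    rw [← hband, ← Finset.mul_sum, ← hh]
    ring
  rw [mul_add, mul_add] at hlin
  simp only [shiftedIncrement, indicatorNoise, Finset.sum_sub_distrib, mul_sub] at hlin ⊢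
  rw [hlin]
  ring

/-- Expansion of the shifted increment at random parameters bounded in probability. -/
theorem vanishes_shiftedIncrement_random (h : IsLocalSequence P β G₀ H Q K Γ R r q u ε z ξ)
    (hβ : IsStableAR β) (hG : HasSmoothCDF G₀) (hH : HasSmoothCDF H) {γ : ℕ → ℝ}
    (hγ : ∀ᶠ n : ℕ in atTop, √(n : ℝ) * q n = γ n) {T : ∀ n, Ω n → ℝ × (Fin p → ℝ)}
    (hT : ∀ η : ENNReal, 0 < η → ∃ M : ℝ, ∀ᶠ n in atTop, P n {ω | M < ‖T n ω‖} ≤ η) (x : ℝ) :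
    VanishesInProb P (fun n ω =>
      shiftedIncrement β n x (T n ω).1 (T n ω).2 0 (u n) (ε n) (z n) (ξ n) ω -
        γ n * outlierShift G₀ Q β x - deriv (fun y => cdf G₀ y) x * (T n ω).1) := by
  intro δ hδ
  set g := deriv (fun y => cdf G₀ y) x with hg
  rw [ENNReal.tendsto_nhds_zero]
  intro η hη
  have hη3 : 0 < η / 3 := ENNReal.div_pos hη.ne' (by simp)
  obtain ⟨M, hM⟩ := hT (η / 3) hη3
  obtain ⟨B, hB0, hB⟩ := h.tight_average hη3
  -- The radius is chosen so that moving the parameter to a centre (cost `|g| l`) and the band (cost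
  -- `|g| l B`) together cost at most `δ / 2`.
  set l : ℝ := δ / (2 * (|g| + 1) * (1 + B)) with hl
  have hl0 : 0 < l := by positivity
  have hgl : |g| * (l * (1 + B)) ≤ δ / 2 := by
    have h1 : l * (1 + B) * (2 * (|g| + 1)) = δ := by
      rw [hl]
      field_simp
    have h2 : 0 ≤ l * (1 + B) := by positivity
    nlinarith [abs_nonneg g]
  obtain ⟨S, -, hSfin, hScov⟩ := (isCompact_closedBall (0 : ℝ × (Fin p → ℝ)) M).finite_cover_balls
    hl0
  -- The expansion error at a deterministic centre and band, known to vanish. Only the finitely many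
  -- centres of the net, with bands `± l`, are needed.
  let Z : ℝ × (Fin p → ℝ) → ℝ → ∀ n, Ω n → ℝ := fun c l n ω =>
    shiftedIncrement β n x c.1 c.2 l (u n) (ε n) (z n) (ξ n) ω - γ n * outlierShift G₀ Q β x -
        g * (c.1 + l * ((n : ℝ)⁻¹ * ∑ k ∈ Finset.range n, lagSize (lagVec p (u n) (k + 1) ω)))
  have hZ : ∀ c l, VanishesInProb P (Z c l) := fun c l =>
    h.vanishes_shiftedIncrement hβ hG hH hγ x c.1 c.2 l
  have hsum : Tendsto (fun n => ∑ c ∈ hSfin.toFinset, (P n {ω | δ / 2 < |Z c l n ω|} +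
      P n {ω | δ / 2 < |Z c (-l) n ω|})) atTop (𝓝 0) := by
    have h1 := tendsto_finsetSum hSfin.toFinset fun c _ =>
      (hZ c l (δ / 2) (by positivity)).add (hZ c (-l) (δ / 2) (by positivity))
    simpa using h1
  filter_upwards [hM, (ENNReal.tendsto_nhds_zero.1 hsum) (η / 3) hη3, eventually_ge_atTop 1]
    with n hMn hZn hn
  have hcover : {ω | δ < |shiftedIncrement β n x (T n ω).1 (T n ω).2 0 (u n) (ε n) (z n) (ξ n) ω -
        γ n * outlierShift G₀ Q β x - g * (T n ω).1|} ⊆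
      {ω | M < ‖T n ω‖} ∪ {ω | B < (n : ℝ)⁻¹ * ∑ k ∈ Finset.range n,
        lagSize (lagVec p (u n) (k + 1) ω)} ∪
      ⋃ c ∈ hSfin.toFinset, ({ω | δ / 2 < |Z c l n ω|} ∪ {ω | δ / 2 < |Z c (-l) n ω|}) := by
    intro ω hω
    by_contra hc
    simp only [mem_union, mem_iUnion, mem_ofPred_eq, not_or, not_exists, not_lt] at hc hω
    obtain ⟨⟨hc1, hc2⟩, hc3⟩ := hc
    have hmem : T n ω ∈ Metric.closedBall (0 : ℝ × (Fin p → ℝ)) M := by simpa using hc1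
    obtain ⟨c, hcS, hcd⟩ := mem_iUnion₂.1 (hScov hmem)
    have hd : dist (T n ω) c ≤ l := (Metric.mem_ball.1 hcd).le
    obtain ⟨hz1, hz2⟩ := hc3 c (hSfin.mem_toFinset.2 hcS)
    set A := (n : ℝ)⁻¹ * ∑ k ∈ Finset.range n, lagSize (lagVec p (u n) (k + 1) ω) with hA
    have hA0 : 0 ≤ A := mul_nonneg (by positivity)
      (Finset.sum_nonneg fun k _ => zero_le_one.trans (one_le_lagSize _))
    -- The bracketing holds pathwise for every outlier configuration, so the random parameter is
    -- replaced by a centre without conditioning on it.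
    have hup := shiftedIncrement_mono β n x (ε := ε n) fun t =>
      (thresholdShift_between β (s := (√(n : ℝ))⁻¹) (by positivity) (T n ω) c hd (u n) (z n) (ξ n)
        t ω).2
    have hlow := shiftedIncrement_mono β n x (ε := ε n) fun t =>
      (thresholdShift_between β (s := (√(n : ℝ))⁻¹) (by positivity) (T n ω) c hd (u n) (z n) (ξ n)
        t ω).1
    have hc1 : |(T n ω).1 - c.1| ≤ l := by
      have := (abs_le_norm_of_prod (T n ω - c)).1
      rw [← dist_eq_norm] at this
      exact this.trans hd
    have hg1 : |g * ((T n ω).1 - c.1)| ≤ |g| * l := by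
      rw [abs_mul]
      gcongr
    have hg2 : |g * (l * A)| ≤ |g| * (l * B) := by
      rw [abs_mul, abs_of_nonneg (show 0 ≤ l * A by positivity)]
      gcongr
    have hgl' : |g| * l + |g| * (l * B) ≤ δ / 2 := by linarith
    rw [abs_le] at hz1 hz2 hg1 hg2
    simp only [Z, ← hA] at hz1 hz2
    refine absurd hω (not_lt.2 ?_)
    rw [abs_le]
    constructor
    · linarith [hz2.1, hg1.1, hg1.2, hg2.1, hg2.2]
    · linarith [hz1.2, hg1.1, hg1.2, hg2.1, hg2.2]
  calc _ ≤ _ := measure_mono hcover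
    _ ≤ P n {ω | M < ‖T n ω‖} + P n {ω | B < (n : ℝ)⁻¹ * ∑ k ∈ Finset.range n,
        lagSize (lagVec p (u n) (k + 1) ω)} + P n (⋃ c ∈ hSfin.toFinset,
          ({ω | δ / 2 < |Z c l n ω|} ∪ {ω | δ / 2 < |Z c (-l) n ω|})) :=
      (measure_union_le _ _).trans (by gcongr; exact measure_union_le _ _)
    _ ≤ η / 3 + η / 3 + η / 3 := by
      refine add_le_add (add_le_add hMn (hB n hn)) (le_trans ?_ hZn)
      exact (measure_biUnion_finset_le _ _).trans
        (Finset.sum_le_sum fun c _ => measure_union_le _ _)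
    _ = η := ENNReal.add_thirds η

end IsLocalSequence

/-! ### Residuals, scaled estimation errors and uniformity -/

theorem sum_Icc_int_eq_sum_range (n : ℕ) (f : ℤ → ℝ) :
    ∑ t ∈ Finset.Icc (1 : ℤ) n, f t = ∑ k ∈ Finset.range n, f (k + 1) := by
  symm
  refine Finset.sum_bij (fun k _ => (k : ℤ) + 1) (fun k hk => ?_) (fun a _ b _ hab => ?_)
    (fun t ht => ?_) fun k _ => rfl
  · rw [Finset.mem_range] at hk
    rw [Finset.mem_Icc]
    omega
  · simpa using hab
  · rw [Finset.mem_Icc] at ht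
    exact ⟨(t - 1).toNat, by rw [Finset.mem_range]; omega, by omega⟩

theorem sqrt_mul_inv_natCast (n : ℕ) : √(n : ℝ) * (n : ℝ)⁻¹ = (√(n : ℝ))⁻¹ := by
  rw [← div_eq_mul_inv, Real.sqrt_div_self]

/-- The scaled estimation errors, as they enter the residuals. -/
noncomputable def scaledError {p : ℕ} (β : EuclideanSpace ℝ (Fin p)) (μ : ℝ) (n : ℕ) (m : ℝ)
    (b : EuclideanSpace ℝ (Fin p)) : ℝ × (Fin p → ℝ) :=
  (√(n : ℝ) * (m - μ) * (1 - ∑ j, b j), fun j => √(n : ℝ) * (b j - β j))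

/-- A residual lies below `x` iff the innovation lies below the shifted threshold. -/
theorem arResidual_le_iff {Ω : Type*} {p : ℕ} {β : EuclideanSpace ℝ (Fin p)} {μ : ℝ}
    {u v ε z ξ : ℤ → Ω → ℝ} {ω : Ω} (hv : ∀ t, v t ω = u t ω + μ) {t : ℤ}
    (hrec : u t ω = ∑ j : Fin p, β j * u (t - ((j : ℤ) + 1)) ω + ε t ω) {n : ℕ} (hn : 1 ≤ n)
    (m : ℝ) (b : EuclideanSpace ℝ (Fin p)) (x : ℝ) :
    arResidual (fun t => observation v z ξ t ω) m b t ≤ x ↔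
      ε t ω ≤ x + thresholdShift β (√(n : ℝ))⁻¹ (scaledError β μ n m b).1
        (scaledError β μ n m b).2 0 u z ξ t ω := by
  have hs : (√(n : ℝ))⁻¹ * √(n : ℝ) = 1 := by
    have : (0 : ℝ) < n := by exact_mod_cast hn
    exact inv_mul_cancel₀ (Real.sqrt_pos.2 this).ne'
  set w : ℤ → ℝ := fun t => z t ω * ξ t ω with hw
  have hj : ∀ j : Fin p, t - ((j.succ : Fin (p + 1)) : ℤ) = t - ((j : ℤ) + 1) := fun j => by
    simp
  have h1 : thresholdShift β (√(n : ℝ))⁻¹ (scaledError β μ n m b).1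
        (scaledError β μ n m b).2 0 u z ξ t ω = -w t + ∑ j : Fin p, β j * w (t - ((j : ℤ) + 1)) +
      ((m - μ) * (1 - ∑ j, b j) + ∑ j : Fin p, (b j - β j) *
        (u (t - ((j : ℤ) + 1)) ω + w (t - ((j : ℤ) + 1)))) := by
    unfold thresholdShift bandForm scaledError lagVec windowVec outlierCoeff
    rw [Fin.sum_univ_succ]
    simp only [Fin.cons_zero, Fin.cons_succ, hj, zero_mul, mul_add, Finset.sum_const_zero,
      Finset.mul_sum, Fin.val_zero, Nat.cast_zero, sub_zero, hw]
    have h2 : ∀ y : ℝ, (√(n : ℝ))⁻¹ * (√(n : ℝ) * y) = y := fun y => by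
      rw [← mul_assoc, hs, one_mul]
    simp only [mul_assoc, h2]
    ring
  -- This identity is exact: the product of the two estimation errors is absorbed because `τ₀`
  -- carries the factor `1 - ∑ b j` with the estimated coefficients.
  have h3 : arResidual (fun t => observation v z ξ t ω) m b t = ε t ω -
      (-w t + ∑ j : Fin p, β j * w (t - ((j : ℤ) + 1)) +
      ((m - μ) * (1 - ∑ j, b j) + ∑ j : Fin p, (b j - β j) *
        (u (t - ((j : ℤ) + 1)) ω + w (t - ((j : ℤ) + 1))))) := by
    simp only [arResidual, observation, hv, hw]
    rw [hrec]
    simp only [mul_sub, sub_mul, mul_add, Finset.sum_sub_distrib, Finset.sum_add_distrib,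
      ← Finset.sum_mul]
    ring
  rw [h1, h3, sub_le_iff_le_add]

theorem empCDF_sub_eq_shiftedIncrement {Ω : Type*} {p : ℕ} {β : EuclideanSpace ℝ (Fin p)} {μ : ℝ}
    {u v ε z ξ : ℤ → Ω → ℝ} {ω : Ω} (hv : ∀ t, v t ω = u t ω + μ)
    (hrec : ∀ t, u t ω = ∑ j : Fin p, β j * u (t - ((j : ℤ) + 1)) ω + ε t ω) {n : ℕ} (hn : 1 ≤ n)
    (m : ℝ) (b : EuclideanSpace ℝ (Fin p)) (x : ℝ) :
    √(n : ℝ) * (empCDF n (arResidual (fun t => observation v z ξ t ω) m b) x -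
      empCDF n (fun t => ε t ω) x) =
      shiftedIncrement β n x (scaledError β μ n m b).1 (scaledError β μ n m b).2 0 u ε z ξ ω := by
  have h1 : ∀ t, (Iic x).indicator (1 : ℝ → ℝ)
      (arResidual (fun t => observation v z ξ t ω) m b t) =
      (Iic (x + thresholdShift β (√(n : ℝ))⁻¹ (scaledError β μ n m b).1
        (scaledError β μ n m b).2 0 u z ξ t ω)).indicator 1 (ε t ω) := by
    intro t
    simp only [indicator, mem_Iic, arResidual_le_iff hv (hrec t) hn m b x]
    rfl
  unfold empCDF shiftedIncrement
  rw [← mul_sub, ← mul_assoc, sqrt_mul_inv_natCast, sum_Icc_int_eq_sum_range,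
    sum_Icc_int_eq_sum_range, ← Finset.sum_sub_distrib]
  simp only [h1]

/-- The scaled errors are bounded in terms of the errors of the two estimators. -/
theorem norm_scaledError_le {p : ℕ} (β : EuclideanSpace ℝ (Fin p)) (μ : ℝ) {n : ℕ} (hn : 1 ≤ n)
    {m : ℝ} {b : EuclideanSpace ℝ (Fin p)} {M : ℝ} (hm : ‖√(n : ℝ) * (m - μ)‖ ≤ M)
    (hb : ‖√(n : ℝ) • (b - β)‖ ≤ M) :
    ‖scaledError β μ n m b‖ ≤ M * (1 + ∑ j, |β j| + p * M) + M := by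
  have hM : 0 ≤ M := (norm_nonneg _).trans hm
  have hn1 : (1 : ℝ) ≤ √(n : ℝ) := by
    rw [Real.one_le_sqrt]
    exact_mod_cast hn
  have hcoord : ∀ j, |√(n : ℝ) * (b j - β j)| ≤ M := fun j => by
    have := PiLp.norm_apply_le (√(n : ℝ) • (b - β)) j
    simpa using this.trans hb
  have hdiff : ∀ j, |b j| ≤ |β j| + M := fun j => by
    have h1 := hcoord j
    rw [abs_mul, abs_of_nonneg (zero_le_one.trans hn1)] at h1
    have h2 : |b j - β j| ≤ M := (le_mul_of_one_le_left (abs_nonneg _) hn1).trans h1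
    have h3 := abs_add_le (β j) (b j - β j)
    rw [add_sub_cancel] at h3
    linarith
  have hsum : |1 - ∑ j, b j| ≤ 1 + ∑ j, |β j| + p * M := by
    have h1 := abs_sub 1 (∑ j, b j)
    have h2 : |∑ j, b j| ≤ ∑ j, |β j| + p * M := by
      refine (Finset.abs_sum_le_sum_abs _ _).trans
        ((Finset.sum_le_sum fun j _ => hdiff j).trans (le_of_eq ?_))
      rw [Finset.sum_add_distrib]
      simp
    rw [abs_one] at h1
    linarith
  have hS : 0 ≤ ∑ j, |β j| := Finset.sum_nonneg fun _ _ => abs_nonneg _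
  rw [Prod.norm_def]
  refine max_le ?_ ((pi_norm_le_iff_of_nonneg (by positivity)).2 fun j => ?_)
  · rw [scaledError, norm_mul]
    exact (mul_le_mul hm hsum (abs_nonneg _) hM).trans (by linarith)
  · have h1 : 0 ≤ M * (1 + ∑ j, |β j| + p * M) := by positivity
    exact (hcoord j).trans (by linarith)

theorem localLevel_nonneg {c : ℝ} (hc : 0 ≤ c) (n : ℕ) : 0 ≤ localLevel c n :=
  le_min zero_le_one (by positivity)

theorem localLevel_le {c C : ℝ} (hc : c ≤ C) (n : ℕ) : localLevel c n ≤ C * (√(n : ℝ))⁻¹ := by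
  refine (min_le_right _ _).trans ?_
  rw [div_eq_mul_inv]
  gcongr

/-- The cap at one is inactive as soon as `√n ≥ C`, a threshold common to all admissible sequences.
-/
theorem eventually_sqrt_mul_localLevel {c : ℕ → ℝ} {C : ℝ} (hc : ∀ n, c n ≤ C) :
    ∀ᶠ n : ℕ in atTop, √(n : ℝ) * localLevel (c n) n = c n := by
  have h1 : Tendsto (fun n : ℕ => √(n : ℝ)) atTop atTop :=
    Real.tendsto_sqrt_atTop.comp tendsto_natCast_atTop_atTop
  filter_upwards [h1.eventually_ge_atTop C, h1.eventually_gt_atTop 0] with n hn hn0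
  rw [localLevel, min_eq_right ((div_le_one hn0).2 ((hc n).trans hn)), mul_div_cancel₀ _ hn0.ne']

/-- A supremum over two bounded parameters tends to zero if this holds along all parameter
sequences. -/
theorem tendsto_iSup_Icc_of_sequences {Γ R : ℝ} (hΓ : 0 ≤ Γ) (hR : 0 ≤ R)
    {f : ℕ → ℝ → ℝ → ENNReal}
    (h : ∀ γ ρ : ℕ → ℝ, (∀ n, γ n ∈ Icc 0 Γ) → (∀ n, ρ n ∈ Icc 0 R) →
      Tendsto (fun n => f n (γ n) (ρ n)) atTop (𝓝 0)) :
    Tendsto (fun n => ⨆ γ ∈ Icc 0 Γ, ⨆ ρ ∈ Icc 0 R, f n γ ρ) atTop (𝓝 0) := by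
  rw [ENNReal.tendsto_nhds_zero]
  intro η hη
  -- For each `n` a parameter pair violating the level `η` is selected if there is one, and `(0, 0)`
  -- otherwise; convergence along this single sequence controls the supremum.
  have hsel : ∀ n, ∃ a : ℝ × ℝ, a.1 ∈ Icc 0 Γ ∧ a.2 ∈ Icc 0 R ∧
      (f n a.1 a.2 ≤ η → (⨆ γ ∈ Icc 0 Γ, ⨆ ρ ∈ Icc 0 R, f n γ ρ) ≤ η) := by
    intro n
    by_cases hb : ∃ γ ∈ Icc 0 Γ, ∃ ρ ∈ Icc 0 R, η < f n γ ρ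
    · obtain ⟨γ, hγ, ρ, hρ, hlt⟩ := hb
      exact ⟨(γ, ρ), hγ, hρ, fun hle => absurd hle (not_le.2 hlt)⟩
    · push Not at hb
      exact ⟨(0, 0), ⟨le_rfl, hΓ⟩, ⟨le_rfl, hR⟩, fun _ =>
        iSup₂_le fun γ hγ => iSup₂_le fun ρ hρ => hb γ hγ ρ hρ⟩
  choose a h1 h2 h3 using hsel
  have := ENNReal.tendsto_nhds_zero.1 (h (fun n => (a n).1) (fun n => (a n).2) h1 h2) η hη
  filter_upwards [this] with n hn using h3 n hn

theorem mainTheorem4 {p : ℕ} (β : EuclideanSpace ℝ (Fin p)) (hβ : IsStableAR β)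
    (ν μ : ℝ) (hμ : ν = (1 - ∑ j : Fin p, β j) * μ)
    (G₀ H Q : Measure ℝ) [IsProbabilityMeasure G₀] [IsProbabilityMeasure H]
    [IsProbabilityMeasure Q]
    (hG₀ : IsCenteredL2 G₀) (hH : IsCenteredL2 H)
    (hG₀' : HasSmoothCDF G₀) (hH' : HasSmoothCDF H)
    (hsymm : G₀.map (fun x => -x) = G₀)
    (Γ R : ℝ) (hΓ : 0 ≤ Γ) (hR : 0 ≤ R)
    {Ω : ℕ → ℝ → ℝ → Type*} [∀ n γ ρ, MeasurableSpace (Ω n γ ρ)]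
    (P : ∀ n γ ρ, Measure (Ω n γ ρ)) [∀ n γ ρ, IsProbabilityMeasure (P n γ ρ)]
    (v ε z ξ : ∀ n γ ρ, ℤ → Ω n γ ρ → ℝ)
    (hmodel : ∀ n, 1 ≤ n → ∀ γ ∈ Icc 0 Γ, ∀ ρ ∈ Icc 0 R,
      IsARScheme (P n γ ρ) β ν (mixtureCDF G₀ H (localLevel ρ n)) (localLevel γ n) Q
        (v n γ ρ) (ε n γ ρ) (z n γ ρ) (ξ n γ ρ))
    (μhat : ∀ n γ ρ, Ω n γ ρ → ℝ) (βhat : ∀ n γ ρ, Ω n γ ρ → EuclideanSpace ℝ (Fin p))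
    (hμhat_meas : ∀ n γ ρ, Measurable (μhat n γ ρ))
    (hβhat_meas : ∀ n γ ρ, Measurable (βhat n γ ρ))
    (hμhat : IsUniformlyOPOne P Γ R (fun n γ ρ ω => √(n : ℝ) * (μhat n γ ρ ω - μ)))
    (hβhat : IsUniformlyOPOne P Γ R (fun n γ ρ ω => √(n : ℝ) • (βhat n γ ρ ω - β)))
    (x δ : ℝ) (hδ : 0 < δ) :
    Tendsto (fun n : ℕ => ⨆ γ ∈ Icc 0 Γ, ⨆ ρ ∈ Icc 0 R,
      P n γ ρ {ω | δ < |√(n : ℝ) *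
        (symCDF (empCDF n (arResidual (fun t => observation (v n γ ρ) (z n γ ρ) (ξ n γ ρ) t ω)
            (μhat n γ ρ ω) (βhat n γ ρ ω))) x
          - symCDF (empCDF n (fun t => ε n γ ρ t ω)) x)
        - γ * symShift G₀ Q β x|})
      atTop (𝓝 0) := by
  refine tendsto_iSup_Icc_of_sequences hΓ hR fun γ ρ hγ hρ => ?_
  obtain ⟨K, hK, hcausal⟩ := hβ.exists_causalScheme hμ hG₀ hH
  have hex : ∀ n, ∃ u : ℤ → Ω n (γ n) (ρ n) → ℝ, 1 ≤ n →
      IsCausalScheme (P n (γ n) (ρ n)) β (mixtureLaw G₀ H (localLevel (ρ n) n))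
        (localLevel (γ n) n) Q K u (ε n (γ n) (ρ n)) (z n (γ n) (ρ n)) (ξ n (γ n) (ρ n)) ∧
      ∀ t, ∀ᵐ ω ∂P n (γ n) (ρ n), v n (γ n) (ρ n) t ω = u t ω + μ := by
    intro n
    by_cases hn : 1 ≤ n
    · obtain ⟨u, hu⟩ := hcausal _ _ _ _ _ _ _ _ (localLevel_nonneg (hρ n).1 n) (min_le_left _ _)
        (hmodel n hn (γ n) (hγ n) (ρ n) (hρ n))
      exact ⟨u, fun _ => hu⟩
    · exact ⟨fun _ _ => 0, fun h => absurd h hn⟩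
  choose u hu using hex
  have hloc : IsLocalSequence (fun n => P n (γ n) (ρ n)) β G₀ H Q K Γ R
      (fun n => localLevel (ρ n) n) (fun n => localLevel (γ n) n) u
      (fun n => ε n (γ n) (ρ n)) (fun n => z n (γ n) (ρ n)) (fun n => ξ n (γ n) (ρ n)) :=
    { scheme := fun n hn => (hu n hn).1
      K_nonneg := hK
      r_nonneg := fun n => localLevel_nonneg (hρ n).1 n
      r_le_one := fun n => min_le_left _ _
      r_le := fun n _ => localLevel_le (hρ n).2 n
      q_le := fun n _ => localLevel_le (hγ n).2 n }
  have hlev : ∀ᶠ n : ℕ in atTop, √(n : ℝ) * localLevel (γ n) n = γ n :=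
    eventually_sqrt_mul_localLevel fun n => (hγ n).2
  let T : ∀ n, Ω n (γ n) (ρ n) → ℝ × (Fin p → ℝ) := fun n ω =>
    scaledError β μ n (μhat n (γ n) (ρ n) ω) (βhat n (γ n) (ρ n) ω)
  have hT : ∀ η : ENNReal, 0 < η → ∃ M : ℝ, ∀ᶠ n in atTop,
      P n (γ n) (ρ n) {ω | M < ‖T n ω‖} ≤ η := by
    intro η hη
    set η' : ENNReal := min η 1
    have hη' : 0 < η'.toReal := ENNReal.toReal_pos (by simp [η', hη.ne']) (by simp [η'])
    obtain ⟨M₁, hM₁⟩ := hμhat (η'.toReal / 2) (by positivity)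
    obtain ⟨M₂, hM₂⟩ := hβhat (η'.toReal / 2) (by positivity)
    set M := max M₁ M₂
    refine ⟨M * (1 + ∑ j, |β j| + p * M) + M, ?_⟩
    filter_upwards [hM₁, hM₂, eventually_ge_atTop 1] with n h₁ h₂ hn
    have hsub : {ω | M * (1 + ∑ j, |β j| + p * M) + M < ‖T n ω‖} ⊆
        {ω | M₁ < ‖√(n : ℝ) * (μhat n (γ n) (ρ n) ω - μ)‖} ∪
        {ω | M₂ < ‖√(n : ℝ) • (βhat n (γ n) (ρ n) ω - β)‖} := by
      intro ω hω
      by_contra hc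
      simp only [mem_union, mem_ofPred_eq, not_or, not_lt] at hc hω
      exact absurd hω (not_lt.2 (norm_scaledError_le β μ hn (hc.1.trans (le_max_left _ _))
        (hc.2.trans (le_max_right _ _))))
    have h3 : (P n (γ n) (ρ n)).real {ω | M * (1 + ∑ j, |β j| + p * M) + M < ‖T n ω‖} ≤
        η'.toReal :=
      (measureReal_mono hsub).trans ((measureReal_union_le _ _).trans
        ((add_le_add (h₁ _ (hγ n) _ (hρ n)) (h₂ _ (hγ n) _ (hρ n))).trans (by linarith)))
    rw [measureReal_def] at h3
    exact ((ENNReal.toReal_le_toReal (by finiteness) (by simp [η'])).1 h3).trans (min_le_left _ _)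
  have hplus := hloc.vanishes_shiftedIncrement_random hβ hG₀' hH' hlev hT x
  have hminus := hloc.vanishes_shiftedIncrement_random hβ hG₀' hH' hlev hT (-x)
  -- Half the difference of the expansions at `x` and `-x`. Both contain the same `τ₀`, with
  -- coefficients `G₀'(x)` and `G₀'(-x)`, which agree by symmetry, so the estimation error drops
  -- out.
  refine ((hplus.sub hminus).const_mul (1 / 2)).congr ?_ δ hδ
  filter_upwards [eventually_ge_atTop 1] with n hn
  filter_upwards [ae_all_iff.2 (hu n hn).2, ae_all_iff.2 (hu n hn).1.recursion] with ω hv hrec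
  have hx := fun y => empCDF_sub_eq_shiftedIncrement (z := z n (γ n) (ρ n))
    (ξ := ξ n (γ n) (ρ n)) hv hrec hn (μhat n (γ n) (ρ n) ω) (βhat n (γ n) (ρ n) ω) y
  rw [hG₀'.deriv_neg hsymm x]
  simp only [T]
  rw [← hx x, ← hx (-x)]
  unfold symCDF symShift
  ring
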